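/- Let $X$ be a compact complex manifold of dimension $n$ and let $\omega_0=\sqrt{-1}\,(g_0)_{i\bar j}\,dz^i\wedge d\bar z^j$ be a Hermitian metric on $X$ with $\partial\bar\partial\omega_0^k=0$ for $k=1,2$. Assume $c_1^{\mathrm{BC}}(X)=0$ and let $F$ be the Chern–Ricci potential of $\omega_0$, i.e. $F$ is a smooth real function with $\mathrm{Ric}(\omega_0)=-\sqrt{-1}\partial\bar\partial\log\det g_0=\sqrt{-1}\partial\bar\partial F$ and $\int_X e^F\omega_0^n=\int_X\omega_0^n=:V$. For a smooth real function $\varphi$ with $\omega_\varphi:=\omega_0+\sqrt{-1}\partial\bar\partial\varphi>0$, with metric coefficients $g_\varphi$, put $$\mathrm{Mab}_{\omega_0}(\omega_\varphi)=\frac1V\int_X\Big(\log\frac{\det g_\varphi}{\det g_0}-F\Big)\omega_\varphi^n+\frac1V\int_X F\,\omega_0^n,$$ $$P(\varphi)=R_\varphi+2\,\mathrm{Re}\Big(g_\varphi^{j\bar k}\,(\mathrm{tr}\,T_\varphi)_j\,\partial_{\bar k}\Big(\log\frac{\det g_\varphi}{\det g_0}-F\Big)\Big),$$ where $R_\varphi=-g_\varphi^{i\bar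 j}\partial_i\partial_{\bar j}\log\det g_\varphi$ is the Chern scalar curvature of $\omega_\varphi$ and $(\mathrm{tr}\,T_\varphi)_j=T^p_{pj}$ is the trace of the torsion $T^k_{ij}=\Gamma^k_{ij}-\Gamma^k_{ji}$ of its Chern connection, $\Gamma^k_{ij}=g_\varphi^{k\bar p}\partial_i (g_\varphi)_{j\bar p}$. Then: 1. Let $0<T\le\infty$ and let $\varphi=\varphi(t)$ be a smooth solution on $[0,T)\times X$, with $\omega_{\varphi(t)}>0$, of the flow $$\frac{\partial\varphi}{\partial t}=P(\varphi),\qquad \varphi(0)=0.$$ Then for all $t\in[0,T)$ (with the one-sided derivative at $t=0$) $$\frac{d}{dt}\mathrm{Mab}_{\omega_0}(\omega_{\varphi(t)})=-\frac1V\int_X\dot\varphi^2\,\omega_\varphi^n ,$$ which, if $V=1$, is minus the squared $L^2(\omega_\varphi^n)$-norm of $\dot\varphi$. In particular $t\mapsto\mathrm{Mab}_{\omega_0}(\omega_{\varphi(t)})$ is non-increasing on $[0,T)$. 2. The flow is the (negative) gradient flow of $\mathrm{Mab}_{\omega_0}$ with respect to the inner products $\langle\psi,\chi\rangle_\varphi=\frac1V\int_X\psi\chi\,\omega_\varphi^n$: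 for every smooth real $\varphi$ with $\omega_\varphi>0$ and every smooth real $\psi$, $$\frac{d}{ds}\Big|_{s=0}\mathrm{Mab}_{\omega_0}(\omega_{\varphi+s\psi})=-\frac1V\int_X\psi\,P(\varphi)\,\omega_\varphi^n .$$ -/

import Mathlib

open scoped Manifold ContDiff ComplexOrder
open MeasureTheory

noncomputable section

namespace ChernCalabi

variable {n : ℕ}

/-! ### Calculus on open subsets of `ℂⁿ` -/

/-- The Wirtinger derivative `∂f/∂zⁱ = ½ (∂f/∂xⁱ - √-1 ∂f/∂yⁱ)`. -/
def dz (i : Fin n) (f : (Fin n → ℂ) → ℂ) (z : Fin n → ℂ) : ℂ :=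
  (1 / 2 : ℂ) * (fderiv ℝ f z (Pi.single i 1) - Complex.I * fderiv ℝ f z (Pi.single i Complex.I))

/-- The Wirtinger derivative `∂f/∂z̄ʲ = ½ (∂f/∂xʲ + √-1 ∂f/∂yʲ)`. -/
def dzbar (j : Fin n) (f : (Fin n → ℂ) → ℂ) (z : Fin n → ℂ) : ℂ :=
  (1 / 2 : ℂ) * (fderiv ℝ f z (Pi.single j 1) + Complex.I * fderiv ℝ f z (Pi.single j Complex.I))

/-- The matrix `(∂ᵢ ∂_j̄ f)` of a real function `f`, i.e. the coefficients of the form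
`√-1 ∂∂̄f = √-1 (∂ᵢ ∂_j̄ f) dzⁱ ∧ dz̄ʲ`. -/
def ddbar (f : (Fin n → ℂ) → ℝ) (z : Fin n → ℂ) : Matrix (Fin n) (Fin n) ℂ :=
  Matrix.of fun i j => dz i (dzbar j fun w => (f w : ℂ)) z

/-! In what follows `h : ℂⁿ → Matrix` is the coefficient matrix `h i j = g_{i j̄}` of a Hermitian
metric in local coordinates; the associated form is `ω = √-1 g_{i j̄} dzⁱ ∧ dz̄ʲ`. -/

/-- The inverse metric `g^{k p̄}`, determined by `∑ₚ g^{k p̄} g_{i p̄} = δ_{ik}`. -/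
def invMetric (h : (Fin n → ℂ) → Matrix (Fin n) (Fin n) ℂ) (k p : Fin n) (z : Fin n → ℂ) : ℂ :=
  (h z)⁻¹ p k

/-- The Christoffel symbols `Γᵏ_{ij} = g^{k p̄} ∂ᵢ g_{j p̄}` of the Chern connection. -/
def christoffel (h : (Fin n → ℂ) → Matrix (Fin n) (Fin n) ℂ) (k i j : Fin n)
    (z : Fin n → ℂ) : ℂ :=
  ∑ p, invMetric h k p z * dz i (fun w => h w j p) z

/-- The torsion `Tᵏ_{ij} = Γᵏ_{ij} - Γᵏ_{ji}` of the Chern connection. -/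
def torsion (h : (Fin n → ℂ) → Matrix (Fin n) (Fin n) ℂ) (k i j : Fin n) (z : Fin n → ℂ) : ℂ :=
  christoffel h k i j z - christoffel h k j i z

/-- The trace of the torsion, `(tr T)ⱼ = Tᵖ_{pj}`. -/
def trTorsion (h : (Fin n → ℂ) → Matrix (Fin n) (Fin n) ℂ) (j : Fin n) (z : Fin n → ℂ) : ℂ :=
  ∑ p, torsion h p p j z

/-- The coefficients `R_{i j̄} = -∂ᵢ ∂_j̄ log det g` of the Chern-Ricci form
`Ric(ω) = √-1 R_{i j̄} dzⁱ ∧ dz̄ʲ` (the determinant of a Hermitian matrix is real). -/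
def chernRicci (h : (Fin n → ℂ) → Matrix (Fin n) (Fin n) ℂ) (z : Fin n → ℂ) :
    Matrix (Fin n) (Fin n) ℂ :=
  -ddbar (fun w => Real.log (h w).det.re) z

/-- The Chern scalar curvature `R = g^{i j̄} R_{i j̄}` (a real number). -/
def chernScalar (h : (Fin n → ℂ) → Matrix (Fin n) (Fin n) ℂ) (z : Fin n → ℂ) : ℝ :=
  (∑ i, ∑ j, invMetric h i j z * chernRicci h z i j).re

/-- `2 Re ⟨tr T, ∂u⟩ = 2 Re (g^{j k̄} (tr T)ⱼ ∂_k̄ u)` for a real function `u`. -/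
def torsionTerm (h : (Fin n → ℂ) → Matrix (Fin n) (Fin n) ℂ) (u : (Fin n → ℂ) → ℝ)
    (z : Fin n → ℂ) : ℝ :=
  2 * (∑ j, ∑ k, invMetric h j k z * trTorsion h j z * dzbar k (fun w => (u w : ℂ)) z).re

/-- The components of the `(k+1,k+1)`-form `∂∂̄(ωᵏ)`, up to a nonzero constant depending on `k`
only. As `ωᵏ` is `(√-1)ᵏ ∏ₘ g_{iₘ j̄ₘ} dz^{i₁} ∧ dz̄^{j₁} ∧ ⋯ ∧ dz^{iₖ} ∧ dz̄^{jₖ}` summed over all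
indices, the coefficient of `∂∂̄(ωᵏ)` at `dz^{I₀} ∧ ⋯ ∧ dz^{Iₖ} ∧ dz̄^{J₀} ∧ ⋯ ∧ dz̄^{Jₖ}` is the
antisymmetrization, in the indices `I` and in the indices `J`, of
`∂_{I₀} ∂_{J̄₀} (∏ₘ g_{Iₘ J̄ₘ})`, the product being over `m = 1, …, k`. -/
def ddbarPow (k : ℕ) (h : (Fin n → ℂ) → Matrix (Fin n) (Fin n) ℂ) (I J : Fin (k + 1) → Fin n)
    (z : Fin n → ℂ) : ℂ :=
  ∑ σ : Equiv.Perm (Fin (k + 1)), ∑ τ : Equiv.Perm (Fin (k + 1)),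
    (((Equiv.Perm.sign σ : ℤ) * (Equiv.Perm.sign τ : ℤ) : ℤ) : ℂ) *
      dz (I (σ 0)) (dzbar (J (τ 0)) fun w => ∏ m : Fin k, h w (I (σ m.succ)) (J (τ m.succ))) z

/-! ### Hermitian metrics on a complex manifold -/

/-- Coefficients `g_{i j̄}` in local coordinates: one matrix-valued function on `ℂⁿ` for each chart
`e`. Only the values on `e.target`, for charts `e` of the atlas, are meaningful. -/
abbrev LocalCoeff (n : ℕ) (X : Type*) [TopologicalSpace X] : Type _ :=
  OpenPartialHomeomorph X (Fin n → ℂ) → (Fin n → ℂ) → Matrix (Fin n) (Fin n) ℂ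

variable {X : Type*} [TopologicalSpace X] [ChartedSpace (Fin n → ℂ) X]

/-- The coefficients are Hermitian and positive definite at every point, in every chart of the
atlas. -/
def IsPositive (g : LocalCoeff n X) : Prop :=
  ∀ e ∈ atlas (Fin n → ℂ) X, ∀ z ∈ e.target, (g e z).PosDef

/-- A (smooth) Hermitian metric: in each chart, smooth coefficients that form a positive definite
Hermitian matrix, and that transform as a tensor under changes of coordinates `w = w(z)`:
`g_{i j̄} = g'_{a b̄} (∂wᵃ/∂zⁱ) conj(∂wᵇ/∂zʲ)`. -/
structure IsHermitianMetric (g : LocalCoeff n X) : Prop where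
  smooth : ∀ e ∈ atlas (Fin n → ℂ) X, ∀ i j, ContDiffOn ℝ ∞ (fun z => g e z i j) e.target
  pos : IsPositive g
  transform : ∀ e ∈ atlas (Fin n → ℂ) X, ∀ e' ∈ atlas (Fin n → ℂ) X,
    ∀ z ∈ e.target, e.symm z ∈ e'.source → ∀ i j,
      g e z i j = ∑ a, ∑ b, g e' (e' (e.symm z)) a b *
        fderiv ℂ (fun w => e' (e.symm w)) z (Pi.single i 1) a *
        starRingEnd ℂ (fderiv ℂ (fun w => e' (e.symm w)) z (Pi.single j 1) b)

/-- `∂∂̄(ωᵏ) = 0` on `X`. -/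
def DDbarPowEqZero (g : LocalCoeff n X) (k : ℕ) : Prop :=
  ∀ e ∈ atlas (Fin n → ℂ) X, ∀ z ∈ e.target, ∀ I J, ddbarPow k (g e) I J z = 0

/-- Coefficients of `ω_φ = ω₀ + √-1 ∂∂̄φ`. -/
def perturb (g₀ : LocalCoeff n X) (φ : X → ℝ) : LocalCoeff n X :=
  fun e z => g₀ e z + ddbar (fun w => φ (e.symm w)) z

/-- The measure on `X` given by the volume form `ωⁿ`. In a chart,
`ωⁿ = n! det(g) ∏ₖ (√-1 dzᵏ ∧ dz̄ᵏ)` is `n! 2ⁿ det(g)` times Lebesgue measure on `ℂⁿ`. The measures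
that the charts define in this way agree on overlaps, and `ωⁿ` is their supremum, i.e. the least
measure on `X` that dominates all of them. -/
def volForm [MeasurableSpace X] (g : LocalCoeff n X) : Measure X :=
  ⨆ e ∈ atlas (Fin n → ℂ) X,
    (((volume : Measure (Fin n → ℂ)).restrict e.target).withDensity fun z =>
        ENNReal.ofReal ((n.factorial : ℝ) * 2 ^ n * (g e z).det.re)).map e.symm

/-- `F` is the Chern-Ricci potential of `ω₀`: a smooth real function with `Ric(ω₀) = √-1 ∂∂̄F`,
normalized by `∫_X e^F ω₀ⁿ = ∫_X ω₀ⁿ`. -/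
structure IsChernRicciPotential [MeasurableSpace X] (g₀ : LocalCoeff n X) (F : X → ℝ) : Prop where
  smooth : ContMDiff 𝓘(ℝ, Fin n → ℂ) 𝓘(ℝ, ℝ) ∞ F
  ricci : ∀ e ∈ atlas (Fin n → ℂ) X, ∀ z ∈ e.target,
    chernRicci (g₀ e) z = ddbar (fun w => F (e.symm w)) z
  normalized : ∫ x, Real.exp (F x) ∂(volForm g₀) = ∫ _x, (1 : ℝ) ∂(volForm g₀)

/-- The function `log (det g / det g₀) - F = log (ωⁿ / (e^F ω₀ⁿ))`, in the chart `e`. -/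
def logRatio (g₀ : LocalCoeff n X) (F : X → ℝ) (g : LocalCoeff n X)
    (e : OpenPartialHomeomorph X (Fin n → ℂ)) (z : Fin n → ℂ) : ℝ :=
  Real.log ((g e z).det.re / (g₀ e z).det.re) - F (e.symm z)

/-- The volume `V = ∫_X ω₀ⁿ`. -/
def totalVol [MeasurableSpace X] (g₀ : LocalCoeff n X) : ℝ := ∫ _x, (1 : ℝ) ∂(volForm g₀)

/-- The Mabuchi energy
`Mab_{ω₀}(ω) = (1/V) ∫_X (log (det g / det g₀) - F) ωⁿ + (1/V) ∫_X F ω₀ⁿ`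
(the integrand does not depend on the chart in which it is evaluated). -/
def mabuchi [MeasurableSpace X] (g₀ : LocalCoeff n X) (F : X → ℝ) (g : LocalCoeff n X) : ℝ :=
  1 / totalVol g₀ *
      ∫ x, logRatio g₀ F g (chartAt (Fin n → ℂ) x) (chartAt (Fin n → ℂ) x x) ∂(volForm g)
    + 1 / totalVol g₀ * ∫ x, F x ∂(volForm g₀)

/-- The right-hand side of the flow at the metric `ω`, as a function on `X`:
`R + 2 Re ⟨tr T, ∂(log (det g / det g₀) - F)⟩`, where `R` and `T` are the Chern scalar curvature and
the torsion of `ω` (a scalar that does not depend on the chart in which it is evaluated). -/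
def flowSpeed (g₀ : LocalCoeff n X) (F : X → ℝ) (g : LocalCoeff n X) (x : X) : ℝ :=
  chernScalar (g (chartAt (Fin n → ℂ) x)) (chartAt (Fin n → ℂ) x x) +
    torsionTerm (g (chartAt (Fin n → ℂ) x)) (logRatio g₀ F g (chartAt (Fin n → ℂ) x))
      (chartAt (Fin n → ℂ) x x)

/-- The time interval `[0, T)`, where `T = ∞` is allowed. -/
def timeInterval (T : EReal) : Set ℝ := {t : ℝ | 0 ≤ t ∧ (t : EReal) < T}

/-- `φ` is a smooth solution on `[0, T) × X` of the flow
`∂φ/∂t = R_φ + 2 Re ⟨tr T_φ, ∂(log (det g_φ / det g₀) - F)⟩_φ`, `φ(0) = 0`, with `ω_φ > 0`. -/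
structure IsFlowSolution (g₀ : LocalCoeff n X) (F : X → ℝ) (T : EReal) (φ : ℝ → X → ℝ) :
    Prop where
  smooth : ContMDiffOn (𝓘(ℝ, ℝ).prod 𝓘(ℝ, Fin n → ℂ)) 𝓘(ℝ, ℝ) ∞
    (fun p : ℝ × X => φ p.1 p.2) (timeInterval T ×ˢ Set.univ)
  pos : ∀ t ∈ timeInterval T, IsPositive (perturb g₀ (φ t))
  init : ∀ x, φ 0 x = 0
  evolution : ∀ t ∈ timeInterval T, ∀ x,
    HasDerivWithinAt (fun s => φ s x) (flowSpeed g₀ F (perturb g₀ (φ t)) x) (timeInterval T) t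

end ChernCalabi

end

open scoped Manifold ContDiff ComplexOrder
open scoped Matrix
open MeasureTheory

noncomputable section

namespace ChernCalabi

variable {n : ℕ}

/-! Write u = log(det g / det g₀) - F, Δ = g^{i j̄} ∂ᵢ∂_j̄, and A^{i j̄} = det(g) g^{i j̄} for the
adjugate. Moving the potential in the direction ψ gives (det g)' = det(g) Δψ and u' = Δψ, so the
integrand u det g of the energy changes by (1 + u) A^{i j̄} ∂ᵢ∂_j̄ ψ. Two integrations by parts
leave ψ times ∂_j̄∂ᵢ((1 + u) A^{i j̄}), and the whole theorem is the pointwise identity that this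
expression equals -det(g) P.

Expand by Leibniz (`sum_dzbar_dz_mul_adjMetric`). The second-order part is det(g) Δu, and Δu = -R
because the contributions of g₀ and F to ∂∂̄u cancel by the definition of F
(`IsVariational.ddbar_logRatio`). The first-order part involves ∂ᵢA^{i j̄} = -det(g) g^{k j̄}(tr T)ₖ
(`divAdj_eq_trTorsion`) and its conjugate, which produces the torsion term. The zeroth-order part is
(1 + u) ∂_j̄∂ᵢA^{i j̄}, in essence ∂∂̄ωⁿ⁻¹, and has to vanish (`sum_dzbar_divAdj_eq_zero`). Indeed
∂∂̄ωⁿ⁻¹ combines ωⁿ⁻² ∧ ∂∂̄ω and ωⁿ⁻³ ∧ ∂ω ∧ ∂̄ω; the first is killed by ∂∂̄ω = 0, the second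
because ∂∂̄ω² = 2ω ∧ ∂∂̄ω + 2∂ω ∧ ∂̄ω. In coordinates the two types appear as 2 × 2 and 3 × 3 minors
of the inverse metric. Both conditions pass from ω₀ to ω_φ, since √-1∂∂̄φ is ∂- and ∂̄-closed
(`IsPluriclosedAt.add_ddbar`).

Integrals over X are reduced to charts by a partition of unity, using that ωⁿ restricted to a chart
domain is the measure of that chart (`volForm_restrict_source`). Green's formula then holds for
functions supported in a chart, and it forces P to be independent of the chart: two local
expressions that pair equally with all test functions agree. This avoids transforming the torsion by
hand (`IsVariational.isInvariant_localSpeed`).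

`hasDerivWithinAt_mabuchi` combines Green's formula with differentiation under the integral over a
compact time interval, one-sided at the ends. Applied on [0, c] inside [0, T), with velocity P, it
gives the flow statement; applied to φ + sψ for small |s|, it gives the gradient statement. -/

/-! ### Wirtinger calculus -/

/-- The common form of the two Wirtinger derivatives: `c = -√-1` gives `∂/∂zⁱ` and `c = √-1` gives
`∂/∂z̄ⁱ`. -/
def wirt (c : ℂ) (i : Fin n) (f : (Fin n → ℂ) → ℂ) (z : Fin n → ℂ) : ℂ :=
  (1 / 2 : ℂ) * (fderiv ℝ f z (Pi.single i 1) + c * fderiv ℝ f z (Pi.single i Complex.I))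

lemma dz_eq_wirt (i : Fin n) : dz i = wirt (-Complex.I) i := by
  ext f z; simp [dz, wirt, sub_eq_add_neg]

lemma dzbar_eq_wirt (i : Fin n) : dzbar i = wirt Complex.I i := rfl

section wirt

variable {c c' : ℂ} {i j : Fin n} {f g : (Fin n → ℂ) → ℂ} {z : Fin n → ℂ} {U : Set (Fin n → ℂ)}

lemma wirt_congr (h : f =ᶠ[nhds z] g) : wirt c i f z = wirt c i g z := by
  simp only [wirt, h.fderiv_eq]

lemma wirt_congr_on (hU : IsOpen U) (h : Set.EqOn f g U) (hz : z ∈ U) :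
    wirt c i f z = wirt c i g z :=
  wirt_congr (h.eventuallyEq_of_mem (hU.mem_nhds hz))

lemma wirt_const (a : ℂ) : wirt c i (fun _ => a) z = 0 := by
  simp [wirt]

lemma wirt_add (hf : DifferentiableAt ℝ f z) (hg : DifferentiableAt ℝ g z) :
    wirt c i (fun w => f w + g w) z = wirt c i f z + wirt c i g z := by
  simp only [wirt, fderiv_fun_add hf hg, _root_.add_apply]; ring

lemma wirt_sub (hf : DifferentiableAt ℝ f z) (hg : DifferentiableAt ℝ g z) :
    wirt c i (fun w => f w - g w) z = wirt c i f z - wirt c i g z := by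
  simp only [wirt, fderiv_fun_sub hf hg, _root_.sub_apply]; ring

lemma wirt_neg : wirt c i (fun w => -f w) z = -wirt c i f z := by
  simp only [wirt, fderiv_fun_neg, _root_.neg_apply]; ring

lemma wirt_mul (hf : DifferentiableAt ℝ f z) (hg : DifferentiableAt ℝ g z) :
    wirt c i (fun w => f w * g w) z = wirt c i f z * g z + f z * wirt c i g z := by
  simp only [wirt, fderiv_fun_mul hf hg, _root_.add_apply,
    _root_.smul_apply, smul_eq_mul]; ring

lemma wirt_sum {ι : Type*} {s : Finset ι} {F : ι → (Fin n → ℂ) → ℂ}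
    (hF : ∀ k ∈ s, DifferentiableAt ℝ (F k) z) :
    wirt c i (fun w => ∑ k ∈ s, F k w) z = ∑ k ∈ s, wirt c i (F k) z := by
  simp only [wirt, fderiv_fun_sum hF, _root_.sum_apply, Finset.mul_sum,
    ← Finset.sum_add_distrib]

lemma ContDiffOn.wirt (hU : IsOpen U) (hf : ContDiffOn ℝ ∞ f U) :
    ContDiffOn ℝ ∞ (wirt c i f) U := by
  have h := hf.fderiv_of_isOpen (m := ∞) hU (by simp)
  exact contDiffOn_const.mul ((h.clm_apply contDiffOn_const).add
    (contDiffOn_const.mul (h.clm_apply contDiffOn_const)))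

lemma fderiv_fderiv_apply (hf : ContDiffAt ℝ ∞ f z) (v w : Fin n → ℂ) :
    fderiv ℝ (fun y => fderiv ℝ f y v) z w = fderiv ℝ (fderiv ℝ f) z w v := by
  have h : DifferentiableAt ℝ (fderiv ℝ f) z :=
    (hf.fderiv_right (m := 1) (by norm_cast)).differentiableAt (by simp)
  rw [fderiv_clm_apply h (differentiableAt_const v)]
  simp

lemma differentiableAt_fderiv_apply (hf : ContDiffAt ℝ ∞ f z) (v : Fin n → ℂ) :
    DifferentiableAt ℝ (fun y => fderiv ℝ f y v) z :=
  ((hf.fderiv_right (m := 1) (by norm_cast)).differentiableAt (by simp)).clm_apply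
    (differentiableAt_const v)

/-- Both operators are constant-coefficient combinations of real directional derivatives, so this is
the symmetry of the real Hessian. -/
lemma wirt_wirt_comm (hf : ContDiffAt ℝ ∞ f z) :
    wirt c i (wirt c' j f) z = wirt c' j (wirt c i f) z := by
  have hs : ∀ v w, fderiv ℝ (fderiv ℝ f) z v w = fderiv ℝ (fderiv ℝ f) z w v :=
    (hf.isSymmSndFDerivAt (by simp; norm_cast)).eq
  have key : ∀ (c : ℂ) (i : Fin n) (w), fderiv ℝ (wirt c i f) z w =
      (1 / 2 : ℂ) * (fderiv ℝ (fderiv ℝ f) z w (Pi.single i 1) +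
        c * fderiv ℝ (fderiv ℝ f) z w (Pi.single i Complex.I)) := by
    intro c i w
    have h1 := differentiableAt_fderiv_apply hf (Pi.single i 1)
    have h2 := differentiableAt_fderiv_apply hf (Pi.single i Complex.I)
    change fderiv ℝ (fun y => (1 / 2 : ℂ) * (fderiv ℝ f y (Pi.single i 1) +
      c * fderiv ℝ f y (Pi.single i Complex.I))) z w = _
    rw [fderiv_const_mul (h1.fun_add (h2.const_mul c)), fderiv_fun_add h1 (h2.const_mul c),
      fderiv_const_mul h2]
    simp [fderiv_fderiv_apply hf, mul_add]
  conv_lhs => rw [ChernCalabi.wirt]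
  conv_rhs => rw [ChernCalabi.wirt]
  simp only [key]
  rw [hs (Pi.single i 1) (Pi.single j 1), hs (Pi.single i 1) (Pi.single j Complex.I),
    hs (Pi.single i Complex.I) (Pi.single j 1),
    hs (Pi.single i Complex.I) (Pi.single j Complex.I)]
  ring

lemma wirt_conj : wirt c i (fun w => starRingEnd ℂ (f w)) z =
    starRingEnd ℂ (wirt (starRingEnd ℂ c) i f z) := by
  have : fderiv ℝ (fun w => starRingEnd ℂ (f w)) z =
      (Complex.conjCLE : ℂ →L[ℝ] ℂ).comp (fderiv ℝ f z) :=
    Complex.conjCLE.comp_fderiv (f := f) (x := z)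
  simp [wirt, this, Complex.conj_ofNat]

lemma dz_conj : dz i (fun w => starRingEnd ℂ (f w)) z = starRingEnd ℂ (dzbar i f z) := by
  rw [dz_eq_wirt, wirt_conj, dzbar_eq_wirt]; simp

lemma dzbar_conj : dzbar i (fun w => starRingEnd ℂ (f w)) z = starRingEnd ℂ (dz i f z) := by
  rw [dz_eq_wirt, dzbar_eq_wirt, wirt_conj]; simp

lemma dz_ofReal (u : (Fin n → ℂ) → ℝ) :
    dz i (fun w => (u w : ℂ)) z = starRingEnd ℂ (dzbar i (fun w => (u w : ℂ)) z) := by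
  rw [← dz_conj]; simp

/-- The splitting df = ∂f + ∂̄f, read off by expanding v in the real basis formed by the vectors e_a
and √-1 e_a. -/
lemma fderiv_eq_wirtinger (v : Fin n → ℂ) :
    fderiv ℝ f z v = ∑ a, (dz a f z * v a + dzbar a f z * starRingEnd ℂ (v a)) := by
  have hv : v = ∑ a, ((v a).re • (Pi.single a 1 : Fin n → ℂ) +
      (v a).im • (Pi.single a Complex.I : Fin n → ℂ)) := by
    ext b
    simp only [Finset.sum_apply, Pi.add_apply, Pi.smul_apply, Pi.single_apply]
    rw [Finset.sum_eq_single b]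
    · simp
    · intro a _ h; simp [h.symm]
    · simp
  conv_lhs => rw [hv]
  rw [map_sum]
  refine Finset.sum_congr rfl fun a _ => ?_
  rw [map_add, map_smul, map_smul]
  conv_rhs => rw [← Complex.re_add_im (v a)]
  simp only [dz, dzbar, Complex.real_smul, map_add, map_mul, Complex.conj_ofReal, Complex.conj_I]
  linear_combination ((v a).im * fderiv ℝ f z (Pi.single a Complex.I)) * Complex.I_sq

lemma fderiv_comp_holomorphic {w : (Fin n → ℂ) → (Fin n → ℂ)} (hw : DifferentiableAt ℂ w z)
    (hf : DifferentiableAt ℝ f (w z)) (v : Fin n → ℂ) :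
    fderiv ℝ (fun y => f (w y)) z v = fderiv ℝ f (w z) (fderiv ℂ w z v) := by
  have h := (hf.hasFDerivAt.comp z (hw.hasFDerivAt.restrictScalars ℝ)).fderiv
  change fderiv ℝ (f ∘ w) z v = _
  rw [h]; rfl

lemma single_I (i : Fin n) : (Pi.single i Complex.I : Fin n → ℂ) = Complex.I • Pi.single i 1 := by
  rw [← Pi.single_smul]; simp

/-- Complex linearity of the differential of w sends √-1 eᵢ to √-1 times the image of eᵢ, so the
∂̄-contributions of the two real directions cancel and ∂ does not mix with ∂̄. -/
lemma dz_comp {w : (Fin n → ℂ) → (Fin n → ℂ)} (hw : DifferentiableAt ℂ w z)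
    (hf : DifferentiableAt ℝ f (w z)) :
    dz i (fun y => f (w y)) z = ∑ a, dz a f (w z) * fderiv ℂ w z (Pi.single i 1) a := by
  conv_lhs => rw [dz]
  rw [fderiv_comp_holomorphic hw hf, fderiv_comp_holomorphic hw hf, single_I, map_smul,
    fderiv_eq_wirtinger, fderiv_eq_wirtinger, Finset.mul_sum, ← Finset.sum_sub_distrib,
    Finset.mul_sum]
  refine Finset.sum_congr rfl fun a _ => ?_
  simp only [Pi.smul_apply, smul_eq_mul, map_mul, Complex.conj_I]
  linear_combination (1 / 2 * (-(dz a f (w z) * fderiv ℂ w z (Pi.single i 1) a) +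
    dzbar a f (w z) * starRingEnd ℂ (fderiv ℂ w z (Pi.single i 1) a))) * Complex.I_sq

lemma dzbar_comp {w : (Fin n → ℂ) → (Fin n → ℂ)} (hw : DifferentiableAt ℂ w z)
    (hf : DifferentiableAt ℝ f (w z)) :
    dzbar i (fun y => f (w y)) z =
      ∑ a, dzbar a f (w z) * starRingEnd ℂ (fderiv ℂ w z (Pi.single i 1) a) := by
  conv_lhs => rw [dzbar]
  rw [fderiv_comp_holomorphic hw hf, fderiv_comp_holomorphic hw hf, single_I, map_smul,
    fderiv_eq_wirtinger, fderiv_eq_wirtinger, Finset.mul_sum, ← Finset.sum_add_distrib,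
    Finset.mul_sum]
  refine Finset.sum_congr rfl fun a _ => ?_
  simp only [Pi.smul_apply, smul_eq_mul, map_mul, Complex.conj_I]
  linear_combination (1 / 2 * ((dz a f (w z) * fderiv ℂ w z (Pi.single i 1) a) -
    dzbar a f (w z) * starRingEnd ℂ (fderiv ℂ w z (Pi.single i 1) a))) * Complex.I_sq

lemma dzbar_holomorphic (hf : DifferentiableAt ℂ f z) : dzbar i f z = 0 := by
  rw [dzbar, hf.fderiv_restrictScalars ℝ, single_I]
  simp only [ContinuousLinearMap.coe_restrictScalars', map_smul, smul_eq_mul]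
  linear_combination (1 / 2 * fderiv ℂ f z (Pi.single i 1)) * Complex.I_sq

lemma dz_conj_holomorphic (hf : DifferentiableAt ℂ f z) :
    dz i (fun w => starRingEnd ℂ (f w)) z = 0 := by
  rw [dz_conj, dzbar_holomorphic hf, map_zero]

end wirt

/-- No second derivatives of w survive: ∂̄ of the composite carries the conjugate Jacobian, which is
antiholomorphic and so annihilated by ∂. This is why ∂∂̄f is a tensor. -/
lemma dz_dzbar_comp {w : (Fin n → ℂ) → (Fin n → ℂ)} {f : (Fin n → ℂ) → ℂ}
    {U U' : Set (Fin n → ℂ)} (hU : IsOpen U)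
    (hU' : IsOpen U') (hw : ContDiffOn ℂ 2 w U) (hwU : Set.MapsTo w U U')
    (hf : ContDiffOn ℝ ∞ f U') {z : Fin n → ℂ} (hz : z ∈ U) (i j : Fin n) :
    dz i (dzbar j fun y => f (w y)) z =
      ∑ a, ∑ b, dz a (dzbar b f) (w z) * fderiv ℂ w z (Pi.single i 1) a *
        starRingEnd ℂ (fderiv ℂ w z (Pi.single j 1) b) := by
  have hwd : ∀ y ∈ U, DifferentiableAt ℂ w y := fun y hy =>
    (hw.contDiffAt (hU.mem_nhds hy)).differentiableAt (by simp)
  have hfd : ∀ y ∈ U', DifferentiableAt ℝ f y := fun y hy =>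
    (hf.contDiffAt (hU'.mem_nhds hy)).differentiableAt (by simp)
  have h1 : Set.EqOn (dzbar j fun y => f (w y)) (fun y => ∑ b, dzbar b f (w y) *
      starRingEnd ℂ (fderiv ℂ w y (Pi.single j 1) b)) U := fun y hy =>
    dzbar_comp (hwd y hy) (hfd _ (hwU hy))
  have hJ : ∀ b, DifferentiableAt ℂ (fun y => fderiv ℂ w y (Pi.single j 1) b) z := by
    intro b
    have h3 := ((hw.contDiffAt (hU.mem_nhds hz)).fderiv_right (m := 1)
      (by norm_num)).differentiableAt (by simp)
    exact differentiableAt_pi.1 (h3.clm_apply (differentiableAt_const _)) b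
  have hJc : ∀ b, DifferentiableAt ℝ
      (fun y => starRingEnd ℂ (fderiv ℂ w y (Pi.single j 1) b)) z := fun b =>
    (Complex.conjCLE.differentiableAt (x := _)).comp z ((hJ b).restrictScalars ℝ)
  have hb : ∀ b, DifferentiableAt ℝ (dzbar b f) (w z) := fun b =>
    (((dzbar_eq_wirt b ▸ ContDiffOn.wirt hU' hf).contDiffAt
      (hU'.mem_nhds (hwU hz))).differentiableAt (by simp))
  have hbc : ∀ b, DifferentiableAt ℝ (fun y => dzbar b f (w y)) z := fun b =>
    (hb b).comp z ((hwd z hz).restrictScalars ℝ)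
  rw [dz_eq_wirt, wirt_congr_on hU h1 hz, wirt_sum fun b _ => (hbc b).fun_mul (hJc b),
    Finset.sum_comm]
  refine Finset.sum_congr rfl fun b _ => ?_
  rw [wirt_mul (hbc b) (hJc b), ← dz_eq_wirt, dz_conj_holomorphic (hJ b), dz_comp (hwd z hz) (hb b),
    mul_zero, add_zero, Finset.sum_mul]

/-! ### Determinants and inverses of matrix-valued functions -/

lemma det_updateCol_eq_sum (M : Matrix (Fin n) (Fin n) ℂ) (i : Fin n) (v : Fin n → ℂ) :
    (M.updateCol i v).det = ∑ σ : Equiv.Perm (Fin n),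
      ((Equiv.Perm.sign σ : ℤ) : ℂ) * ((∏ j ∈ Finset.univ.erase i, M (σ j) j) * v (σ i)) := by
  rw [Matrix.det_apply']
  refine Finset.sum_congr rfl fun σ _ => ?_
  rw [← Finset.prod_erase_mul _ _ (Finset.mem_univ i), Matrix.updateCol_self]
  congr 2
  refine Finset.prod_congr rfl fun j hj => ?_
  rw [Matrix.updateCol_ne (Finset.ne_of_mem_erase hj)]

/-- The right-hand side is what the product rule yields from the Leibniz expansion of the
determinant; Cramer's rule, one column at a time, recognises it as a trace against the adjugate. -/
lemma sum_adjugate_mul (M k : Matrix (Fin n) (Fin n) ℂ) :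
    ∑ i, ∑ j, M.adjugate j i * k i j = ∑ σ : Equiv.Perm (Fin n), ((Equiv.Perm.sign σ : ℤ) : ℂ) *
      ∑ i, (∏ j ∈ Finset.univ.erase i, M (σ j) j) * k (σ i) i := by
  have h : ∀ j, ∑ i, M.adjugate j i * k i j = (M.updateCol j (fun i => k i j)).det := by
    intro j
    rw [← Matrix.cramer_apply, Matrix.cramer_eq_adjugate_mulVec]
    rfl
  rw [Finset.sum_comm]
  simp_rw [h, det_updateCol_eq_sum, Finset.mul_sum]
  rw [Finset.sum_comm]

/-- Jacobi's formula. The general domain and the set `s` let it serve both for space derivatives and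
for one-sided time derivatives. -/
lemma hasFDerivWithinAt_det {G : Type*} [NormedAddCommGroup G] [NormedSpace ℝ G]
    {h : G → Matrix (Fin n) (Fin n) ℂ} {h' : Fin n → Fin n → G →L[ℝ] ℂ} {s : Set G} {x : G}
    (hh : ∀ i j, HasFDerivWithinAt (fun y => h y i j) (h' i j) s x) :
    HasFDerivWithinAt (fun y => (h y).det) (∑ i, ∑ j, (h x).adjugate j i • h' i j) s x := by
  have h1 : HasFDerivWithinAt (fun y => (h y).det)
      (∑ σ : Equiv.Perm (Fin n), ((Equiv.Perm.sign σ : ℤ) : ℂ) •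
        ∑ i, (∏ j ∈ Finset.univ.erase i, h x (σ j) j) • h' (σ i) i) s x := by
    simp_rw [Matrix.det_apply']
    refine HasFDerivWithinAt.fun_sum fun σ _ => HasFDerivWithinAt.const_mul ?_ _
    exact HasFDerivWithinAt.finsetProd fun i _ => hh (σ i) i
  convert h1 using 1
  ext v
  have := sum_adjugate_mul (h x) (fun i j => h' i j v)
  simpa [_root_.sum_apply] using this

lemma contDiffOn_det {G : Type*} [NormedAddCommGroup G] [NormedSpace ℝ G]
    {h : G → Matrix (Fin n) (Fin n) ℂ} {s : Set G}
    (hh : ∀ i j, ContDiffOn ℝ ∞ (fun y => h y i j) s) :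
    ContDiffOn ℝ ∞ (fun y => (h y).det) s := by
  simp_rw [Matrix.det_apply']
  exact ContDiffOn.sum fun σ _ => contDiffOn_const.mul (contDiffOn_prod fun i _ => hh _ _)

lemma contDiffOn_inv {G : Type*} [NormedAddCommGroup G] [NormedSpace ℝ G]
    {h : G → Matrix (Fin n) (Fin n) ℂ} {s : Set G}
    (hh : ∀ i j, ContDiffOn ℝ ∞ (fun y => h y i j) s) (hdet : ∀ y ∈ s, (h y).det ≠ 0) (i j : Fin n) :
    ContDiffOn ℝ ∞ (fun y => (h y)⁻¹ i j) s := by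
  have h1 : ∀ y, (h y)⁻¹ i j = (h y).det⁻¹ * ((h y).updateRow j (Pi.single i 1)).det := by
    intro y
    rw [Matrix.inv_def, Matrix.smul_apply, Matrix.adjugate_apply, Ring.inverse_eq_inv', smul_eq_mul]
  simp_rw [h1]
  refine ((contDiffOn_det hh).inv hdet).mul (contDiffOn_det fun a b => ?_)
  by_cases ha : a = j
  · subst ha
    simp only [Matrix.updateRow_self]
    exact contDiffOn_const
  · simp only [Matrix.updateRow_ne ha]
    exact hh a b

section pointwise

variable {h : (Fin n → ℂ) → Matrix (Fin n) (Fin n) ℂ} {U : Set (Fin n → ℂ)} {z : Fin n → ℂ}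

lemma adjugate_eq_det_mul_inv (M : Matrix (Fin n) (Fin n) ℂ) (hM : M.det ≠ 0) (i j : Fin n) :
    M.adjugate i j = M.det * M⁻¹ i j := by
  rw [Matrix.inv_def, Matrix.smul_apply, Ring.inverse_eq_inv', smul_eq_mul, mul_inv_cancel_left₀ hM]

lemma wirt_det {c : ℂ} {m : Fin n} (hh : ∀ i j, DifferentiableAt ℝ (fun y => h y i j) z)
    (hdet : (h z).det ≠ 0) :
    wirt c m (fun y => (h y).det) z =
      (h z).det * ∑ p, ∑ q, invMetric h p q z * wirt c m (fun y => h y p q) z := by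
  have h1 := (hasFDerivWithinAt_det (s := Set.univ)
    fun i j => (hh i j).hasFDerivAt.hasFDerivWithinAt).hasFDerivAt Filter.univ_mem
  simp only [wirt, h1.fderiv, _root_.sum_apply, _root_.smul_apply, smul_eq_mul, invMetric,
    Finset.mul_sum, ← Finset.sum_add_distrib]
  refine Finset.sum_congr rfl fun p _ => Finset.sum_congr rfl fun q _ => ?_
  rw [adjugate_eq_det_mul_inv _ hdet]
  ring

/-- Obtained by differentiating h h⁻¹ = 1 entrywise and solving for the derivative of the inverse.
-/
lemma wirt_invMetric {c : ℂ} {m : Fin n} (hU : IsOpen U) (hz : z ∈ U)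
    (hh : ∀ i j, ContDiffOn ℝ ∞ (fun y => h y i j) U) (hdet : ∀ y ∈ U, (h y).det ≠ 0)
    (i j : Fin n) :
    wirt c m (invMetric h i j) z =
      -∑ p, ∑ q, invMetric h i q z * invMetric h p j z * wirt c m (fun y => h y p q) z := by
  have hd : ∀ i j, DifferentiableAt ℝ (fun y => h y i j) z := fun i j =>
    ((hh i j).contDiffAt (hU.mem_nhds hz)).differentiableAt (by simp)
  have hi : ∀ i j, DifferentiableAt ℝ (fun y => (h y)⁻¹ i j) z := fun i j =>
    ((contDiffOn_inv hh hdet i j).contDiffAt (hU.mem_nhds hz)).differentiableAt (by simp)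
  set Dh : Matrix (Fin n) (Fin n) ℂ := Matrix.of fun a b => wirt c m (fun y => h y a b) z with hDh
  set Di : Matrix (Fin n) (Fin n) ℂ := Matrix.of fun a b => wirt c m (fun y => (h y)⁻¹ a b) z
    with hDi
  have h0 : Dh * (h z)⁻¹ + h z * Di = 0 := by
    ext a b
    have e1 : Set.EqOn (fun y => ∑ k, h y a k * (h y)⁻¹ k b)
        (fun _ => (1 : Matrix (Fin n) (Fin n) ℂ) a b) U := by
      intro y hy
      simp only
      rw [← Matrix.mul_apply, Matrix.mul_nonsing_inv _ (isUnit_iff_ne_zero.2 (hdet y hy))]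
    have e2 := wirt_congr_on (c := c) (i := m) hU e1 hz
    rw [wirt_const, wirt_sum fun k _ => (hd a k).fun_mul (hi k b)] at e2
    rw [Matrix.add_apply, Matrix.mul_apply, Matrix.mul_apply, ← Finset.sum_add_distrib,
      Matrix.zero_apply, ← e2]
    exact Finset.sum_congr rfl fun k _ => (wirt_mul (hd a k) (hi k b)).symm
  have h1 : Di = -((h z)⁻¹ * Dh * (h z)⁻¹) := by
    have h2 := congrArg (fun M => (h z)⁻¹ * M) h0
    simp only [mul_add, mul_zero, ← mul_assoc,
      Matrix.nonsing_inv_mul _ (isUnit_iff_ne_zero.2 (hdet z hz)), one_mul] at h2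
    exact eq_neg_of_add_eq_zero_right h2
  have h3 := congrFun (congrFun h1 j) i
  change Di j i = _
  rw [h3, Matrix.neg_apply, Matrix.mul_apply, Finset.sum_comm]
  simp only [Matrix.mul_apply, Finset.sum_mul]
  congr 1
  refine Finset.sum_congr rfl fun q _ => Finset.sum_congr rfl fun p _ => ?_
  simp only [hDh, Matrix.of_apply, invMetric]
  ring

/-- The entries `det(g) g^{i j̄}` of the adjugate matrix. -/
def adjMetric (h : (Fin n → ℂ) → Matrix (Fin n) (Fin n) ℂ) (i j : Fin n) (z : Fin n → ℂ) : ℂ :=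
  (h z).det * invMetric h i j z

/-- The `2 × 2` minors of a matrix. -/
def minor₂ (B : Matrix (Fin n) (Fin n) ℂ) (i k j l : Fin n) : ℂ :=
  B i j * B k l - B i l * B k j

/-- The `3 × 3` minors of a matrix. -/
def minor₃ (B : Matrix (Fin n) (Fin n) ℂ) (i k p j l q : Fin n) : ℂ :=
  B i j * minor₂ B k p l q - B i l * minor₂ B k p j q + B i q * minor₂ B k p j l

/-- The derivative of the determinant supplies the diagonal product and that of the inverse the
crossed one; together they form a 2 × 2 minor. The transpose appears because g^{i j̄} is the (j, i)
entry of the inverse matrix. -/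
lemma wirt_adjMetric {c : ℂ} {m : Fin n} (hU : IsOpen U) (hz : z ∈ U)
    (hh : ∀ i j, ContDiffOn ℝ ∞ (fun y => h y i j) U) (hdet : ∀ y ∈ U, (h y).det ≠ 0)
    (i j : Fin n) :
    wirt c m (adjMetric h i j) z =
      ∑ p, ∑ q, (h z).det * minor₂ (h z)⁻¹ᵀ i p j q * wirt c m (fun y => h y p q) z := by
  have hd : ∀ i j, DifferentiableAt ℝ (fun y => h y i j) z := fun i j =>
    ((hh i j).contDiffAt (hU.mem_nhds hz)).differentiableAt (by simp)
  have hi : ∀ i j, DifferentiableAt ℝ (invMetric h i j) z := fun i j =>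
    ((contDiffOn_inv hh hdet j i).contDiffAt (hU.mem_nhds hz)).differentiableAt (by simp)
  have hD : DifferentiableAt ℝ (fun y => (h y).det) z :=
    ((contDiffOn_det hh).contDiffAt (hU.mem_nhds hz)).differentiableAt (by simp)
  change wirt c m (fun y => (h y).det * invMetric h i j y) z = _
  rw [wirt_mul hD (hi i j), wirt_det hd (hdet z hz), wirt_invMetric hU hz hh hdet]
  simp only [Finset.mul_sum, Finset.sum_mul, ← Finset.sum_neg_distrib, ← Finset.sum_add_distrib,
    minor₂, invMetric, Matrix.transpose_apply]
  refine Finset.sum_congr rfl fun p _ => Finset.sum_congr rfl fun q _ => ?_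
  ring

/-- The same mechanism one degree higher: each derivative of det(g) times a minor of g⁻¹ raises the
order of the minor by one. Antisymmetry of the result is what makes the hypotheses on ω usable. -/
lemma wirt_det_mul_minor₂ {c : ℂ} {m : Fin n} (hU : IsOpen U) (hz : z ∈ U)
    (hh : ∀ i j, ContDiffOn ℝ ∞ (fun y => h y i j) U) (hdet : ∀ y ∈ U, (h y).det ≠ 0)
    (i k j l : Fin n) :
    wirt c m (fun y => (h y).det * minor₂ (h y)⁻¹ᵀ i k j l) z =
      ∑ p, ∑ q, (h z).det * minor₃ (h z)⁻¹ᵀ i k p j l q * wirt c m (fun y => h y p q) z := by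
  have hd : ∀ i j, DifferentiableAt ℝ (fun y => h y i j) z := fun i j =>
    ((hh i j).contDiffAt (hU.mem_nhds hz)).differentiableAt (by simp)
  have hi : ∀ i j, DifferentiableAt ℝ (invMetric h i j) z := fun i j =>
    ((contDiffOn_inv hh hdet j i).contDiffAt (hU.mem_nhds hz)).differentiableAt (by simp)
  have hD : DifferentiableAt ℝ (fun y => (h y).det) z :=
    ((contDiffOn_det hh).contDiffAt (hU.mem_nhds hz)).differentiableAt (by simp)
  change wirt c m (fun y => (h y).det * (invMetric h i j y * invMetric h k l y -
    invMetric h i l y * invMetric h k j y)) z = _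
  rw [wirt_mul hD (((hi i j).fun_mul (hi k l)).fun_sub ((hi i l).fun_mul (hi k j))),
    wirt_sub ((hi i j).fun_mul (hi k l)) ((hi i l).fun_mul (hi k j)),
    wirt_mul (hi i j) (hi k l), wirt_mul (hi i l) (hi k j), wirt_det hd (hdet z hz)]
  simp only [wirt_invMetric hU hz hh hdet]
  simp only [Finset.mul_sum, Finset.sum_mul, ← Finset.sum_neg_distrib, ← Finset.sum_add_distrib,
    ← Finset.sum_sub_distrib, minor₃, minor₂, Matrix.transpose_apply, invMetric]
  refine Finset.sum_congr rfl fun p _ => Finset.sum_congr rfl fun q _ => ?_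
  ring

end pointwise

/-! ### The double divergence of the adjugate matrix -/

/-- An alternating array W pairs only with the antisymmetrization of X. Reindexing by each pair of
permutations leaves the pairing unchanged, so (m!)² copies of it add up to a pairing with that
antisymmetrization, which is zero. -/
lemma sum_alternating_mul_eq_zero {m : ℕ} (W X : (Fin m → Fin n) → (Fin m → Fin n) → ℂ)
    (hW : ∀ (σ τ : Equiv.Perm (Fin m)) I J, W (I ∘ σ) (J ∘ τ) =
      (((Equiv.Perm.sign σ : ℤ) * (Equiv.Perm.sign τ : ℤ) : ℤ) : ℂ) * W I J)
    (hX : ∀ I J, ∑ σ : Equiv.Perm (Fin m), ∑ τ : Equiv.Perm (Fin m),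
      (((Equiv.Perm.sign σ : ℤ) * (Equiv.Perm.sign τ : ℤ) : ℤ) : ℂ) * X (I ∘ σ) (J ∘ τ) = 0) :
    ∑ I, ∑ J, W I J * X I J = 0 := by
  have h1 : ∀ σ τ : Equiv.Perm (Fin m), ∑ I, ∑ J, W I J * X I J =
      ∑ I, ∑ J, W I J * ((((Equiv.Perm.sign σ : ℤ) * (Equiv.Perm.sign τ : ℤ) : ℤ) : ℂ) *
        X (I ∘ σ) (J ∘ τ)) := by
    intro σ τ
    rw [← (Equiv.arrowCongr σ.symm (Equiv.refl (Fin n))).sum_comp]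
    refine Finset.sum_congr rfl fun I _ => ?_
    rw [← (Equiv.arrowCongr τ.symm (Equiv.refl (Fin n))).sum_comp]
    refine Finset.sum_congr rfl fun J _ => ?_
    have hI : (Equiv.arrowCongr σ.symm (Equiv.refl (Fin n))) I = I ∘ σ := rfl
    have hJ : (Equiv.arrowCongr τ.symm (Equiv.refl (Fin n))) J = J ∘ τ := rfl
    rw [hI, hJ, hW]
    ring
  have h2 : ∑ σ : Equiv.Perm (Fin m), ∑ τ : Equiv.Perm (Fin m), ∑ I, ∑ J, W I J * X I J = 0 := by
    rw [Finset.sum_congr rfl fun σ _ => Finset.sum_congr rfl fun τ _ => h1 σ τ]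
    rw [Finset.sum_congr rfl fun σ _ => Finset.sum_comm, Finset.sum_comm]
    refine Finset.sum_eq_zero fun I _ => ?_
    rw [Finset.sum_congr rfl fun σ _ => Finset.sum_comm, Finset.sum_comm]
    refine Finset.sum_eq_zero fun J _ => ?_
    simp_rw [← Finset.mul_sum]
    rw [hX, mul_zero]
  simpa [Fintype.card_perm, Nat.factorial_ne_zero] using h2

lemma sum_fin_succ_arrow {α : Type*} [Fintype α] {k : ℕ} (f : (Fin (k + 1) → α) → ℂ) :
    ∑ I, f I = ∑ a, ∑ I : Fin k → α, f (Fin.cons a I) := by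
  rw [← (Fin.consEquiv fun _ => α).sum_comp, Fintype.sum_prod_type]
  rfl

lemma sum_fin_two_arrow (f : (Fin 2 → Fin n) → ℂ) : ∑ I, f I = ∑ a, ∑ b, f ![a, b] := by
  simp_rw [sum_fin_succ_arrow, Fintype.sum_unique]
  rfl

lemma sum_fin_three_arrow (f : (Fin 3 → Fin n) → ℂ) :
    ∑ I, f I = ∑ a, ∑ b, ∑ c, f ![a, b, c] := by
  simp_rw [sum_fin_succ_arrow, Fintype.sum_unique]
  rfl

section pointwise

variable {h : (Fin n → ℂ) → Matrix (Fin n) (Fin n) ℂ} {U : Set (Fin n → ℂ)} {z : Fin n → ℂ}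

lemma sum_mul_ddbar_eq_zero (hk : ∀ I J, ddbarPow 1 h I J z = 0)
    (W : Fin n → Fin n → Fin n → Fin n → ℂ) (hW₁ : ∀ i k j l, W k i j l = -W i k j l)
    (hW₂ : ∀ i k j l, W i k l j = -W i k j l) :
    ∑ i, ∑ k, ∑ j, ∑ l, W i k j l * dz i (dzbar j fun y => h y k l) z = 0 := by
  have key := sum_alternating_mul_eq_zero (m := 2) (fun I J => W (I 0) (I 1) (J 0) (J 1))
    (fun I J => dz (I 0) (dzbar (J 0) fun w => ∏ m : Fin 1, h w (I m.succ) (J m.succ)) z)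
    ?_ hk
  · rw [sum_fin_two_arrow] at key
    simp_rw [sum_fin_two_arrow] at key
    simpa using key
  -- With two indices the transposition is the only nontrivial permutation, so the two sign rules
  -- give full alternation.
  · have hp : ∀ σ : Equiv.Perm (Fin 2), σ = 1 ∨ σ = Equiv.swap 0 1 := by decide
    intro σ τ I J
    rcases hp σ with rfl | rfl <;> rcases hp τ with rfl | rfl <;>
      simp [hW₁ (I 0) (I 1), hW₂ _ _ (J 0) (J 1)]

/-- In determinant form, alternation under all permutations of rows and columns comes from
`Matrix.det_permute` and `Matrix.det_permute'`. -/
lemma minor₃_eq_det (B : Matrix (Fin n) (Fin n) ℂ) (I J : Fin 3 → Fin n) :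
    minor₃ B (I 0) (I 1) (I 2) (J 0) (J 1) (J 2) = (B.submatrix I J).det := by
  rw [Matrix.det_fin_three]
  simp only [minor₃, minor₂, Matrix.submatrix_apply]
  ring

lemma sum_minor₃_mul_ddbar_eq_zero (hk : ∀ I J, ddbarPow 2 h I J z = 0)
    (B : Matrix (Fin n) (Fin n) ℂ) :
    ∑ i, ∑ k, ∑ p, ∑ j, ∑ l, ∑ q, minor₃ B i k p j l q *
      dz i (dzbar j fun y => h y k l * h y p q) z = 0 := by
  have key := sum_alternating_mul_eq_zero (m := 3) (fun I J => (B.submatrix I J).det)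
    (fun I J => dz (I 0) (dzbar (J 0) fun w => ∏ m : Fin 2, h w (I m.succ) (J m.succ)) z)
    ?_ hk
  · simp_rw [← minor₃_eq_det] at key
    rw [sum_fin_three_arrow] at key
    simp_rw [sum_fin_three_arrow, Fin.prod_univ_two] at key
    simpa using key
  · intro σ τ I J
    have : B.submatrix (I ∘ σ) (J ∘ τ) = ((B.submatrix I J).submatrix σ id).submatrix id τ := rfl
    rw [this, Matrix.det_permute', Matrix.det_permute]
    push_cast
    ring

lemma dz_dzbar_mul {f g : (Fin n → ℂ) → ℂ} (hU : IsOpen U) (hz : z ∈ U)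
    (hf : ContDiffOn ℝ ∞ f U) (hg : ContDiffOn ℝ ∞ g U) (c c' : ℂ) (i j : Fin n) :
    wirt c i (wirt c' j fun y => f y * g y) z =
      wirt c i (wirt c' j f) z * g z + wirt c' j f z * wirt c i g z +
        (wirt c i f z * wirt c' j g z + f z * wirt c i (wirt c' j g) z) := by
  have hd : ∀ {f : (Fin n → ℂ) → ℂ}, ContDiffOn ℝ ∞ f U → ∀ y ∈ U, DifferentiableAt ℝ f y :=
    fun hf y hy => (hf.contDiffAt (hU.mem_nhds hy)).differentiableAt (by simp)
  have h1 : Set.EqOn (wirt c' j fun y => f y * g y)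
      (fun y => wirt c' j f y * g y + f y * wirt c' j g y) U := fun y hy =>
    wirt_mul (hd hf y hy) (hd hg y hy)
  have hf' := hd (ContDiffOn.wirt (c := c') (i := j) hU hf) z hz
  have hg' := hd (ContDiffOn.wirt (c := c') (i := j) hU hg) z hz
  rw [wirt_congr_on hU h1 hz, wirt_add (hf'.fun_mul (hd hg z hz)) ((hd hf z hz).fun_mul hg'),
    wirt_mul hf' (hd hg z hz), wirt_mul (hd hf z hz) hg']

/-- `∂∂̄ω = 0` and `∂∂̄ω² = 0` annihilate the quadratic first-order terms
`∂g ∧ ∂̄g` contracted with `3 × 3` minors. -/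
lemma sum_minor₃_mul_dz_mul_dzbar_eq_zero (hU : IsOpen U) (hz : z ∈ U)
    (hh : ∀ i j, ContDiffOn ℝ ∞ (fun y => h y i j) U)
    (hk₁ : ∀ I J, ddbarPow 1 h I J z = 0) (hk₂ : ∀ I J, ddbarPow 2 h I J z = 0)
    (B : Matrix (Fin n) (Fin n) ℂ) :
    ∑ i, ∑ k, ∑ p, ∑ j, ∑ l, ∑ q, minor₃ B i k p j l q *
      (dz i (fun y => h y k l) z * dzbar j (fun y => h y p q) z) = 0 := by
  have h2 := sum_minor₃_mul_ddbar_eq_zero hk₂ B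
  set a : Fin n → Fin n → Fin n → Fin n → ℂ := fun i k j l => dz i (dzbar j fun y => h y k l) z
    with ha
  set S := ∑ i, ∑ k, ∑ p, ∑ j, ∑ l, ∑ q, minor₃ B i k p j l q *
      (dz i (fun y => h y k l) z * dzbar j (fun y => h y p q) z) with hS
  -- Leibniz gives two terms with ∂∂̄g and two with first derivatives. The first mixed term is
  -- written with (k, l) and (p, q) exchanged in the minor, which leaves the minor unchanged, so
  -- that relabelling identifies its sum with `S`.
  have e : ∀ i k p j l q, minor₃ B i k p j l q *
      dz i (dzbar j fun y => h y k l * h y p q) z =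
      minor₃ B i k p j l q * h z p q * a i k j l +
      minor₃ B i p k j q l * (dz i (fun y => h y p q) z * dzbar j (fun y => h y k l) z) +
      minor₃ B i k p j l q * (dz i (fun y => h y k l) z * dzbar j (fun y => h y p q) z) +
      minor₃ B i k p j l q * h z k l * a i p j q := by
    intro i k p j l q
    have e1 : minor₃ B i p k j q l = minor₃ B i k p j l q := by
      simp only [minor₃, minor₂]; ring
    rw [e1]
    simp only [ha, dz_eq_wirt, dzbar_eq_wirt]
    rw [dz_dzbar_mul hU hz (hh k l) (hh p q)]
    ring
  simp_rw [e, Finset.sum_add_distrib] at h2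
  -- This is the term ω ∧ ∂∂̄ω: contracting (p, q) against g leaves an array still alternating in
  -- (i, k) and in (j, l), to which ∂∂̄ω = 0 applies.
  have t1 : ∑ i, ∑ k, ∑ p, ∑ j, ∑ l, ∑ q, minor₃ B i k p j l q * h z p q * a i k j l = 0 := by
    have := sum_mul_ddbar_eq_zero hk₁
      (fun i k j l => ∑ p, ∑ q, minor₃ B i k p j l q * h z p q) ?_ ?_
    · rw [← this]
      refine Finset.sum_congr rfl fun i _ => Finset.sum_congr rfl fun k _ => ?_
      rw [Finset.sum_comm]
      refine Finset.sum_congr rfl fun j _ => ?_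
      rw [Finset.sum_comm]
      simp_rw [Finset.sum_mul]
      rfl
    · intro i k j l
      simp_rw [← Finset.sum_neg_distrib]
      refine Finset.sum_congr rfl fun p _ => Finset.sum_congr rfl fun q _ => ?_
      simp only [minor₃, minor₂]; ring
    · intro i k j l
      simp_rw [← Finset.sum_neg_distrib]
      refine Finset.sum_congr rfl fun p _ => Finset.sum_congr rfl fun q _ => ?_
      simp only [minor₃, minor₂]; ring
  have swap : ∀ f : Fin n → Fin n → Fin n → Fin n → Fin n → Fin n → ℂ,
      ∑ i, ∑ k, ∑ p, ∑ j, ∑ l, ∑ q, f i k p j l q =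
        ∑ i, ∑ k, ∑ p, ∑ j, ∑ l, ∑ q, f i p k j q l := by
    intro f
    refine Finset.sum_congr rfl fun i _ => ?_
    rw [Finset.sum_comm]
    refine Finset.sum_congr rfl fun k _ => Finset.sum_congr rfl fun p _ =>
      Finset.sum_congr rfl fun j _ => Finset.sum_comm
  have t4 : ∑ i, ∑ k, ∑ p, ∑ j, ∑ l, ∑ q, minor₃ B i k p j l q * h z k l * a i p j q = 0 := by
    rw [swap, ← t1]
    refine Finset.sum_congr rfl fun i _ => Finset.sum_congr rfl fun k _ =>
      Finset.sum_congr rfl fun p _ => Finset.sum_congr rfl fun j _ =>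
      Finset.sum_congr rfl fun l _ => Finset.sum_congr rfl fun q _ => ?_
    simp only [minor₃, minor₂]; ring
  rw [t1, t4, ← swap, ← hS, zero_add, add_zero] at h2
  -- Only the two equal first-order sums remain, so 2S = 0.
  linear_combination h2 / 2

/-- The consequences at a point of `∂∂̄ω = 0` and `∂∂̄ω² = 0`, in a form that is stable under adding
`√-1 ∂∂̄u` to `ω`. -/
structure IsPluriclosedAt (h : (Fin n → ℂ) → Matrix (Fin n) (Fin n) ℂ) (z : Fin n → ℂ) : Prop where
  second : ∀ W : Fin n → Fin n → Fin n → Fin n → ℂ, (∀ i k j l, W k i j l = -W i k j l) →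
    (∀ i k j l, W i k l j = -W i k j l) →
    ∑ i, ∑ k, ∑ j, ∑ l, W i k j l * dz i (dzbar j fun y => h y k l) z = 0
  first : ∀ B : Matrix (Fin n) (Fin n) ℂ,
    ∑ i, ∑ k, ∑ p, ∑ j, ∑ l, ∑ q, minor₃ B i k p j l q *
      (dz i (fun y => h y k l) z * dzbar j (fun y => h y p q) z) = 0

lemma isPluriclosedAt_of_ddbarPow (hU : IsOpen U) (hz : z ∈ U)
    (hh : ∀ i j, ContDiffOn ℝ ∞ (fun y => h y i j) U)
    (hk₁ : ∀ I J, ddbarPow 1 h I J z = 0) (hk₂ : ∀ I J, ddbarPow 2 h I J z = 0) :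
    IsPluriclosedAt h z :=
  ⟨sum_mul_ddbar_eq_zero hk₁, sum_minor₃_mul_dz_mul_dzbar_eq_zero hU hz hh hk₁ hk₂⟩

lemma sum_antisymm_eq_zero {f : Fin n → Fin n → ℂ} (hf : ∀ i k, f k i = -f i k) :
    ∑ i, ∑ k, f i k = 0 := by
  have h : ∑ i, ∑ k, f i k = -∑ i, ∑ k, f i k := by
    conv_lhs => rw [Finset.sum_comm]
    simp_rw [← Finset.sum_neg_distrib]
    exact Finset.sum_congr rfl fun i _ => Finset.sum_congr rfl fun k _ => hf i k
  exact self_eq_neg.1 h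

/-- Closedness of √-1∂∂̄u: ∂ᵢ u_{k l̄} is symmetric in (i, k) and ∂_j̄ u_{p q̄} is symmetric in (j,
q), so every new term is a symmetric array paired with an alternating one. -/
lemma IsPluriclosedAt.add_ddbar (hp : IsPluriclosedAt h z) (hU : IsOpen U) (hz : z ∈ U)
    (hh : ∀ i j, ContDiffOn ℝ ∞ (fun y => h y i j) U) {u : (Fin n → ℂ) → ℝ}
    (hu : ContDiffOn ℝ ∞ (fun y => (u y : ℂ)) U) :
    IsPluriclosedAt (fun y => h y + ddbar u y) z := by
  have hd : ∀ {f : (Fin n → ℂ) → ℂ}, ContDiffOn ℝ ∞ f U → ∀ y ∈ U, DifferentiableAt ℝ f y :=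
    fun hf y hy => (hf.contDiffAt (hU.mem_nhds hy)).differentiableAt (by simp)
  have hw : ∀ c (i : Fin n) {f : (Fin n → ℂ) → ℂ}, ContDiffOn ℝ ∞ f U →
    ContDiffOn ℝ ∞ (wirt c i f) U := fun c i f hf => ContDiffOn.wirt hU hf
  have hc : ∀ {f : (Fin n → ℂ) → ℂ}, ContDiffOn ℝ ∞ f U → ∀ y ∈ U, ∀ c c' (i j : Fin n),
      wirt c i (wirt c' j f) y = wirt c' j (wirt c i f) y := fun hf y hy c c' i j =>
    wirt_wirt_comm (hf.contDiffAt (hU.mem_nhds hy))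
  have hφ : ∀ k l, ContDiffOn ℝ ∞ (fun y => ddbar u y k l) U := fun k l => by
    simp only [ddbar, Matrix.of_apply, dz_eq_wirt, dzbar_eq_wirt]
    exact hw _ _ (hw _ _ hu)
  have hφz : ∀ i k l, dz i (fun y => ddbar u y k l) z = dz k (fun y => ddbar u y i l) z := by
    intro i k l
    simp only [ddbar, Matrix.of_apply, dz_eq_wirt, dzbar_eq_wirt]
    exact hc (hw _ _ hu) z hz _ _ _ _
  have hφzbar : ∀ j p q, dzbar j (fun y => ddbar u y p q) z =
      dzbar q (fun y => ddbar u y p j) z := by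
    intro j p q
    have e : ∀ q, Set.EqOn (fun y => ddbar u y p q)
        (dzbar q (dz p fun w => (u w : ℂ))) U := fun q y hy => by
      simp only [ddbar, Matrix.of_apply, dz_eq_wirt, dzbar_eq_wirt]
      exact hc hu y hy _ _ _ _
    simp only [dzbar_eq_wirt]
    rw [wirt_congr_on hU (e q) hz, wirt_congr_on hU (e j) hz]
    simp only [dz_eq_wirt, dzbar_eq_wirt]
    exact hc (hw _ _ hu) z hz _ _ _ _
  have e1 : ∀ c (i : Fin n) k l, ∀ y ∈ U, wirt c i (fun y => (h y + ddbar u y) k l) y =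
      wirt c i (fun y => h y k l) y + wirt c i (fun y => ddbar u y k l) y := fun c i k l y hy =>
    wirt_add (hd (hh k l) y hy) (hd (hφ k l) y hy)
  constructor
  · intro W hW₁ hW₂
    have e2 : ∀ i k j l, W i k j l * dz i (dzbar j fun y => (h y + ddbar u y) k l) z =
        W i k j l * dz i (dzbar j fun y => h y k l) z +
          W i k j l * dzbar j (dz i fun y => ddbar u y k l) z := by
      intro i k j l
      simp only [dz_eq_wirt, dzbar_eq_wirt]
      rw [wirt_congr_on hU (e1 _ j k l) hz, wirt_add (hd (hw _ _ (hh k l)) z hz)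
        (hd (hw _ _ (hφ k l)) z hz), hc (hφ k l) z hz, mul_add]
    simp_rw [e2, Finset.sum_add_distrib]
    rw [hp.second W hW₁ hW₂, zero_add]
    refine sum_antisymm_eq_zero fun i k => ?_
    simp_rw [← Finset.sum_neg_distrib]
    refine Finset.sum_congr rfl fun j _ => Finset.sum_congr rfl fun l _ => ?_
    have e3 : dzbar j (dz k fun y => ddbar u y i l) z = dzbar j (dz i fun y => ddbar u y k l) z := by
      rw [dzbar_eq_wirt]
      refine wirt_congr_on hU (fun y hy => ?_) hz
      simp only [ddbar, Matrix.of_apply, dz_eq_wirt, dzbar_eq_wirt]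
      exact hc (hw _ _ hu) y hy _ _ _ _
    rw [hW₁, e3, neg_mul]
  · intro B
    -- Three terms suffice: once u sits in the ∂-factor, symmetry in (i, k) kills the product
    -- whatever the ∂̄-factor is, so that factor is not split.
    have e2 : ∀ i k p j l q, minor₃ B i k p j l q * (dz i (fun y => (h y + ddbar u y) k l) z *
        dzbar j (fun y => (h y + ddbar u y) p q) z) =
        minor₃ B i k p j l q * (dz i (fun y => h y k l) z * dzbar j (fun y => h y p q) z) +
        minor₃ B i k p j l q * (dz i (fun y => h y k l) z * dzbar j (fun y => ddbar u y p q) z) +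
        minor₃ B i k p j l q * (dz i (fun y => ddbar u y k l) z *
          dzbar j (fun y => (h y + ddbar u y) p q) z) := by
      intro i k p j l q
      simp only [dz_eq_wirt, dzbar_eq_wirt]
      rw [e1 _ _ _ _ z hz, e1 _ _ _ _ z hz]
      ring
    simp_rw [e2, Finset.sum_add_distrib]
    rw [hp.first B, zero_add]
    have t1 : ∑ i, ∑ k, ∑ p, ∑ j, ∑ l, ∑ q, minor₃ B i k p j l q *
        (dz i (fun y => h y k l) z * dzbar j (fun y => ddbar u y p q) z) = 0 := by
      refine Finset.sum_eq_zero fun i _ => Finset.sum_eq_zero fun k _ =>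
        Finset.sum_eq_zero fun p _ => ?_
      rw [Finset.sum_comm]
      refine Finset.sum_eq_zero fun l _ => sum_antisymm_eq_zero fun j q => ?_
      rw [hφzbar q p j]
      simp only [minor₃, minor₂]; ring
    rw [t1, zero_add]
    refine sum_antisymm_eq_zero fun i k => ?_
    simp_rw [← Finset.sum_neg_distrib]
    refine Finset.sum_congr rfl fun p _ => Finset.sum_congr rfl fun j _ =>
      Finset.sum_congr rfl fun l _ => Finset.sum_congr rfl fun q _ => ?_
    rw [hφz k i l]
    simp only [minor₃, minor₂]; ring

/-- The divergence `∑ᵢ ∂ᵢ (det(g) g^{i j̄})` of the adjugate matrix. -/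
def divAdj (h : (Fin n → ℂ) → Matrix (Fin n) (Fin n) ℂ) (j : Fin n) (z : Fin n → ℂ) : ℂ :=
  ∑ i, dz i (adjMetric h i j) z

lemma divAdj_eq_sum (hU : IsOpen U) (hz : z ∈ U)
    (hh : ∀ i j, ContDiffOn ℝ ∞ (fun y => h y i j) U) (hdet : ∀ y ∈ U, (h y).det ≠ 0)
    (j : Fin n) :
    divAdj h j z = ∑ i, ∑ p, ∑ q, (h z).det * minor₂ (h z)⁻¹ᵀ i p j q * dz i (fun y => h y p q) z := by
  simp only [divAdj, dz_eq_wirt, wirt_adjMetric hU hz hh hdet]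

/-- Exchanging the names of i and p in the crossed product of the minor turns the divergence into
det(g) g^{k j̄}(Γᵖ_{kp} - Γᵖ_{pk}), a trace of the torsion with the opposite sign. -/
lemma divAdj_eq_trTorsion (hU : IsOpen U) (hz : z ∈ U)
    (hh : ∀ i j, ContDiffOn ℝ ∞ (fun y => h y i j) U) (hdet : ∀ y ∈ U, (h y).det ≠ 0)
    (j : Fin n) :
    divAdj h j z = -((h z).det * ∑ k, invMetric h k j z * trTorsion h k z) := by
  rw [divAdj_eq_sum hU hz hh hdet]
  have e : ∑ i, ∑ p, ∑ q, (h z).det * minor₂ (h z)⁻¹ᵀ i p j q * dz i (fun y => h y p q) z =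
      (h z).det * (∑ i, ∑ p, ∑ q, invMetric h i j z * invMetric h p q z *
          dz i (fun y => h y p q) z -
        ∑ p, ∑ i, ∑ q, invMetric h i q z * invMetric h p j z * dz i (fun y => h y p q) z) := by
    rw [Finset.sum_comm (f := fun p i => ∑ q, invMetric h i q z * invMetric h p j z *
      dz i (fun y => h y p q) z)]
    simp only [Finset.mul_sum, ← Finset.sum_sub_distrib, minor₂, invMetric,
      Matrix.transpose_apply]
    refine Finset.sum_congr rfl fun i _ => Finset.sum_congr rfl fun p _ =>
      Finset.sum_congr rfl fun q _ => ?_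
    ring
  rw [e, ← Finset.sum_sub_distrib, ← mul_neg, ← Finset.sum_neg_distrib]
  congr 1
  refine Finset.sum_congr rfl fun k _ => ?_
  simp only [trTorsion, torsion, christoffel, Finset.mul_sum, ← Finset.sum_sub_distrib,
    ← Finset.sum_neg_distrib]
  refine Finset.sum_congr rfl fun i _ => Finset.sum_congr rfl fun p _ => ?_
  ring

lemma contDiffOn_invMetric (hh : ∀ i j, ContDiffOn ℝ ∞ (fun y => h y i j) U)
    (hdet : ∀ y ∈ U, (h y).det ≠ 0) (i j : Fin n) : ContDiffOn ℝ ∞ (invMetric h i j) U :=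
  contDiffOn_inv hh hdet j i

lemma contDiffOn_adjMetric (hh : ∀ i j, ContDiffOn ℝ ∞ (fun y => h y i j) U)
    (hdet : ∀ y ∈ U, (h y).det ≠ 0) (i j : Fin n) : ContDiffOn ℝ ∞ (adjMetric h i j) U :=
  (contDiffOn_det hh).mul (contDiffOn_invMetric hh hdet i j)

lemma contDiffOn_minor₂ (hh : ∀ i j, ContDiffOn ℝ ∞ (fun y => h y i j) U)
    (hdet : ∀ y ∈ U, (h y).det ≠ 0) (i k j l : Fin n) :
    ContDiffOn ℝ ∞ (fun y => minor₂ (h y)⁻¹ᵀ i k j l) U :=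
  ((contDiffOn_invMetric hh hdet i j).mul (contDiffOn_invMetric hh hdet k l)).sub
    ((contDiffOn_invMetric hh hdet i l).mul (contDiffOn_invMetric hh hdet k j))

/-- The double divergence of the adjugate matrix, i.e. `∂∂̄(ωⁿ⁻¹)`, vanishes. -/
lemma sum_dzbar_divAdj_eq_zero (hU : IsOpen U) (hz : z ∈ U)
    (hh : ∀ i j, ContDiffOn ℝ ∞ (fun y => h y i j) U) (hdet : ∀ y ∈ U, (h y).det ≠ 0)
    (hp : IsPluriclosedAt h z) :
    ∑ j, dzbar j (divAdj h j) z = 0 := by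
  have hd : ∀ {f : (Fin n → ℂ) → ℂ}, ContDiffOn ℝ ∞ f U → DifferentiableAt ℝ f z :=
    fun hf => (hf.contDiffAt (hU.mem_nhds hz)).differentiableAt (by simp)
  have hC : ∀ i p j q, ContDiffOn ℝ ∞ (fun y => (h y).det * minor₂ (h y)⁻¹ᵀ i p j q) U :=
    fun i p j q => (contDiffOn_det hh).mul (contDiffOn_minor₂ hh hdet i p j q)
  have hH : ∀ i p q, ContDiffOn ℝ ∞ (wirt (-Complex.I) i fun y => h y p q) U :=
    fun i p q => ContDiffOn.wirt hU (hh p q)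
  -- The ∂̄-derivative either hits det(g) times the 2 × 2 minor, giving a 3 × 3 minor against ∂g
  -- ∂̄g, or hits ∂g, giving a 2 × 2 minor against ∂∂̄g. The fields `first` and `second` of
  -- `IsPluriclosedAt` remove the two kinds.
  have e : ∀ j, dzbar j (divAdj h j) z = ∑ i, ∑ p, ∑ q,
      ((∑ r, ∑ s, (h z).det * (minor₃ (h z)⁻¹ᵀ i p r j q s *
        (dz i (fun y => h y p q) z * dzbar j (fun y => h y r s) z))) +
      (h z).det * (minor₂ (h z)⁻¹ᵀ i p j q * dz i (dzbar j fun y => h y p q) z)) := by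
    intro j
    rw [dzbar_eq_wirt, wirt_congr_on hU (fun y hy => divAdj_eq_sum hU hy hh hdet j) hz]
    simp only [dz_eq_wirt]
    rw [wirt_sum fun i _ => DifferentiableAt.fun_sum fun p _ => DifferentiableAt.fun_sum
      fun q _ => (hd (hC i p j q)).fun_mul (hd (hH i p q))]
    refine Finset.sum_congr rfl fun i _ => ?_
    rw [wirt_sum fun p _ => DifferentiableAt.fun_sum
      fun q _ => (hd (hC i p j q)).fun_mul (hd (hH i p q))]
    refine Finset.sum_congr rfl fun p _ => ?_
    rw [wirt_sum fun q _ => (hd (hC i p j q)).fun_mul (hd (hH i p q))]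
    refine Finset.sum_congr rfl fun q _ => ?_
    rw [wirt_mul (hd (hC i p j q)) (hd (hH i p q)), wirt_det_mul_minor₂ hU hz hh hdet,
      wirt_wirt_comm ((hh p q).contDiffAt (hU.mem_nhds hz))]
    simp only [Finset.sum_mul]
    congr 1
    · refine Finset.sum_congr rfl fun r _ => Finset.sum_congr rfl fun s _ => ?_
      ring
    · ring
  simp_rw [e, Finset.sum_add_distrib, ← Finset.mul_sum]
  have t1 := hp.first (h z)⁻¹ᵀ
  have t2 := hp.second (fun i k j l => minor₂ (h z)⁻¹ᵀ i k j l)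
    (fun i k j l => by simp only [minor₂]; ring) (fun i k j l => by simp only [minor₂]; ring)
  have s1 : ∀ f : Fin n → Fin n → Fin n → Fin n → ℂ, ∑ j, ∑ i, ∑ p, ∑ q, f i p j q =
      ∑ i, ∑ p, ∑ j, ∑ q, f i p j q := by
    intro f
    rw [Finset.sum_comm]
    exact Finset.sum_congr rfl fun i _ => Finset.sum_comm
  have t2' := (s1 fun i p j q => minor₂ (h z)⁻¹ᵀ i p j q * dz i (dzbar j fun y => h y p q) z).trans t2
  have t1' : ∑ j, ∑ i, ∑ p, ∑ q, ∑ r, ∑ s, minor₃ (h z)⁻¹ᵀ i p r j q s *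
        (dz i (fun y => h y p q) z * dzbar j (fun y => h y r s) z) = 0 := by
    rw [s1, ← t1]
    refine Finset.sum_congr rfl fun i _ => Finset.sum_congr rfl fun p _ => ?_
    exact Eq.trans (Finset.sum_congr rfl fun j _ => Finset.sum_comm) Finset.sum_comm
  rw [t1', t2', mul_zero, add_zero]

end pointwise

/-! ### Hermitian symmetry and the double divergence of a function times the adjugate. -/

section pointwise

variable {h : (Fin n → ℂ) → Matrix (Fin n) (Fin n) ℂ} {U : Set (Fin n → ℂ)} {z : Fin n → ℂ}

lemma det_conj_of_isHermitian {M : Matrix (Fin n) (Fin n) ℂ} (hM : M.IsHermitian) :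
    starRingEnd ℂ M.det = M.det := by
  conv_rhs => rw [← hM.eq, Matrix.det_conjTranspose]
  rfl

lemma ofReal_det_re {M : Matrix (Fin n) (Fin n) ℂ} (hM : M.IsHermitian) :
    ((M.det.re : ℝ) : ℂ) = M.det :=
  Complex.conj_eq_iff_re.1 (det_conj_of_isHermitian hM)

lemma invMetric_conj (hM : (h z).IsHermitian) (i j : Fin n) :
    starRingEnd ℂ (invMetric h i j z) = invMetric h j i z := by
  have := congrFun (congrFun hM.inv.eq i) j
  rw [Matrix.conjTranspose_apply] at this
  exact this

lemma adjMetric_conj (hM : (h z).IsHermitian) (i j : Fin n) :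
    starRingEnd ℂ (adjMetric h i j z) = adjMetric h j i z := by
  simp only [adjMetric, map_mul, det_conj_of_isHermitian hM, invMetric_conj hM]

lemma ddbar_isHermitian {u : (Fin n → ℂ) → ℝ} (hU : IsOpen U) (hz : z ∈ U)
    (hu : ContDiffOn ℝ ∞ (fun y => (u y : ℂ)) U) : (ddbar u z).IsHermitian := by
  ext i j
  rw [Matrix.conjTranspose_apply]
  simp only [ddbar, Matrix.of_apply]
  have e1 : dzbar i (fun w => (u w : ℂ)) =
      fun y => starRingEnd ℂ (dz i (fun w => (u w : ℂ)) y) := by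
    ext y; rw [dz_ofReal]; simp
  rw [e1, dz_conj, RCLike.star_def, Complex.conj_conj, dzbar_eq_wirt, dz_eq_wirt,
    wirt_wirt_comm (hu.contDiffAt (hU.mem_nhds hz))]

/-- The pointwise heart of the proof. In the Leibniz expansion the undifferentiated u multiplies the
double divergence of the adjugate, which vanishes. The two first-order sums are conjugate to each
other, as u is real and the adjugate Hermitian, and the divergence formula turns them into the real
part in `torsionTerm`. -/
lemma sum_dzbar_dz_mul_adjMetric (hU : IsOpen U) (hz : z ∈ U)
    (hh : ∀ i j, ContDiffOn ℝ ∞ (fun y => h y i j) U) (hdet : ∀ y ∈ U, (h y).det ≠ 0)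
    (hherm : ∀ y ∈ U, (h y).IsHermitian)
    (hp : IsPluriclosedAt h z)
    {u : (Fin n → ℂ) → ℝ} (hu : ContDiffOn ℝ ∞ (fun y => (u y : ℂ)) U) :
    ∑ i, ∑ j, dzbar j (dz i fun y => (u y : ℂ) * adjMetric h i j y) z =
      (h z).det * ((∑ i, ∑ j, invMetric h i j z * ddbar u z i j) - torsionTerm h u z) := by
  have hA := contDiffOn_adjMetric hh hdet
  have hd : ∀ {f : (Fin n → ℂ) → ℂ}, ContDiffOn ℝ ∞ f U → DifferentiableAt ℝ f z :=
    fun hf => (hf.contDiffAt (hU.mem_nhds hz)).differentiableAt (by simp)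
  have e : ∀ i j, dzbar j (dz i fun y => (u y : ℂ) * adjMetric h i j y) z =
      adjMetric h i j z * ddbar u z i j +
      starRingEnd ℂ (dzbar i (fun y => (u y : ℂ)) z) * dzbar j (adjMetric h i j) z +
      dzbar j (fun y => (u y : ℂ)) z * dz i (adjMetric h i j) z +
      u z * dzbar j (dz i (adjMetric h i j)) z := by
    intro i j
    rw [← dz_ofReal]
    simp only [dz_eq_wirt, dzbar_eq_wirt, ddbar, Matrix.of_apply]
    rw [dz_dzbar_mul hU hz hu (hA i j), wirt_wirt_comm (hu.contDiffAt (hU.mem_nhds hz))]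
    ring
  have h1 : ∀ i, ∑ j, dzbar j (adjMetric h i j) z = starRingEnd ℂ (divAdj h i z) := by
    intro i
    simp only [divAdj, map_sum]
    refine Finset.sum_congr rfl fun j _ => ?_
    rw [← dzbar_conj, dzbar_eq_wirt]
    exact wirt_congr_on hU (fun y hy => (adjMetric_conj (hherm y hy) j i).symm) hz
  have h2 : ∑ i, ∑ j, u z * dzbar j (dz i (adjMetric h i j)) z = 0 := by
    simp_rw [← Finset.mul_sum]
    rw [Finset.sum_comm, ← mul_zero (u z : ℂ),
      ← sum_dzbar_divAdj_eq_zero hU hz hh hdet hp]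
    congr 1
    refine Finset.sum_congr rfl fun j _ => ?_
    unfold divAdj
    rw [dzbar_eq_wirt, wirt_sum]
    intro i _
    rw [dz_eq_wirt]
    exact hd (ContDiffOn.wirt hU (hA i j))
  have h3 : ∑ i, ∑ j, dzbar j (fun y => (u y : ℂ)) z * dz i (adjMetric h i j) z =
      ∑ j, dzbar j (fun y => (u y : ℂ)) z * divAdj h j z := by
    rw [Finset.sum_comm]
    simp_rw [divAdj, Finset.mul_sum]
  have h4 : ∑ i, ∑ j, starRingEnd ℂ (dzbar i (fun y => (u y : ℂ)) z) *
      dzbar j (adjMetric h i j) z =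
      starRingEnd ℂ (∑ j, dzbar j (fun y => (u y : ℂ)) z * divAdj h j z) := by
    simp_rw [← Finset.mul_sum, h1, map_sum, map_mul]
  have h5 : ∑ j, dzbar j (fun y => (u y : ℂ)) z * divAdj h j z = -((h z).det *
      ∑ j, ∑ k, invMetric h j k z * trTorsion h j z * dzbar k (fun w => (u w : ℂ)) z) := by
    simp_rw [divAdj_eq_trTorsion hU hz hh hdet]
    rw [Finset.sum_comm]
    simp_rw [mul_neg, Finset.sum_neg_distrib, Finset.mul_sum]
    congr 1
    refine Finset.sum_congr rfl fun j _ => Finset.sum_congr rfl fun k _ => ?_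
    ring
  simp_rw [e, Finset.sum_add_distrib]
  rw [h2, h3, h4, h5]
  simp only [map_neg, map_mul, det_conj_of_isHermitian (hherm z hz), torsionTerm]
  set q := ∑ j, ∑ k, invMetric h j k z * trTorsion h j z * dzbar k (fun w => (u w : ℂ)) z
  have h6 := Complex.add_conj q
  have h7 : ∑ i, ∑ j, adjMetric h i j z * ddbar u z i j =
      (h z).det * ∑ i, ∑ j, invMetric h i j z * ddbar u z i j := by
    simp_rw [Finset.mul_sum, adjMetric, mul_assoc]
  rw [h7]
  push_cast at h6 ⊢
  linear_combination -(h z).det * h6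

end pointwise

/-! ### Integration on open subsets of `ℂⁿ` -/

section integration

variable {U K : Set (Fin n → ℂ)}

lemma integrableOn_of_eq_zero_off_compact {β : Type*} [NormedAddCommGroup β]
    {f : (Fin n → ℂ) → β} (hU : IsOpen U) (hK : IsCompact K) (hKU : K ⊆ U)
    (hf : ContinuousOn f U) (hfK : ∀ z ∈ U, z ∉ K → f z = 0) : IntegrableOn f U :=
  ((hf.mono hKU).integrableOn_compact hK).of_forall_sdiff_eq_zero hU.measurableSet
    fun z hz => hfK z hz.1 hz.2

lemma contDiff_indicator {g : (Fin n → ℂ) → ℂ} (hU : IsOpen U) (hK : IsCompact K) (hKU : K ⊆ U)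
    (hg : ContDiffOn ℝ ∞ g U) (hgK : ∀ z ∈ U, z ∉ K → g z = 0) :
    ContDiff ℝ ∞ (U.indicator g) := by
  rw [contDiff_iff_contDiffAt]
  intro z
  by_cases hz : z ∈ K
  · exact (hg.contDiffAt (hU.mem_nhds (hKU hz))).congr_of_eventuallyEq
      ((Set.eqOn_indicator (f := g)).eventuallyEq_of_mem (hU.mem_nhds (hKU hz)))
  · refine (contDiffAt_const (c := (0 : ℂ))).congr_of_eventuallyEq ?_
    filter_upwards [hK.isClosed.isOpen_compl.mem_nhds hz] with y hy
    by_cases hyU : y ∈ U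
    · rw [Set.indicator_of_mem hyU, hgK y hyU hy]
    · rw [Set.indicator_of_notMem hyU]

lemma wirt_eq_zero_off_compact {c : ℂ} {i : Fin n} {g : (Fin n → ℂ) → ℂ} (hU : IsOpen U)
    (hK : IsCompact K) (hgK : ∀ z ∈ U, z ∉ K → g z = 0) :
    ∀ z ∈ U, z ∉ K → wirt c i g z = 0 := by
  intro z hz hzK
  have h : Set.EqOn g (fun _ => 0) (U ∩ Kᶜ) := fun y hy => hgK y hy.1 hy.2
  rw [wirt_congr_on (hU.inter hK.isClosed.isOpen_compl) h ⟨hz, hzK⟩, wirt_const]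

lemma fderiv_eq_zero_off_compact {g : (Fin n → ℂ) → ℂ} (hU : IsOpen U)
    (hK : IsCompact K) (hgK : ∀ z ∈ U, z ∉ K → g z = 0) :
    ∀ z ∈ U, z ∉ K → fderiv ℝ g z = 0 := by
  intro z hz hzK
  have h : Set.EqOn g (fun _ => 0) (U ∩ Kᶜ) := fun y hy => hgK y hy.1 hy.2
  rw [(h.eventuallyEq_of_mem ((hU.inter hK.isClosed.isOpen_compl).mem_nhds ⟨hz, hzK⟩)).fderiv_eq]
  simp

variable {f g : (Fin n → ℂ) → ℂ}

/-- Only g has compact support in U. Replacing g by its extension by zero brings in integration by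
parts on all of ℂⁿ, where differentiability of f is needed only on the support of that extension. -/
lemma integral_mul_fderiv_eq (hU : IsOpen U) (hK : IsCompact K) (hKU : K ⊆ U)
    (hf : ContDiffOn ℝ ∞ f U) (hg : ContDiffOn ℝ ∞ g U) (hgK : ∀ z ∈ U, z ∉ K → g z = 0)
    (v : Fin n → ℂ) :
    ∫ z in U, f z * fderiv ℝ g z v = -∫ z in U, fderiv ℝ f z v * g z := by
  set G := U.indicator g with hG
  have hGs : ContDiff ℝ ∞ G := contDiff_indicator hU hK hKU hg hgK
  have hGU : Set.EqOn G g U := Set.eqOn_indicator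
  have hG0 : ∀ z, z ∉ K → G z = 0 := by
    intro z hz
    by_cases hzU : z ∈ U
    · rw [hGU hzU, hgK z hzU hz]
    · exact Set.indicator_of_notMem hzU _
  have hG0' : ∀ z, z ∉ K → fderiv ℝ G z = 0 := fun z hz =>
    fderiv_eq_zero_off_compact isOpen_univ hK (fun z _ => hG0 z) z trivial hz
  have hGd : ∀ z ∈ U, fderiv ℝ G z = fderiv ℝ g z := fun z hz =>
    (hGU.eventuallyEq_of_mem (hU.mem_nhds hz)).fderiv_eq
  have hGt : tsupport G ⊆ K := closure_minimal
    (fun z hz => by_contra fun h => hz (hG0 z h)) hK.isClosed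
  have hf' : ContinuousOn (fun z => fderiv ℝ f z v) U :=
    ((hf.fderiv_of_isOpen (m := ∞) hU (by simp)).clm_apply contDiffOn_const).continuousOn
  have hGc : Continuous fun z => fderiv ℝ G z v :=
    (hGs.continuous_fderiv (by simp)).clm_apply continuous_const
  have toU : ∀ F : (Fin n → ℂ) → ℂ, ContinuousOn F U → (∀ z, z ∉ K → F z = 0) →
      Integrable F ∧ ∫ z, F z = ∫ z in U, F z := by
    intro F hF hF0
    refine ⟨?_, (setIntegral_eq_integral_of_forall_compl_eq_zero
      fun z hz => hF0 z fun h => hz (hKU h)).symm⟩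
    exact (integrableOn_of_eq_zero_off_compact hU hK hKU hF
      fun z _ => hF0 z).integrable_of_forall_notMem_eq_zero fun z hz => hF0 z fun h => hz (hKU h)
  obtain ⟨i1, e1⟩ := toU (fun z => fderiv ℝ f z v * G z)
    (hf'.mul hGs.continuous.continuousOn) (fun z hz => by simp [hG0 z hz])
  obtain ⟨i2, e2⟩ := toU (fun z => f z * fderiv ℝ G z v)
    (hf.continuousOn.mul hGc.continuousOn) (fun z hz => by simp [hG0' z hz])
  obtain ⟨i3, -⟩ := toU (fun z => f z * G z)
    (hf.continuousOn.mul hGs.continuous.continuousOn) (fun z hz => by simp [hG0 z hz])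
  have key := integral_mul_fderiv_eq_neg_fderiv_mul_of_integrable (μ := volume) i1 i2 i3
    (fun z hz => (hf.contDiffAt (hU.mem_nhds (hKU (hGt hz)))).differentiableAt (by simp))
    (fun z _ => (hGs.differentiable (by simp)) z)
  rw [e1, e2] at key
  rw [setIntegral_congr_fun hU.measurableSet (g := fun z => f z * fderiv ℝ G z v)
      (fun z hz => by simp only [hGd z hz]), key,
    setIntegral_congr_fun hU.measurableSet (g := fun z => fderiv ℝ f z v * g z)
      (fun z hz => by simp only [hGU hz])]

lemma integral_mul_wirt (hU : IsOpen U) (hK : IsCompact K) (hKU : K ⊆ U)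
    (hf : ContDiffOn ℝ ∞ f U) (hg : ContDiffOn ℝ ∞ g U) (hgK : ∀ z ∈ U, z ∉ K → g z = 0)
    (c : ℂ) (i : Fin n) :
    ∫ z in U, f z * wirt c i g z = -∫ z in U, wirt c i f z * g z := by
  have hc : ∀ {f : (Fin n → ℂ) → ℂ}, ContDiffOn ℝ ∞ f U → ∀ v,
      ContinuousOn (fun z => fderiv ℝ f z v) U := fun hf v =>
    ((hf.fderiv_of_isOpen (m := ∞) hU (by simp)).clm_apply contDiffOn_const).continuousOn
  have i1 : ∀ v, IntegrableOn (fun z => f z * fderiv ℝ g z v) U := fun v =>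
    integrableOn_of_eq_zero_off_compact hU hK hKU (hf.continuousOn.mul (hc hg v))
      fun z hz hzK => by simp [fderiv_eq_zero_off_compact hU hK hgK z hz hzK]
  have i2 : ∀ v, IntegrableOn (fun z => fderiv ℝ f z v * g z) U := fun v =>
    integrableOn_of_eq_zero_off_compact hU hK hKU ((hc hf v).mul hg.continuousOn)
      fun z hz hzK => by simp [hgK z hz hzK]
  have e1 : ∀ z, f z * wirt c i g z = (1 / 2 : ℂ) * (f z * fderiv ℝ g z (Pi.single i 1) +
      c * (f z * fderiv ℝ g z (Pi.single i Complex.I))) := fun z => by rw [wirt]; ring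
  have e2 : ∀ z, wirt c i f z * g z = (1 / 2 : ℂ) * (fderiv ℝ f z (Pi.single i 1) * g z +
      c * (fderiv ℝ f z (Pi.single i Complex.I) * g z)) := fun z => by rw [wirt]; ring
  simp_rw [e1, e2, integral_const_mul]
  rw [integral_add (i1 _) ((i1 _).const_mul c), integral_add (i2 _) ((i2 _).const_mul c)]
  simp_rw [integral_const_mul, integral_mul_fderiv_eq hU hK hKU hf hg hgK]
  ring

lemma integral_mul_dz_dzbar (hU : IsOpen U) (hK : IsCompact K) (hKU : K ⊆ U)
    (hf : ContDiffOn ℝ ∞ f U) (hg : ContDiffOn ℝ ∞ g U) (hgK : ∀ z ∈ U, z ∉ K → g z = 0)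
    (i j : Fin n) :
    ∫ z in U, f z * dz i (dzbar j g) z = ∫ z in U, dzbar j (dz i f) z * g z := by
  rw [dz_eq_wirt, dzbar_eq_wirt, integral_mul_wirt hU hK hKU hf (ContDiffOn.wirt hU hg)
    (wirt_eq_zero_off_compact hU hK hgK),
    integral_mul_wirt hU hK hKU (ContDiffOn.wirt hU hf) hg hgK, neg_neg]

/-- Differentiation under the integral sign, with one-sided derivatives at the end points. -/
lemma hasDerivWithinAt_setIntegral {a b : ℝ} (hK : IsCompact K) {G G' : ℝ → (Fin n → ℂ) → ℝ}
    (hG : ContinuousOn (fun p : ℝ × (Fin n → ℂ) => G p.1 p.2) (Set.Icc a b ×ˢ K))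
    (hG' : ContinuousOn (fun p : ℝ × (Fin n → ℂ) => G' p.1 p.2) (Set.Icc a b ×ˢ K))
    (hd : ∀ s ∈ Set.Icc a b, ∀ z ∈ K,
      HasDerivWithinAt (fun r => G r z) (G' s z) (Set.Icc a b) s)
    {t : ℝ} (ht : t ∈ Set.Icc a b) :
    HasDerivWithinAt (fun s => ∫ z in K, G s z) (∫ z in K, G' t z) (Set.Icc a b) t := by
  obtain ⟨C, hC⟩ := (isCompact_Icc.prod hK).exists_bound_of_continuousOn hG'
  have hGs : ∀ s ∈ Set.Icc a b, ContinuousOn (G s) K := fun s hs =>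
    hG.comp (f := fun z => (s, z)) (by fun_prop) fun z hz => ⟨hs, hz⟩
  have hGi : ∀ s ∈ Set.Icc a b, IntegrableOn (G s) K := fun s hs =>
    (hGs s hs).integrableOn_compact hK
  rw [hasDerivWithinAt_iff_tendsto_slope]
  have key : Filter.Tendsto (fun s => ∫ z in K, slope (fun r => G r z) t s)
      (nhdsWithin t (Set.Icc a b \ {t})) (nhds (∫ z in K, G' t z)) := by
    refine tendsto_integral_filter_of_dominated_convergence (fun _ => C) ?_ ?_ ?_ ?_
    -- Measurability of the difference quotients comes from continuity on K; their domination by the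
    -- constant C, a bound for the time derivative on the compact set [a, b] × K, comes from the
    -- mean value inequality on [a, b].
    · filter_upwards [self_mem_nhdsWithin] with s hs
      simp only [slope_def_field]
      exact (((hGs s hs.1).sub (hGs t ht)).div_const _).aestronglyMeasurable hK.measurableSet
    · filter_upwards [self_mem_nhdsWithin] with s hs
      filter_upwards [ae_restrict_mem hK.measurableSet] with z hz
      have h := (convex_Icc a b).norm_image_sub_le_of_norm_hasDerivWithin_le
        (fun r hr => hd r hr z hz) (fun r hr => hC (r, z) ⟨hr, hz⟩) ht hs.1
      have h0 : 0 < ‖s - t‖ := norm_pos_iff.2 (sub_ne_zero.2 hs.2)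
      rw [slope_def_field, norm_div, div_le_iff₀ h0]
      exact h
    · exact (integrableOn_const (hK.measure_lt_top.ne))
    · filter_upwards [ae_restrict_mem hK.measurableSet] with z hz
      exact hasDerivWithinAt_iff_tendsto_slope.1 (hd t ht z hz)
  refine key.congr' ?_
  filter_upwards [self_mem_nhdsWithin] with s hs
  simp only [slope_def_field]
  rw [integral_div, integral_sub (hGi s hs.1) (hGi t ht)]

end integration

/-! ### Functions depending on a time parameter in a compact interval -/

section parametric

variable {a b : ℝ} {U : Set (Fin n → ℂ)} {β : Type*} [NormedAddCommGroup β] [NormedSpace ℝ β]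

lemma uniqueDiffOn_Icc_prod (hab : a < b) (hU : IsOpen U) :
    UniqueDiffOn ℝ (Set.Icc a b ×ˢ U) :=
  (uniqueDiffOn_Icc hab).prod hU.uniqueDiffOn

/-- Expressing space derivatives through the joint derivative within [a, b] × U transfers joint
smoothness, up to the end points in time, to all partial derivatives. -/
lemma fderiv_slice {Ψ : ℝ → (Fin n → ℂ) → β} (hU : IsOpen U)
    (hΨ : DifferentiableOn ℝ (fun p : ℝ × (Fin n → ℂ) => Ψ p.1 p.2) (Set.Icc a b ×ˢ U))
    {t : ℝ} {z : Fin n → ℂ} (ht : t ∈ Set.Icc a b) (hz : z ∈ U) (v : Fin n → ℂ) :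
    fderiv ℝ (Ψ t) z v = fderivWithin ℝ (fun p : ℝ × (Fin n → ℂ) => Ψ p.1 p.2)
      (Set.Icc a b ×ˢ U) (t, z) (0, v) := by
  have h1 := (hΨ (t, z) ⟨ht, hz⟩).hasFDerivWithinAt
  have h2 : HasFDerivWithinAt (fun y : Fin n → ℂ => (t, y))
      (ContinuousLinearMap.inr ℝ ℝ (Fin n → ℂ)) U z :=
    (hasFDerivAt_prodMk_right t z).hasFDerivWithinAt
  have h3 := (h1.comp z h2 fun y hy => ⟨ht, hy⟩).hasFDerivAt (hU.mem_nhds hz)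
  change fderiv ℝ ((fun p : ℝ × (Fin n → ℂ) => Ψ p.1 p.2) ∘ fun y => (t, y)) z v = _
  rw [h3.fderiv]
  rfl

lemma hasDerivWithinAt_slice {Ψ : ℝ → (Fin n → ℂ) → β}
    (hΨ : DifferentiableOn ℝ (fun p : ℝ × (Fin n → ℂ) => Ψ p.1 p.2) (Set.Icc a b ×ˢ U))
    {t : ℝ} {z : Fin n → ℂ} (ht : t ∈ Set.Icc a b) (hz : z ∈ U) :
    HasDerivWithinAt (fun r => Ψ r z) (fderivWithin ℝ (fun p : ℝ × (Fin n → ℂ) => Ψ p.1 p.2)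
      (Set.Icc a b ×ˢ U) (t, z) (1, 0)) (Set.Icc a b) t := by
  have h1 := (hΨ (t, z) ⟨ht, hz⟩).hasFDerivWithinAt
  have h2 : HasFDerivWithinAt (fun r : ℝ => (r, z))
      (ContinuousLinearMap.inl ℝ ℝ (Fin n → ℂ)) (Set.Icc a b) t :=
    (hasFDerivAt_prodMk_left t z).hasFDerivWithinAt
  exact (h1.comp t h2 fun y hy => (⟨hy, hz⟩ : (y, z) ∈ Set.Icc a b ×ˢ U)).hasDerivWithinAt

/-- The time derivative of a time-dependent function. -/
def timeDeriv (a b : ℝ) (Ψ : ℝ → (Fin n → ℂ) → β) (t : ℝ) (z : Fin n → ℂ) : β :=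
  derivWithin (fun r => Ψ r z) (Set.Icc a b) t

variable {Ψ : ℝ → (Fin n → ℂ) → β}

lemma timeDeriv_eq (hab : a < b)
    (hΨ : DifferentiableOn ℝ (fun p : ℝ × (Fin n → ℂ) => Ψ p.1 p.2) (Set.Icc a b ×ˢ U))
    {t : ℝ} {z : Fin n → ℂ} (ht : t ∈ Set.Icc a b) (hz : z ∈ U) :
    timeDeriv a b Ψ t z = fderivWithin ℝ (fun p : ℝ × (Fin n → ℂ) => Ψ p.1 p.2)
      (Set.Icc a b ×ˢ U) (t, z) (1, 0) :=
  (hasDerivWithinAt_slice hΨ ht hz).derivWithin (uniqueDiffOn_Icc hab t ht)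

lemma hasDerivWithinAt_timeDeriv
    (hΨ : ContDiffOn ℝ ∞ (fun p : ℝ × (Fin n → ℂ) => Ψ p.1 p.2) (Set.Icc a b ×ˢ U))
    {t : ℝ} {z : Fin n → ℂ} (ht : t ∈ Set.Icc a b) (hz : z ∈ U) :
    HasDerivWithinAt (fun r => Ψ r z) (timeDeriv a b Ψ t z) (Set.Icc a b) t :=
  (hasDerivWithinAt_slice (hΨ.differentiableOn (by simp)) ht
    hz).differentiableWithinAt.hasDerivWithinAt

lemma contDiffOn_slice (hΨ : ContDiffOn ℝ ∞ (fun p : ℝ × (Fin n → ℂ) => Ψ p.1 p.2)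
    (Set.Icc a b ×ˢ U)) {t : ℝ} (ht : t ∈ Set.Icc a b) : ContDiffOn ℝ ∞ (Ψ t) U :=
  hΨ.comp (f := fun z => (t, z)) (by fun_prop) fun _ hz => ⟨ht, hz⟩

lemma contDiffOn_fderivWithin_apply (hab : a < b) (hU : IsOpen U)
    {f : ℝ × (Fin n → ℂ) → β} (hf : ContDiffOn ℝ ∞ f (Set.Icc a b ×ˢ U))
    (v : ℝ × (Fin n → ℂ)) :
    ContDiffOn ℝ ∞ (fun p => fderivWithin ℝ f (Set.Icc a b ×ˢ U) p v) (Set.Icc a b ×ˢ U) :=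
  (hf.fderivWithin (m := ∞) (uniqueDiffOn_Icc_prod hab hU) (by simp)).clm_apply contDiffOn_const

lemma contDiffOn_timeDeriv (hab : a < b) (hU : IsOpen U)
    (hΨ : ContDiffOn ℝ ∞ (fun p : ℝ × (Fin n → ℂ) => Ψ p.1 p.2) (Set.Icc a b ×ˢ U)) :
    ContDiffOn ℝ ∞ (fun p : ℝ × (Fin n → ℂ) => timeDeriv a b Ψ p.1 p.2) (Set.Icc a b ×ˢ U) :=
  (contDiffOn_fderivWithin_apply hab hU hΨ (1, 0)).congr fun _ hp =>
    timeDeriv_eq hab (hΨ.differentiableOn (by simp)) hp.1 hp.2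

lemma contDiffOn_fderiv_slice (hab : a < b) (hU : IsOpen U)
    (hΨ : ContDiffOn ℝ ∞ (fun p : ℝ × (Fin n → ℂ) => Ψ p.1 p.2) (Set.Icc a b ×ˢ U))
    (v : Fin n → ℂ) :
    ContDiffOn ℝ ∞ (fun p : ℝ × (Fin n → ℂ) => fderiv ℝ (Ψ p.1) p.2 v) (Set.Icc a b ×ˢ U) :=
  (contDiffOn_fderivWithin_apply hab hU hΨ (0, v)).congr fun _ hp =>
    fderiv_slice hU (hΨ.differentiableOn (by simp)) hp.1 hp.2 v

lemma timeDeriv_fderiv (hab : a < b) (hU : IsOpen U)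
    (hΨ : ContDiffOn ℝ ∞ (fun p : ℝ × (Fin n → ℂ) => Ψ p.1 p.2) (Set.Icc a b ×ˢ U))
    {t : ℝ} {z : Fin n → ℂ} (ht : t ∈ Set.Icc a b) (hz : z ∈ U) (v : Fin n → ℂ) :
    timeDeriv a b (fun r y => fderiv ℝ (Ψ r) y v) t z = fderiv ℝ (timeDeriv a b Ψ t) z v := by
  set Q := Set.Icc a b ×ˢ U with hQ
  set f := fun p : ℝ × (Fin n → ℂ) => Ψ p.1 p.2 with hf
  have hmem : (t, z) ∈ Q := ⟨ht, hz⟩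
  have hu : UniqueDiffOn ℝ Q := uniqueDiffOn_Icc_prod hab hU
  -- At t = a or t = b the point lies on the boundary of Q; symmetry of the second derivative
  -- survives because Q lies in the closure of its interior, where a < b is used.
  have hsymm : IsSymmSndFDerivWithinAt ℝ f Q (t, z) := by
    refine (hΨ _ hmem).isSymmSndFDerivWithinAt (by simp; norm_cast) hu ?_ hmem
    rw [hQ, interior_prod_eq, closure_prod_eq, interior_Icc, closure_Ioo hab.ne, hU.interior_eq]
    exact ⟨ht, subset_closure hz⟩
  have hd : DifferentiableWithinAt ℝ (fderivWithin ℝ f Q) Q (t, z) :=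
    ((hΨ.fderivWithin (m := ∞) hu (by simp)).differentiableOn (by simp)) _ hmem
  have hsnd : ∀ v w, fderivWithin ℝ (fun p => fderivWithin ℝ f Q p v) Q (t, z) w =
      fderivWithin ℝ (fderivWithin ℝ f Q) Q (t, z) w v := by
    intro v w
    rw [fderivWithin_clm_apply (hu _ hmem) hd (differentiableWithinAt_const v)]
    simp
  have hc : ∀ v, fderivWithin ℝ (fun p : ℝ × (Fin n → ℂ) => fderiv ℝ (Ψ p.1) p.2 v) Q (t, z) =
      fderivWithin ℝ (fun p => fderivWithin ℝ f Q p (0, v)) Q (t, z) := fun v =>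
    fderivWithin_congr (fun p hp => fderiv_slice hU (hΨ.differentiableOn (by simp)) hp.1 hp.2 v)
      (fderiv_slice hU (hΨ.differentiableOn (by simp)) ht hz v)
  have hc' : fderivWithin ℝ (fun p : ℝ × (Fin n → ℂ) => timeDeriv a b Ψ p.1 p.2) Q (t, z) =
      fderivWithin ℝ (fun p => fderivWithin ℝ f Q p (1, 0)) Q (t, z) :=
    fderivWithin_congr (fun p hp => timeDeriv_eq hab (hΨ.differentiableOn (by simp)) hp.1 hp.2)
      (timeDeriv_eq hab (hΨ.differentiableOn (by simp)) ht hz)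
  rw [timeDeriv_eq hab ((contDiffOn_fderiv_slice hab hU hΨ v).differentiableOn (by simp)) ht hz,
    fderiv_slice hU ((contDiffOn_timeDeriv hab hU hΨ).differentiableOn (by simp)) ht hz, hc, hc',
    hsnd, hsnd]
  exact hsymm.eq _ _

end parametric

/-! ### Wirtinger derivatives of time-dependent functions. -/

section parametricWirtinger

variable {a b : ℝ} {U : Set (Fin n → ℂ)} {Ψ : ℝ → (Fin n → ℂ) → ℂ}

lemma contDiffOn_wirt_slice (hab : a < b) (hU : IsOpen U)
    (hΨ : ContDiffOn ℝ ∞ (fun p : ℝ × (Fin n → ℂ) => Ψ p.1 p.2) (Set.Icc a b ×ˢ U))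
    (c : ℂ) (i : Fin n) :
    ContDiffOn ℝ ∞ (fun p : ℝ × (Fin n → ℂ) => wirt c i (Ψ p.1) p.2) (Set.Icc a b ×ˢ U) :=
  contDiffOn_const.mul ((contDiffOn_fderiv_slice hab hU hΨ _).add
    (contDiffOn_const.mul (contDiffOn_fderiv_slice hab hU hΨ _)))

lemma timeDeriv_wirt (hab : a < b) (hU : IsOpen U)
    (hΨ : ContDiffOn ℝ ∞ (fun p : ℝ × (Fin n → ℂ) => Ψ p.1 p.2) (Set.Icc a b ×ˢ U))
    {t : ℝ} {z : Fin n → ℂ} (ht : t ∈ Set.Icc a b) (hz : z ∈ U) (c : ℂ) (i : Fin n) :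
    timeDeriv a b (fun r => wirt c i (Ψ r)) t z = wirt c i (timeDeriv a b Ψ t) z := by
  have h1 := fun v => hasDerivWithinAt_timeDeriv (Ψ := fun r y => fderiv ℝ (Ψ r) y v)
    (contDiffOn_fderiv_slice hab hU hΨ v) ht hz
  simp_rw [timeDeriv_fderiv hab hU hΨ ht hz] at h1
  exact (((h1 _).add ((h1 _).const_mul c)).const_mul (1 / 2 : ℂ)).derivWithin
    (uniqueDiffOn_Icc hab t ht)

lemma contDiffOn_ofReal {G : Type*} [NormedAddCommGroup G] [NormedSpace ℝ G] {f : G → ℝ}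
    {s : Set G} (hf : ContDiffOn ℝ ∞ f s) : ContDiffOn ℝ ∞ (fun x => (f x : ℂ)) s :=
  Complex.ofRealCLM.contDiff.comp_contDiffOn hf

lemma contDiffOn_re {G : Type*} [NormedAddCommGroup G] [NormedSpace ℝ G] {f : G → ℂ}
    {s : Set G} (hf : ContDiffOn ℝ ∞ f s) : ContDiffOn ℝ ∞ (fun x => (f x).re) s :=
  Complex.reCLM.contDiff.comp_contDiffOn hf

lemma contDiffOn_ddbar {u : (Fin n → ℂ) → ℝ} (hU : IsOpen U) (hu : ContDiffOn ℝ ∞ u U)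
    (i j : Fin n) : ContDiffOn ℝ ∞ (fun z => ddbar u z i j) U := by
  simp only [ddbar, Matrix.of_apply, dz_eq_wirt, dzbar_eq_wirt]
  exact ContDiffOn.wirt hU (ContDiffOn.wirt hU (contDiffOn_ofReal hu))

variable {Φ : ℝ → (Fin n → ℂ) → ℝ}

lemma contDiffOn_ddbar_slice (hab : a < b) (hU : IsOpen U)
    (hΦ : ContDiffOn ℝ ∞ (fun p : ℝ × (Fin n → ℂ) => Φ p.1 p.2) (Set.Icc a b ×ˢ U))
    (i j : Fin n) :
    ContDiffOn ℝ ∞ (fun p : ℝ × (Fin n → ℂ) => ddbar (Φ p.1) p.2 i j) (Set.Icc a b ×ˢ U) := by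
  simp only [ddbar, Matrix.of_apply, dz_eq_wirt, dzbar_eq_wirt]
  exact contDiffOn_wirt_slice hab hU (Ψ := fun r => wirt Complex.I j fun y => (Φ r y : ℂ))
    (contDiffOn_wirt_slice hab hU (Ψ := fun r y => (Φ r y : ℂ)) (contDiffOn_ofReal hΦ) _ j) _ i

lemma hasDerivWithinAt_ddbar (hab : a < b) (hU : IsOpen U)
    (hΦ : ContDiffOn ℝ ∞ (fun p : ℝ × (Fin n → ℂ) => Φ p.1 p.2) (Set.Icc a b ×ˢ U))
    {t : ℝ} {z : Fin n → ℂ} (ht : t ∈ Set.Icc a b) (hz : z ∈ U) (i j : Fin n) :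
    HasDerivWithinAt (fun r => ddbar (Φ r) z i j) (ddbar (timeDeriv a b Φ t) z i j)
      (Set.Icc a b) t := by
  set Ψ : ℝ → (Fin n → ℂ) → ℂ := fun r y => (Φ r y : ℂ)
  have hΨ : ContDiffOn ℝ ∞ (fun p : ℝ × (Fin n → ℂ) => Ψ p.1 p.2) (Set.Icc a b ×ˢ U) :=
    contDiffOn_ofReal hΦ
  have h0 : Set.EqOn (timeDeriv a b Ψ t) (fun y => ((timeDeriv a b Φ t y : ℝ) : ℂ)) U := fun y hy =>
    (hasDerivWithinAt_timeDeriv hΦ ht hy).ofReal_comp.derivWithin (uniqueDiffOn_Icc hab t ht)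
  have h1 := contDiffOn_wirt_slice hab hU hΨ Complex.I j
  have h2 := hasDerivWithinAt_timeDeriv (Ψ := fun r => wirt (-Complex.I) i (wirt Complex.I j (Ψ r)))
    (contDiffOn_wirt_slice hab hU (Ψ := fun r => wirt Complex.I j (Ψ r)) h1 (-Complex.I) i) ht hz
  rw [timeDeriv_wirt hab hU h1 ht hz] at h2
  have h3 : Set.EqOn (timeDeriv a b (fun r => wirt Complex.I j (Ψ r)) t)
      (wirt Complex.I j fun y => ((timeDeriv a b Φ t y : ℝ) : ℂ)) U := fun y hy => by
    rw [timeDeriv_wirt hab hU hΨ ht hy]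
    exact wirt_congr_on hU h0 hy
  rw [wirt_congr_on hU h3 hz] at h2
  simp only [ddbar, Matrix.of_apply, dz_eq_wirt, dzbar_eq_wirt]
  exact h2

end parametricWirtinger

/-! ### Tensors and charts on a complex manifold -/

section charts

variable {X : Type*} [TopologicalSpace X]

/-- The set of coordinates, in the chart `e`, of the points that lie in the domains of `e` and
`e'`. -/
def overlap (e e' : OpenPartialHomeomorph X (Fin n → ℂ)) : Set (Fin n → ℂ) :=
  e.target ∩ e.symm ⁻¹' e'.source

lemma isOpen_overlap (e e' : OpenPartialHomeomorph X (Fin n → ℂ)) : IsOpen (overlap e e') :=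
  e.symm.isOpen_inter_preimage e'.open_source

/-- The change of coordinates from `e` to `e'`. -/
def transition (e e' : OpenPartialHomeomorph X (Fin n → ℂ)) (z : Fin n → ℂ) : Fin n → ℂ :=
  e' (e.symm z)

lemma mapsTo_transition (e e' : OpenPartialHomeomorph X (Fin n → ℂ)) :
    Set.MapsTo (transition e e') (overlap e e') (overlap e' e) := by
  intro z hz
  refine ⟨e'.map_source hz.2, ?_⟩
  simp only [transition, Set.mem_preimage]
  rw [e'.left_inv hz.2]
  exact e.map_target hz.1

lemma symm_transition {e e' : OpenPartialHomeomorph X (Fin n → ℂ)} {z : Fin n → ℂ}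
    (hz : z ∈ overlap e e') : e'.symm (transition e e' z) = e.symm z :=
  e'.left_inv hz.2

lemma transition_transition {e e' : OpenPartialHomeomorph X (Fin n → ℂ)} {z : Fin n → ℂ}
    (hz : z ∈ overlap e e') : transition e' e (transition e e' z) = z := by
  rw [transition, symm_transition hz, e.right_inv hz.1]

lemma injOn_transition (e e' : OpenPartialHomeomorph X (Fin n → ℂ)) :
    Set.InjOn (transition e e') (overlap e e') := fun z hz w hw h => by
  rw [← transition_transition hz, h, transition_transition hw]

variable [ChartedSpace (Fin n → ℂ) X]

lemma contDiffOn_transition [IsManifold 𝓘(ℂ, Fin n → ℂ) ω X]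
    {e e' : OpenPartialHomeomorph X (Fin n → ℂ)} (he : e ∈ atlas (Fin n → ℂ) X)
    (he' : e' ∈ atlas (Fin n → ℂ) X) : ContDiffOn ℂ ω (transition e e') (overlap e e') := by
  have h := (contDiffGroupoid ω 𝓘(ℂ, Fin n → ℂ)).compatible he he'
  rw [contDiffGroupoid, mem_groupoid_of_pregroupoid] at h
  have h1 := h.1
  simp only [contDiffPregroupoid] at h1
  have h2 : ContDiffOn ℂ ω (e' ∘ e.symm) (overlap e e') := by
    simpa [overlap, OpenPartialHomeomorph.trans_source] using h1
  exact h2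

/-- The underlying real smooth structure, with the same atlas: it gives meaning to smoothness of
real functions on X and supplies smooth partitions of unity. -/
lemma isManifold_real (X : Type*) [TopologicalSpace X] [ChartedSpace (Fin n → ℂ) X]
    [IsManifold 𝓘(ℂ, Fin n → ℂ) ω X] : IsManifold 𝓘(ℝ, Fin n → ℂ) ∞ X := by
  refine isManifold_of_contDiffOn _ _ _ fun e e' he he' => ?_
  have h := ((contDiffOn_transition he he').restrict_scalars ℝ).of_le (n := ω) (m := ∞) le_top
  have h2 : ContDiffOn ℝ ∞ (e' ∘ e.symm) (overlap e e') := h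
  simpa [overlap, OpenPartialHomeomorph.trans_source] using h2

/-- The complex Jacobian matrix of a change of coordinates. -/
def jac (e e' : OpenPartialHomeomorph X (Fin n → ℂ)) (z : Fin n → ℂ) :
    Matrix (Fin n) (Fin n) ℂ :=
  Matrix.of fun a i => fderiv ℂ (transition e e') z (Pi.single i 1) a

/-- Smoothness of a function on `X`, expressed in the charts of the atlas. -/
def SmoothInCharts (n : ℕ) {X : Type*} [TopologicalSpace X] [ChartedSpace (Fin n → ℂ) X]
    (f : X → ℝ) : Prop :=
  ∀ e ∈ atlas (Fin n → ℂ) X, ContDiffOn ℝ ∞ (fun z => f (e.symm z)) e.target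

lemma smoothInCharts_of_contMDiff [IsManifold 𝓘(ℂ, Fin n → ℂ) ω X] {f : X → ℝ}
    (hf : ContMDiff 𝓘(ℝ, Fin n → ℂ) 𝓘(ℝ, ℝ) ∞ f) : SmoothInCharts n f := by
  have := isManifold_real (n := n) X
  intro e he
  have h1 := contMDiffOn_symm_of_mem_maximalAtlas (I := 𝓘(ℝ, Fin n → ℂ)) (n := ∞)
    (IsManifold.subset_maximalAtlas he)
  have h2 := hf.comp_contMDiffOn h1
  exact contMDiffOn_iff_contDiffOn.1 h2

lemma SmoothInCharts.mul {f g : X → ℝ} (hf : SmoothInCharts n f) (hg : SmoothInCharts n g) :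
    SmoothInCharts n fun x => f x * g x := fun e he => (hf e he).mul (hg e he)

lemma SmoothInCharts.continuousOn {f : X → ℝ} (hf : SmoothInCharts n f)
    {e : OpenPartialHomeomorph X (Fin n → ℂ)} (he : e ∈ atlas (Fin n → ℂ) X) :
    ContinuousOn f e.source := by
  have h := (hf e he).continuousOn.comp e.continuousOn e.mapsTo
  exact h.congr fun x hx => by simp [e.left_inv hx]

lemma ddbar_transform [IsManifold 𝓘(ℂ, Fin n → ℂ) ω X] {f : X → ℝ} (hf : SmoothInCharts n f)
    {e e' : OpenPartialHomeomorph X (Fin n → ℂ)} (he : e ∈ atlas (Fin n → ℂ) X)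
    (he' : e' ∈ atlas (Fin n → ℂ) X) {z : Fin n → ℂ} (hz : z ∈ overlap e e') (i j : Fin n) :
    ddbar (fun w => f (e.symm w)) z i j =
      ∑ a, ∑ b, ddbar (fun w => f (e'.symm w)) (transition e e' z) a b * jac e e' z a i *
        starRingEnd ℂ (jac e e' z b j) := by
  have hO := isOpen_overlap e e'
  have h1 := dz_dzbar_comp hO e'.open_target
    ((contDiffOn_transition he he').of_le (by simp))
    (fun w hw => (mapsTo_transition e e' hw).1) (contDiffOn_ofReal (hf e' he')) hz i j
  simp only [ddbar, Matrix.of_apply]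
  refine Eq.trans ?_ h1
  have e0 : Set.EqOn (fun w => (f (e.symm w) : ℂ))
      (fun y => (f (e'.symm (transition e e' y)) : ℂ)) (overlap e e') := fun y hy => by
    simp only [symm_transition hy]
  rw [dz_eq_wirt, dzbar_eq_wirt]
  exact wirt_congr_on hO (fun y hy => wirt_congr_on hO e0 hy) hz

/-- Smooth Hermitian tensors with positive determinant. -/
structure IsAdmissible (g : LocalCoeff n X) : Prop where
  smooth : ∀ e ∈ atlas (Fin n → ℂ) X, ∀ i j, ContDiffOn ℝ ∞ (fun z => g e z i j) e.target
  herm : ∀ e ∈ atlas (Fin n → ℂ) X, ∀ z ∈ e.target, (g e z).IsHermitian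
  det_pos : ∀ e ∈ atlas (Fin n → ℂ) X, ∀ z ∈ e.target, 0 < (g e z).det.re
  transform : ∀ e ∈ atlas (Fin n → ℂ) X, ∀ e' ∈ atlas (Fin n → ℂ) X, ∀ z ∈ overlap e e',
    g e z = (jac e e' z)ᵀ * g e' (transition e e' z) * (jac e e' z).map (starRingEnd ℂ)

lemma transform_matrix_eq {J M N : Matrix (Fin n) (Fin n) ℂ}
    (h : ∀ i j, M i j = ∑ a, ∑ b, N a b * J a i * starRingEnd ℂ (J b j)) :
    M = Jᵀ * N * J.map (starRingEnd ℂ) := by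
  ext i j
  rw [h, Matrix.mul_apply, Finset.sum_comm]
  refine Finset.sum_congr rfl fun b _ => ?_
  rw [Matrix.mul_apply, Finset.sum_mul]
  refine Finset.sum_congr rfl fun a _ => ?_
  simp only [Matrix.transpose_apply, Matrix.map_apply]
  ring

lemma det_re_pos_of_posDef {M : Matrix (Fin n) (Fin n) ℂ} (hM : M.PosDef) : 0 < M.det.re :=
  (Complex.pos_iff.1 hM.det_pos).1

lemma IsHermitianMetric.isAdmissible {g : LocalCoeff n X} (hg : IsHermitianMetric g) :
    IsAdmissible g where
  smooth := hg.smooth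
  herm e he z hz := (hg.pos e he z hz).isHermitian
  det_pos e he z hz := det_re_pos_of_posDef (hg.pos e he z hz)
  transform e he e' he' z hz := transform_matrix_eq (hg.transform e he e' he' z hz.1 hz.2)

lemma perturb_transform [IsManifold 𝓘(ℂ, Fin n → ℂ) ω X] {g₀ : LocalCoeff n X}
    (hg : IsAdmissible g₀) {f : X → ℝ} (hf : SmoothInCharts n f)
    {e e' : OpenPartialHomeomorph X (Fin n → ℂ)} (he : e ∈ atlas (Fin n → ℂ) X)
    (he' : e' ∈ atlas (Fin n → ℂ) X) {z : Fin n → ℂ} (hz : z ∈ overlap e e') :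
    perturb g₀ f e z = (jac e e' z)ᵀ * perturb g₀ f e' (transition e e' z) *
      (jac e e' z).map (starRingEnd ℂ) := by
  have h1 := transform_matrix_eq (ddbar_transform hf he he' hz)
  change g₀ e z + ddbar (fun w => f (e.symm w)) z = _ * (g₀ e' (transition e e' z) +
    ddbar (fun w => f (e'.symm w)) (transition e e' z)) * _
  rw [mul_add, add_mul, ← h1, ← hg.transform e he e' he' z hz]

lemma isAdmissible_perturb [IsManifold 𝓘(ℂ, Fin n → ℂ) ω X] {g₀ : LocalCoeff n X}
    (hg : IsAdmissible g₀) {f : X → ℝ} (hf : SmoothInCharts n f)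
    (hpos : ∀ e ∈ atlas (Fin n → ℂ) X, ∀ z ∈ e.target, 0 < (perturb g₀ f e z).det.re) :
    IsAdmissible (perturb g₀ f) where
  smooth e he i j := (hg.smooth e he i j).add (contDiffOn_ddbar e.open_target (hf e he) i j)
  herm e he z hz := (hg.herm e he z hz).add
    (ddbar_isHermitian e.open_target hz (contDiffOn_ofReal (hf e he)))
  det_pos := hpos
  transform _ he _ he' _ hz := perturb_transform hg hf he he' hz

/-- The factors Jᵀ and J̄ contribute det J and its conjugate. The resulting |det J|² is also the
real Jacobian of a holomorphic map, which makes ωⁿ independent of the chart. -/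
lemma det_re_of_transform {J M N : Matrix (Fin n) (Fin n) ℂ}
    (h : M = Jᵀ * N * J.map (starRingEnd ℂ)) :
    M.det.re = Complex.normSq J.det * N.det.re := by
  have h2 : (J.map (starRingEnd ℂ)).det = starRingEnd ℂ J.det := (RingHom.map_det _ _).symm
  have h3 : M.det = ((Complex.normSq J.det : ℝ) : ℂ) * N.det := by
    rw [h, Matrix.det_mul, Matrix.det_mul, Matrix.det_transpose, h2, ← Complex.mul_conj]; ring
  rw [h3, Complex.re_ofReal_mul]

section

variable {g : LocalCoeff n X} {e e' : OpenPartialHomeomorph X (Fin n → ℂ)} {z : Fin n → ℂ}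

lemma IsAdmissible.det_ne_zero (hg : IsAdmissible g) (he : e ∈ atlas (Fin n → ℂ) X)
    (hz : z ∈ e.target) : (g e z).det ≠ 0 := fun h => by
  have := hg.det_pos e he z hz
  rw [h] at this
  simp at this

lemma IsAdmissible.det_transform (hg : IsAdmissible g) (he : e ∈ atlas (Fin n → ℂ) X)
    (he' : e' ∈ atlas (Fin n → ℂ) X) (hz : z ∈ overlap e e') :
    (g e z).det.re = Complex.normSq (jac e e' z).det * (g e' (transition e e' z)).det.re :=
  det_re_of_transform (hg.transform e he e' he' z hz)

/-- Free from positivity: a singular Jacobian would make the determinant of g vanish in the chart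
`e`. -/
lemma IsAdmissible.det_jac_ne_zero (hg : IsAdmissible g) (he : e ∈ atlas (Fin n → ℂ) X)
    (he' : e' ∈ atlas (Fin n → ℂ) X) (hz : z ∈ overlap e e') : (jac e e' z).det ≠ 0 := fun h => by
  have h1 := hg.det_pos e he z hz.1
  rw [hg.det_transform he he' hz, h] at h1
  simp at h1

/-- The trace `g^{i j̄} k_{i j̄}` does not depend on the chart. -/
lemma IsAdmissible.trace_transform (hg : IsAdmissible g) (he : e ∈ atlas (Fin n → ℂ) X)
    (he' : e' ∈ atlas (Fin n → ℂ) X) (hz : z ∈ overlap e e') {k k' : Matrix (Fin n) (Fin n) ℂ}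
    (hk : k = (jac e e' z)ᵀ * k' * (jac e e' z).map (starRingEnd ℂ)) :
    ∑ i, ∑ j, invMetric (g e) i j z * k i j =
      ∑ i, ∑ j, invMetric (g e') i j (transition e e' z) * k' i j := by
  have htr : ∀ (A B : Matrix (Fin n) (Fin n) ℂ), ∑ i, ∑ j, A j i * B i j = (A * B).trace := by
    intro A B
    rw [Finset.sum_comm]
    simp only [Matrix.trace, Matrix.diag_apply, Matrix.mul_apply]
  simp only [invMetric]
  rw [htr, htr, hg.transform e he e' he' z hz, hk]
  set J := jac e e' z
  set Jb := J.map (starRingEnd ℂ)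
  set M := g e' (transition e e' z)
  have hJ : IsUnit Jᵀ.det := by
    rw [Matrix.det_transpose]; exact isUnit_iff_ne_zero.2 (hg.det_jac_ne_zero he he' hz)
  have hJb : IsUnit Jb.det := by
    have h2 : Jb.det = starRingEnd ℂ J.det := (RingHom.map_det _ _).symm
    rw [h2]
    exact isUnit_iff_ne_zero.2 ((map_ne_zero _).2 (hg.det_jac_ne_zero he he' hz))
  rw [Matrix.mul_inv_rev, Matrix.mul_inv_rev]
  have : Jb⁻¹ * (M⁻¹ * Jᵀ⁻¹) * (Jᵀ * k' * Jb) = Jb⁻¹ * (M⁻¹ * k' * Jb) := by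
    simp only [Matrix.mul_assoc]
    rw [Matrix.nonsing_inv_mul_cancel_left _ _ hJ]
  rw [this, Matrix.trace_mul_comm, Matrix.mul_assoc, Matrix.mul_nonsing_inv _ hJb, Matrix.mul_one]

/-- The Laplacian `g^{i j̄} ∂ᵢ ∂_j̄ f`, in local coordinates. -/
def lapl (h : (Fin n → ℂ) → Matrix (Fin n) (Fin n) ℂ) (u : (Fin n → ℂ) → ℝ)
    (z : Fin n → ℂ) : ℝ :=
  (∑ i, ∑ j, invMetric h i j z * ddbar u z i j).re

lemma IsAdmissible.lapl_transform [IsManifold 𝓘(ℂ, Fin n → ℂ) ω X] (hg : IsAdmissible g)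
    (he : e ∈ atlas (Fin n → ℂ) X) (he' : e' ∈ atlas (Fin n → ℂ) X) (hz : z ∈ overlap e e')
    {f : X → ℝ} (hf : SmoothInCharts n f) :
    lapl (g e) (fun w => f (e.symm w)) z =
      lapl (g e') (fun w => f (e'.symm w)) (transition e e' z) := by
  rw [lapl, hg.trace_transform he he' hz (transform_matrix_eq (ddbar_transform hf he he' hz))]
  rfl

lemma logRatio_transform {g₀ : LocalCoeff n X} (hg₀ : IsAdmissible g₀) (hg : IsAdmissible g)
    (he : e ∈ atlas (Fin n → ℂ) X) (he' : e' ∈ atlas (Fin n → ℂ) X) (hz : z ∈ overlap e e')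
    (F : X → ℝ) : logRatio g₀ F g e z = logRatio g₀ F g e' (transition e e' z) := by
  have h1 : Complex.normSq (jac e e' z).det ≠ 0 :=
    (Complex.normSq_pos.2 (hg.det_jac_ne_zero he he' hz)).ne'
  rw [logRatio, logRatio, symm_transition hz, hg.det_transform he he' hz,
    hg₀.det_transform he he' hz, mul_div_mul_left _ _ h1]

lemma contDiffOn_det_re (hg : IsAdmissible g) (he : e ∈ atlas (Fin n → ℂ) X) :
    ContDiffOn ℝ ∞ (fun z => (g e z).det.re) e.target :=
  contDiffOn_re (contDiffOn_det (hg.smooth e he))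

lemma contDiffOn_logRatio {g₀ : LocalCoeff n X} (hg₀ : IsAdmissible g₀) (hg : IsAdmissible g)
    (he : e ∈ atlas (Fin n → ℂ) X) {F : X → ℝ} (hF : SmoothInCharts n F) :
    ContDiffOn ℝ ∞ (logRatio g₀ F g e) e.target := by
  refine ContDiffOn.sub (ContDiffOn.log (((contDiffOn_det_re hg he)).div
    (contDiffOn_det_re hg₀ he) fun z hz => (hg₀.det_pos e he z hz).ne') fun z hz => ?_) (hF e he)
  exact (div_pos (hg.det_pos e he z hz) (hg₀.det_pos e he z hz)).ne'

end

end charts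

/-! ### The volume form -/

section density

variable {X : Type*} [TopologicalSpace X]

/-- The density `n! 2ⁿ det(g)` of `ωⁿ` with respect to Lebesgue measure in a chart. -/
def density (g : LocalCoeff n X) (e : OpenPartialHomeomorph X (Fin n → ℂ))
    (z : Fin n → ℂ) : ℝ :=
  (n.factorial : ℝ) * 2 ^ n * (g e z).det.re

/-- The measure that the chart `e` defines on `X`. -/
def chartMeasure [MeasurableSpace X] (g : LocalCoeff n X) (e : OpenPartialHomeomorph X (Fin n → ℂ)) : Measure X :=
  (((volume : Measure (Fin n → ℂ)).restrict e.target).withDensity fun z =>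
    ENNReal.ofReal (density g e z)).map e.symm

variable [ChartedSpace (Fin n → ℂ) X] {e : OpenPartialHomeomorph X (Fin n → ℂ)}
  {g : LocalCoeff n X}

lemma continuousOn_density (hg : IsAdmissible g) (he : e ∈ atlas (Fin n → ℂ) X) :
    ContinuousOn (density g e) e.target :=
  continuousOn_const.mul (contDiffOn_det_re hg he).continuousOn

lemma density_pos (hg : IsAdmissible g) (he : e ∈ atlas (Fin n → ℂ) X) {z : Fin n → ℂ}
    (hz : z ∈ e.target) : 0 < density g e z := by
  have := hg.det_pos e he z hz
  unfold density
  positivity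

lemma volForm_eq_iSup [MeasurableSpace X] (g : LocalCoeff n X) :
    volForm g = ⨆ e ∈ atlas (Fin n → ℂ) X, chartMeasure g e := rfl

end density

section volume

variable {X : Type*} [TopologicalSpace X] [MeasurableSpace X] [BorelSpace X]

lemma aemeasurable_symm (e : OpenPartialHomeomorph X (Fin n → ℂ)) (f : (Fin n → ℂ) → ENNReal) :
    AEMeasurable e.symm (((volume : Measure (Fin n → ℂ)).restrict e.target).withDensity f) :=
  (e.symm.continuousOn.aemeasurable e.open_target.measurableSet).mono_ac
    (withDensity_absolutelyContinuous _ _)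

lemma chartMeasure_apply (g : LocalCoeff n X) (e : OpenPartialHomeomorph X (Fin n → ℂ))
    {S : Set X} (hS : MeasurableSet S) :
    chartMeasure g e S =
      ∫⁻ z in e.target ∩ e.symm ⁻¹' S, ENNReal.ofReal (density g e z) := by
  rw [chartMeasure, Measure.map_apply_of_aemeasurable (aemeasurable_symm e _) hS,
    withDensity_apply', Measure.restrict_restrict' e.open_target.measurableSet, Set.inter_comm]

lemma chartMeasure_compl_source (g : LocalCoeff n X)
    (e : OpenPartialHomeomorph X (Fin n → ℂ)) : chartMeasure g e e.sourceᶜ = 0 := by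
  rw [chartMeasure_apply g e e.open_source.measurableSet.compl]
  have : e.target ∩ e.symm ⁻¹' e.sourceᶜ = ∅ := by
    ext z
    simp only [Set.mem_inter_iff, Set.mem_preimage, Set.mem_compl_iff, Set.mem_empty_iff_false,
      iff_false, not_and, not_not]
    exact fun hz => e.map_target hz
  rw [this]
  simp

lemma chartMeasure_inter_source (g : LocalCoeff n X)
    (e : OpenPartialHomeomorph X (Fin n → ℂ)) (S : Set X) :
    chartMeasure g e (S ∩ e.source) = chartMeasure g e S := by
  refine le_antisymm (measure_mono Set.inter_subset_left) ?_
  have h : S ⊆ (S ∩ e.source) ∪ e.sourceᶜ := fun x hx => by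
    by_cases h : x ∈ e.source
    · exact Or.inl ⟨hx, h⟩
    · exact Or.inr h
  refine (measure_mono h).trans ((measure_union_le _ _).trans ?_)
  rw [chartMeasure_compl_source, add_zero]

lemma measurableSet_target_inter_preimage (e : OpenPartialHomeomorph X (Fin n → ℂ))
    {S : Set X} (hS : MeasurableSet S) : MeasurableSet (e.target ∩ e.symm ⁻¹' S) := by
  have h := (continuousOn_iff_continuous_domRestrict.1 e.symm.continuousOn).measurable hS
  have h2 := e.open_target.measurableSet.subtype_image h
  convert h2 using 1
  ext z
  constructor
  · exact fun hz => ⟨⟨z, hz.1⟩, hz.2, rfl⟩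
  · rintro ⟨y, hy, rfl⟩
    exact ⟨y.2, hy⟩

variable [ChartedSpace (Fin n → ℂ) X] [IsManifold 𝓘(ℂ, Fin n → ℂ) ω X]
  {e e' : OpenPartialHomeomorph X (Fin n → ℂ)} {g : LocalCoeff n X}

/-- Change of variables along the transition map: its real Jacobian determinant is exactly the
factor by which the densities in the two charts differ. -/
lemma chartMeasure_eq_of_subset (hg : IsAdmissible g) (he : e ∈ atlas (Fin n → ℂ) X)
    (he' : e' ∈ atlas (Fin n → ℂ) X) {S : Set X} (hS : MeasurableSet S)
    (hSe : S ⊆ e.source) (hSe' : S ⊆ e'.source) : chartMeasure g e S = chartMeasure g e' S := by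
  rw [chartMeasure_apply g e hS, chartMeasure_apply g e' hS]
  set A := e.target ∩ e.symm ⁻¹' S with hA
  have hAo : A ⊆ overlap e e' := fun z hz => ⟨hz.1, hSe' hz.2⟩
  have hAm : MeasurableSet A := measurableSet_target_inter_preimage e hS
  have himg : transition e e' '' A = e'.target ∩ e'.symm ⁻¹' S := by
    ext w
    constructor
    · rintro ⟨z, hz, rfl⟩
      refine ⟨(mapsTo_transition e e' (hAo hz)).1, ?_⟩
      rw [Set.mem_preimage, symm_transition (hAo hz)]
      exact hz.2
    · intro hw
      have hw' : w ∈ overlap e' e := ⟨hw.1, hSe hw.2⟩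
      refine ⟨transition e' e w, ⟨(mapsTo_transition e' e hw').1, ?_⟩, transition_transition hw'⟩
      rw [Set.mem_preimage, symm_transition hw']
      exact hw.2
  have hd : ∀ z ∈ A, HasFDerivWithinAt (transition e e')
      ((fderiv ℂ (transition e e') z).restrictScalars ℝ) A z := fun z hz =>
    ((((contDiffOn_transition he he').contDiffAt ((isOpen_overlap e e').mem_nhds
      (hAo hz))).differentiableAt (by simp)).hasFDerivAt.restrictScalars ℝ).hasFDerivWithinAt
  rw [← himg, lintegral_image_eq_lintegral_abs_det_fderiv_mul volume hAm hd
    ((injOn_transition e e').mono hAo)]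
  refine setLIntegral_congr_fun hAm fun z hz => ?_
  -- The real determinant of a complex-linear map is the norm from ℂ to ℝ, that is |·|², of its
  -- complex determinant.
  have hdet : ((fderiv ℂ (transition e e') z).restrictScalars ℝ).det =
      Complex.normSq (jac e e' z).det := by
    have h1 : (jac e e' z).det = LinearMap.det (fderiv ℂ (transition e e') z).toLinearMap := by
      rw [← LinearMap.det_toMatrix']
      congr 1
    rw [h1, ← Algebra.norm_complex_apply, ← LinearMap.det_restrictScalars]
    rfl
  rw [hdet, abs_of_nonneg (Complex.normSq_nonneg _),
    ← ENNReal.ofReal_mul (Complex.normSq_nonneg _), density, density,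
    hg.det_transform he he' (hAo hz)]
  congr 1
  ring

/-- A supremum of measures is not computed set by set, so the upper bound needs a single measure
dominating all chart measures that agrees with that of `e` inside its domain. -/
lemma volForm_apply_of_subset (hg : IsAdmissible g) (he : e ∈ atlas (Fin n → ℂ) X) {S : Set X}
    (hS : MeasurableSet S) (hSe : S ⊆ e.source) : volForm g S = chartMeasure g e S := by
  have hle : ∀ e' ∈ atlas (Fin n → ℂ) X, chartMeasure g e' ≤ volForm g := fun e' he' => by
    rw [volForm_eq_iSup]
    exact le_iSup₂ (f := fun e (_ : e ∈ atlas (Fin n → ℂ) X) => chartMeasure g e) e' he'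
  refine le_antisymm ?_ (hle e he S)
  have hsrc := e.open_source.measurableSet
  -- Inside the domain of `e` every chart measure is bounded by that of `e`, by agreement on
  -- overlaps; outside, the supremum itself is a bound, and this part does not charge S.
  have hub : volForm g ≤ chartMeasure g e + (volForm g).restrict e.sourceᶜ := by
    rw [volForm_eq_iSup]
    refine iSup₂_le fun e' he' => Measure.le_iff.2 fun T hT => ?_
    rw [← volForm_eq_iSup, Measure.add_apply, Measure.restrict_apply hT,
      ← measure_inter_add_sdiff T hsrc]
    refine add_le_add ?_ (hle e' he' _)
    rw [← chartMeasure_inter_source g e' (T ∩ e.source), ← chartMeasure_eq_of_subset hg he he'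
      ((hT.inter hsrc).inter e'.open_source.measurableSet)
      (fun x hx => hx.1.2) (fun x hx => hx.2)]
    exact measure_mono fun x hx => hx.1.1
  refine (hub S).trans ?_
  rw [Measure.add_apply, Measure.restrict_apply hS]
  have : S ∩ e.sourceᶜ = ∅ := Set.disjoint_iff_inter_eq_empty.1
    (Set.disjoint_compl_right_iff_subset.2 hSe)
  rw [this, measure_empty, add_zero]

lemma volForm_restrict_source (hg : IsAdmissible g) (he : e ∈ atlas (Fin n → ℂ) X) :
    (volForm g).restrict e.source = chartMeasure g e := by
  ext S hS
  rw [Measure.restrict_apply hS, volForm_apply_of_subset hg he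
    (hS.inter e.open_source.measurableSet) Set.inter_subset_right, chartMeasure_inter_source]

/-- The integral, with respect to `ωⁿ`, of a function supported in a chart. -/
lemma integrable_and_integral_volForm (hg : IsAdmissible g) (he : e ∈ atlas (Fin n → ℂ) X)
    {K : Set X} (hK : IsCompact K) (hKe : K ⊆ e.source) {f : X → ℝ} (hf : ContinuousOn f e.source)
    (hfK : ∀ x, x ∉ K → f x = 0) :
    Integrable f (volForm g) ∧
      ∫ x, f x ∂(volForm g) = ∫ z in e.target, density g e z * f (e.symm z) := by
  have hf0 : ∀ x, x ∉ e.source → f x = 0 := fun x hx => hfK x fun h => hx (hKe h)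
  have hsrc := e.open_source.measurableSet
  have hm : AEStronglyMeasurable f (chartMeasure g e) := by
    rw [← volForm_restrict_source hg he]
    exact hf.aestronglyMeasurable hsrc
  have hdm : AEMeasurable (fun z => ENNReal.ofReal (density g e z))
      ((volume : Measure (Fin n → ℂ)).restrict e.target) :=
    ((continuousOn_density hg he).aemeasurable e.open_target.measurableSet).ennreal_ofReal
  have hdt : ∀ᵐ z ∂((volume : Measure (Fin n → ℂ)).restrict e.target),
      ENNReal.ofReal (density g e z) < ⊤ := Filter.Eventually.of_forall fun z =>
    ENNReal.ofReal_lt_top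
  have hcongr : Set.EqOn (fun z => (ENNReal.ofReal (density g e z)).toReal • f (e.symm z))
      (fun z => density g e z * f (e.symm z)) e.target := fun z hz => by
    simp only [smul_eq_mul, ENNReal.toReal_ofReal (density_pos hg he hz).le]
  constructor
  · have h1 : Integrable f (chartMeasure g e) := by
      rw [chartMeasure, integrable_map_measure hm (aemeasurable_symm e _),
        integrable_withDensity_iff_integrable_smul₀' hdm hdt]
      have h2 : IntegrableOn (fun z => density g e z * f (e.symm z)) e.target := by
        refine integrableOn_of_eq_zero_off_compact e.open_target
          (hK.image_of_continuousOn (e.continuousOn.mono hKe))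
          (fun z hz => ?_) ((continuousOn_density hg he).mul
            (hf.comp e.symm.continuousOn e.symm.mapsTo)) fun z hz hzK => ?_
        · obtain ⟨x, hx, rfl⟩ := hz
          exact e.map_source (hKe hx)
        · rw [hfK, mul_zero]
          exact fun h => hzK ⟨_, h, e.right_inv hz⟩
      exact h2.congr_fun hcongr.symm e.open_target.measurableSet
    rw [← volForm_restrict_source hg he] at h1
    exact IntegrableOn.integrable_of_forall_notMem_eq_zero h1 hf0
  · rw [← setIntegral_eq_integral_of_forall_compl_eq_zero hf0, volForm_restrict_source hg he,
      chartMeasure, integral_map (aemeasurable_symm e _) hm,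
      integral_withDensity_eq_integral_toReal_smul₀ hdm hdt]
    exact setIntegral_congr_fun e.open_target.measurableSet hcongr

end volume

/-! ### Local form of the right-hand side of the flow -/

section localSpeed

lemma ddbar_congr {u v : (Fin n → ℂ) → ℝ} {U : Set (Fin n → ℂ)} (hU : IsOpen U)
    (h : Set.EqOn u v U) {z : Fin n → ℂ} (hz : z ∈ U) : ddbar u z = ddbar v z := by
  ext i j
  simp only [ddbar, Matrix.of_apply, dz_eq_wirt, dzbar_eq_wirt]
  exact wirt_congr_on hU (fun y hy => wirt_congr_on hU (fun w hw => by simp only [h hw]) hy) hz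

lemma ddbar_add {u v : (Fin n → ℂ) → ℝ} {U : Set (Fin n → ℂ)} (hU : IsOpen U)
    (hu : ContDiffOn ℝ ∞ u U) (hv : ContDiffOn ℝ ∞ v U) {z : Fin n → ℂ} (hz : z ∈ U) :
    ddbar (fun y => u y + v y) z = ddbar u z + ddbar v z := by
  have hd : ∀ {f : (Fin n → ℂ) → ℂ}, ContDiffOn ℝ ∞ f U → ∀ y ∈ U, DifferentiableAt ℝ f y :=
    fun hf y hy => (hf.contDiffAt (hU.mem_nhds hy)).differentiableAt (by simp)
  have hu' := contDiffOn_ofReal hu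
  have hv' := contDiffOn_ofReal hv
  ext i j
  simp only [ddbar, Matrix.of_apply, Matrix.add_apply, dz_eq_wirt, dzbar_eq_wirt,
    Complex.ofReal_add]
  rw [wirt_congr_on hU (fun y hy => wirt_add (hd hu' y hy) (hd hv' y hy)) hz,
    wirt_add (hd (ContDiffOn.wirt hU hu') z hz) (hd (ContDiffOn.wirt hU hv') z hz)]

lemma ddbar_neg {u : (Fin n → ℂ) → ℝ} (z : Fin n → ℂ) :
    ddbar (fun y => -u y) z = -ddbar u z := by
  ext i j
  simp only [ddbar, Matrix.of_apply, Matrix.neg_apply, dz_eq_wirt, dzbar_eq_wirt,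
    Complex.ofReal_neg]
  have : (wirt Complex.I j fun y => -(u y : ℂ)) = fun y => -wirt Complex.I j (fun y => (u y : ℂ)) y :=
    funext fun y => wirt_neg
  rw [this, wirt_neg]

lemma ddbar_zero (z : Fin n → ℂ) : ddbar (fun _ => 0) z = 0 := by
  ext i j
  simp only [ddbar, Matrix.of_apply, Matrix.zero_apply, dz_eq_wirt, dzbar_eq_wirt,
    Complex.ofReal_zero]
  have : (wirt Complex.I j fun _ : Fin n → ℂ => (0 : ℂ)) = fun _ => 0 :=
    funext fun y => wirt_const _
  rw [this, wirt_const]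

lemma ddbar_const_add {u : (Fin n → ℂ) → ℝ} (c : ℝ) (z : Fin n → ℂ) :
    ddbar (fun y => c + u y) z = ddbar u z := by
  ext i j
  have : (dzbar j fun w => (c : ℂ) + (u w : ℂ)) = dzbar j fun w => (u w : ℂ) := by
    ext y; simp only [dzbar, fderiv_const_add]
  simp only [ddbar, Matrix.of_apply, Complex.ofReal_add, this]

lemma torsionTerm_const_add {h : (Fin n → ℂ) → Matrix (Fin n) (Fin n) ℂ}
    {u : (Fin n → ℂ) → ℝ} (c : ℝ) (z : Fin n → ℂ) :
    torsionTerm h (fun y => c + u y) z = torsionTerm h u z := by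
  simp only [torsionTerm, dzbar, Complex.ofReal_add, fderiv_const_add]

variable {X : Type*} [TopologicalSpace X]

/-- The right-hand side of the flow in the chart `e`. -/
def localSpeed (g₀ : LocalCoeff n X) (F : X → ℝ) (g : LocalCoeff n X)
    (e : OpenPartialHomeomorph X (Fin n → ℂ)) (z : Fin n → ℂ) : ℝ :=
  chernScalar (g e) z + torsionTerm (g e) (logRatio g₀ F g e) z

variable [ChartedSpace (Fin n → ℂ) X]

/-- The data of the variational problem: `g₀` is a reference tensor with Chern-Ricci potential `F`
and `g` satisfies the pluriclosedness conditions. -/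
structure IsVariational (g₀ : LocalCoeff n X) (F : X → ℝ) (g : LocalCoeff n X) : Prop where
  ref : IsAdmissible g₀
  adm : IsAdmissible g
  pluriclosed : ∀ e ∈ atlas (Fin n → ℂ) X, ∀ z ∈ e.target, IsPluriclosedAt (g e) z
  smooth : SmoothInCharts n F
  ricci : ∀ e ∈ atlas (Fin n → ℂ) X, ∀ z ∈ e.target,
    chernRicci (g₀ e) z = ddbar (fun w => F (e.symm w)) z

variable {g₀ g : LocalCoeff n X} {F : X → ℝ} {e : OpenPartialHomeomorph X (Fin n → ℂ)}

/-- Splitting the logarithm leaves -Ric(ω) + Ric(ω₀) - √-1∂∂̄F, and the last two cancel by the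
choice of F. -/
lemma IsVariational.ddbar_logRatio (H : IsVariational g₀ F g) (he : e ∈ atlas (Fin n → ℂ) X)
    {z : Fin n → ℂ} (hz : z ∈ e.target) :
    ddbar (logRatio g₀ F g e) z = -chernRicci (g e) z := by
  have hU := e.open_target
  have hl : ∀ {g : LocalCoeff n X}, IsAdmissible g →
      ContDiffOn ℝ ∞ (fun y => Real.log (g e y).det.re) e.target := fun hg =>
    (contDiffOn_det_re hg he).log fun y hy => (hg.det_pos e he y hy).ne'
  have h1 : Set.EqOn (logRatio g₀ F g e) (fun y => Real.log (g e y).det.re +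
      ((-Real.log (g₀ e y).det.re) + (-F (e.symm y)))) e.target := fun y hy => by
    simp only [logRatio]
    rw [Real.log_div (H.adm.det_pos e he y hy).ne' (H.ref.det_pos e he y hy).ne']
    ring
  rw [ddbar_congr hU h1 hz, ddbar_add hU (hl H.adm) ((hl H.ref).neg.add (H.smooth e he).neg) hz,
    ddbar_add hU (hl H.ref).neg (H.smooth e he).neg hz, ddbar_neg, ddbar_neg,
    ← H.ricci e he z hz, chernRicci, chernRicci]
  abel

/-- The sum `∑ ∂_j̄ ∂ᵢ ((1 + u) det(g) g^{i j̄})` for `u = log (det g / det g₀) - F`. -/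
def speedDensity (g₀ : LocalCoeff n X) (F : X → ℝ) (g : LocalCoeff n X)
    (e : OpenPartialHomeomorph X (Fin n → ℂ)) (z : Fin n → ℂ) : ℂ :=
  ∑ i, ∑ j, dzbar j (dz i fun y => ((1 + logRatio g₀ F g e y : ℝ) : ℂ) * adjMetric (g e) i j y) z

/-- The added constant 1 has no effect: derivatives ignore it, and its undifferentiated term has
already vanished with the double divergence. -/
lemma IsVariational.speedDensity_re (H : IsVariational g₀ F g) (he : e ∈ atlas (Fin n → ℂ) X)
    {z : Fin n → ℂ} (hz : z ∈ e.target) :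
    (speedDensity g₀ F g e z).re = -((g e z).det.re * localSpeed g₀ F g e z) := by
  rw [speedDensity, sum_dzbar_dz_mul_adjMetric e.open_target hz (H.adm.smooth e he)
    (fun y hy => H.adm.det_ne_zero he hy) (H.adm.herm e he) (H.pluriclosed e he z hz)
    (contDiffOn_ofReal (contDiffOn_const.add (contDiffOn_logRatio H.ref H.adm he H.smooth))),
    ddbar_const_add, torsionTerm_const_add, H.ddbar_logRatio he hz,
    ← ofReal_det_re (H.adm.herm e he z hz), Complex.re_ofReal_mul, localSpeed, chernScalar]
  simp only [Matrix.neg_apply, mul_neg, Finset.sum_neg_distrib, Complex.sub_re, Complex.neg_re,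
    Complex.ofReal_re]
  ring

lemma IsVariational.contDiffOn_mul_adjMetric (H : IsVariational g₀ F g)
    (he : e ∈ atlas (Fin n → ℂ) X) (i j : Fin n) :
    ContDiffOn ℝ ∞ (fun y => ((1 + logRatio g₀ F g e y : ℝ) : ℂ) * adjMetric (g e) i j y)
      e.target :=
  (contDiffOn_ofReal (contDiffOn_const.add (contDiffOn_logRatio H.ref H.adm he H.smooth))).mul
    (contDiffOn_adjMetric (H.adm.smooth e he) (fun _ hy => H.adm.det_ne_zero he hy) i j)

/-- Dividing the preceding identity by det g avoids treating the curvature and torsion terms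
separately. -/
lemma IsVariational.contDiffOn_localSpeed (H : IsVariational g₀ F g)
    (he : e ∈ atlas (Fin n → ℂ) X) : ContDiffOn ℝ ∞ (localSpeed g₀ F g e) e.target := by
  have h1 : ContDiffOn ℝ ∞ (speedDensity g₀ F g e) e.target := by
    refine ContDiffOn.sum fun i _ => ContDiffOn.sum fun j _ => ?_
    rw [dz_eq_wirt, dzbar_eq_wirt]
    exact ContDiffOn.wirt e.open_target (ContDiffOn.wirt e.open_target
      (H.contDiffOn_mul_adjMetric he i j))
  refine ((contDiffOn_re h1).neg.div (contDiffOn_det_re H.adm he)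
    fun y hy => (H.adm.det_pos e he y hy).ne').congr fun y hy => ?_
  rw [Pi.div_apply, H.speedDensity_re he hy, neg_neg,
    mul_div_cancel_left₀ _ (H.adm.det_pos e he y hy).ne']

lemma contDiffOn_lapl (hg : IsAdmissible g) (he : e ∈ atlas (Fin n → ℂ) X)
    {u : (Fin n → ℂ) → ℝ} (hu : ContDiffOn ℝ ∞ u e.target) :
    ContDiffOn ℝ ∞ (lapl (g e) u) e.target :=
  contDiffOn_re (ContDiffOn.sum fun i _ => ContDiffOn.sum fun j _ =>
    (contDiffOn_invMetric (hg.smooth e he) (fun _ hy => hg.det_ne_zero he hy) i j).mul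
      (contDiffOn_ddbar e.open_target hu i j))

/-- Green's formula in a chart. -/
lemma IsVariational.green_chart (H : IsVariational g₀ F g) (he : e ∈ atlas (Fin n → ℂ) X)
    {K : Set (Fin n → ℂ)} (hK : IsCompact K) (hKe : K ⊆ e.target) {u : (Fin n → ℂ) → ℝ}
    (hu : ContDiffOn ℝ ∞ u e.target) (huK : ∀ z ∈ e.target, z ∉ K → u z = 0) :
    ∫ z in e.target, density g e z * ((1 + logRatio g₀ F g e z) * lapl (g e) u z) =
      -∫ z in e.target, density g e z * (u z * localSpeed g₀ F g e z) := by
  have hU := e.open_target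
  have hu' := contDiffOn_ofReal hu
  have huK' : ∀ z ∈ e.target, z ∉ K → (u z : ℂ) = 0 := fun z hz hzK => by
    rw [huK z hz hzK, Complex.ofReal_zero]
  set W : Fin n → Fin n → (Fin n → ℂ) → ℂ := fun i j y =>
    ((1 + logRatio g₀ F g e y : ℝ) : ℂ) * adjMetric (g e) i j y with hW
  have hWs : ∀ i j, ContDiffOn ℝ ∞ (W i j) e.target := H.contDiffOn_mul_adjMetric he
  have i1 : ∀ i j, IntegrableOn (fun z => W i j z * dz i (dzbar j fun w => (u w : ℂ)) z)
      e.target := by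
    intro i j
    rw [dz_eq_wirt, dzbar_eq_wirt]
    refine integrableOn_of_eq_zero_off_compact hU hK hKe ((hWs i j).continuousOn.mul
      (ContDiffOn.wirt hU (ContDiffOn.wirt hU hu')).continuousOn) fun z hz hzK => ?_
    rw [wirt_eq_zero_off_compact hU hK (wirt_eq_zero_off_compact hU hK huK') z hz hzK, mul_zero]
  have i2 : ∀ i j, IntegrableOn (fun z => dzbar j (dz i (W i j)) z * (u z : ℂ)) e.target := by
    intro i j
    rw [dz_eq_wirt, dzbar_eq_wirt]
    refine integrableOn_of_eq_zero_off_compact hU hK hKe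
      ((ContDiffOn.wirt hU (ContDiffOn.wirt hU (hWs i j))).continuousOn.mul
      hu'.continuousOn) fun z hz hzK => ?_
    rw [huK' z hz hzK, mul_zero]
  have key : ∫ z in e.target, ∑ i, ∑ j, W i j z * dz i (dzbar j fun w => (u w : ℂ)) z =
      ∫ z in e.target, ∑ i, ∑ j, dzbar j (dz i (W i j)) z * (u z : ℂ) := by
    rw [integral_finsetSum _ fun i _ => integrable_finsetSum _ fun j _ => i1 i j,
      integral_finsetSum _ fun i _ => integrable_finsetSum _ fun j _ => i2 i j]
    refine Finset.sum_congr rfl fun i _ => ?_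
    rw [integral_finsetSum _ fun j _ => i1 i j, integral_finsetSum _ fun j _ => i2 i j]
    exact Finset.sum_congr rfl fun j _ => integral_mul_dz_dzbar hU hK hKe (hWs i j) hu' huK' i j
  -- Integration by parts is an identity of complex integrals; its real part contains the Laplacian
  -- on one side and the flow speed on the other.
  have key2 := congrArg Complex.re key
  rw [← RCLike.re_eq_complex_re, ← integral_re (integrable_finsetSum _ fun i _ =>
    integrable_finsetSum _ fun j _ => i1 i j), ← integral_re (integrable_finsetSum _ fun i _ =>
    integrable_finsetSum _ fun j _ => i2 i j)] at key2
  set c : ℝ := (n.factorial : ℝ) * 2 ^ n with hc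
  have e1 : Set.EqOn (fun z => density g e z * ((1 + logRatio g₀ F g e z) * lapl (g e) u z))
      (fun z => c * RCLike.re (∑ i, ∑ j, W i j z * dz i (dzbar j fun w => (u w : ℂ)) z))
      e.target := by
    intro z hz
    have h1 : ∑ i, ∑ j, W i j z * dz i (dzbar j fun w => (u w : ℂ)) z =
        (((1 + logRatio g₀ F g e z) * (g e z).det.re : ℝ) : ℂ) *
          ∑ i, ∑ j, invMetric (g e) i j z * ddbar u z i j := by
      simp only [hW, Finset.mul_sum, adjMetric, ddbar, Matrix.of_apply]
      rw [Complex.ofReal_mul, ofReal_det_re (H.adm.herm e he z hz)]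
      refine Finset.sum_congr rfl fun i _ => Finset.sum_congr rfl fun j _ => ?_
      ring
    simp only
    rw [h1, RCLike.re_eq_complex_re, Complex.re_ofReal_mul, density, lapl, hc]
    ring
  have e2 : Set.EqOn (fun z => density g e z * (u z * localSpeed g₀ F g e z))
      (fun z => -c * RCLike.re (∑ i, ∑ j, dzbar j (dz i (W i j)) z * (u z : ℂ))) e.target := by
    intro z hz
    have h1 : ∑ i, ∑ j, dzbar j (dz i (W i j)) z * (u z : ℂ) =
        (u z : ℂ) * speedDensity g₀ F g e z := by
      simp only [speedDensity, Finset.mul_sum]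
      exact Finset.sum_congr rfl fun i _ => Finset.sum_congr rfl fun j _ => mul_comm _ _
    simp only
    rw [h1, RCLike.re_eq_complex_re, Complex.re_ofReal_mul, H.speedDensity_re he hz, density, hc]
    ring
  rw [setIntegral_congr_fun hU.measurableSet e1, setIntegral_congr_fun hU.measurableSet e2,
    integral_const_mul, integral_const_mul, key2]
  ring

end localSpeed

/-! ### Green's formula on the manifold -/

section glue

variable {X : Type*} [TopologicalSpace X]

lemma isCompact_image_chart {e : OpenPartialHomeomorph X (Fin n → ℂ)} {K : Set X} (hK : IsCompact K) (hKe : K ⊆ e.source) :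
    IsCompact (e '' K) ∧ e '' K ⊆ e.target :=
  ⟨hK.image_of_continuousOn (e.continuousOn.mono hKe), by
    rintro _ ⟨x, hx, rfl⟩; exact e.map_source (hKe hx)⟩

lemma eq_zero_off_image {e : OpenPartialHomeomorph X (Fin n → ℂ)} {K : Set X} {f : X → ℝ}
    (hfK : ∀ x, x ∉ K → f x = 0) :
    ∀ z ∈ e.target, z ∉ e '' K → f (e.symm z) = 0 := fun _ hz hzK =>
  hfK _ fun h => hzK ⟨_, h, e.right_inv hz⟩

lemma eq_zero_off_tsupport {χ : X → ℝ} (f : X → ℝ) :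
    ∀ x, x ∉ tsupport χ → χ x * f x = 0 := fun x hx => by
  rw [image_eq_zero_of_notMem_tsupport hx, zero_mul]

lemma continuous_of_eq_zero_off_compact [T2Space X] {O K : Set X} (hO : IsOpen O) (hK : IsCompact K)
    (hKO : K ⊆ O) {f : X → ℝ} (hf : ContinuousOn f O) (hfK : ∀ x, x ∉ K → f x = 0) :
    Continuous f := by
  refine continuous_iff_continuousAt.2 fun x => ?_
  by_cases hx : x ∈ K
  · exact hf.continuousAt (hO.mem_nhds (hKO hx))
  · refine (continuousAt_const (y := (0 : ℝ))).congr ?_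
    filter_upwards [hK.isClosed.isOpen_compl.mem_nhds hx] with y hy
    exact (hfK y hy).symm

variable [ChartedSpace (Fin n → ℂ) X]

/-- A family of local functions that agree under changes of coordinates. -/
def IsInvariant (q : OpenPartialHomeomorph X (Fin n → ℂ) → (Fin n → ℂ) → ℝ) : Prop :=
  ∀ e ∈ atlas (Fin n → ℂ) X, ∀ e' ∈ atlas (Fin n → ℂ) X, ∀ z ∈ overlap e e',
    q e z = q e' (transition e e' z)

/-- The function on `X` whose value at `x` is read off in the preferred chart at `x`. -/
def glue (q : OpenPartialHomeomorph X (Fin n → ℂ) → (Fin n → ℂ) → ℝ) (x : X) : ℝ :=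
  q (chartAt (Fin n → ℂ) x) (chartAt (Fin n → ℂ) x x)

variable {q q' : OpenPartialHomeomorph X (Fin n → ℂ) → (Fin n → ℂ) → ℝ}
  {e e' : OpenPartialHomeomorph X (Fin n → ℂ)}

lemma glue_symm (hq : IsInvariant q) (he : e ∈ atlas (Fin n → ℂ) X) {z : Fin n → ℂ}
    (hz : z ∈ e.target) : glue q (e.symm z) = q e z :=
  (hq e he _ (chart_mem_atlas _ _) z ⟨hz, mem_chart_source _ _⟩).symm

lemma smoothInCharts_glue (hq : IsInvariant q)
    (hs : ∀ e ∈ atlas (Fin n → ℂ) X, ContDiffOn ℝ ∞ (q e) e.target) :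
    SmoothInCharts n (glue q) := fun e he =>
  (hs e he).congr fun _ hz => glue_symm hq he hz

lemma SmoothInCharts.continuous {f : X → ℝ} (hf : SmoothInCharts n f) : Continuous f :=
  continuous_iff_continuousAt.2 fun x => (hf.continuousOn (chart_mem_atlas _ x)).continuousAt
    ((chartAt (Fin n → ℂ) x).open_source.mem_nhds (mem_chart_source _ x))

lemma lapl_eq_zero {h : (Fin n → ℂ) → Matrix (Fin n) (Fin n) ℂ} {u : (Fin n → ℂ) → ℝ}
    {U : Set (Fin n → ℂ)} (hU : IsOpen U) (hu : ∀ z ∈ U, u z = 0) {z : Fin n → ℂ}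
    (hz : z ∈ U) : lapl h u z = 0 := by
  simp [lapl, ddbar_congr hU (v := fun _ => 0) hu hz, ddbar_zero]

lemma isInvariant_logRatio {g₀ g : LocalCoeff n X} (hg₀ : IsAdmissible g₀) (hg : IsAdmissible g)
    (F : X → ℝ) : IsInvariant (logRatio g₀ F g) :=
  fun _ he _ he' _ hz => logRatio_transform hg₀ hg he he' hz F

/-- The function `(1 + log (det g / det g₀) - F) Δf` on `X`. -/
def greenIntegrand (g₀ : LocalCoeff n X) (F : X → ℝ) (g : LocalCoeff n X) (f : X → ℝ) : X → ℝ :=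
  glue fun e z => (1 + logRatio g₀ F g e z) * lapl (g e) (fun w => f (e.symm w)) z

variable {g₀ g : LocalCoeff n X} {F f : X → ℝ}

lemma IsVariational.isInvariant_green [IsManifold 𝓘(ℂ, Fin n → ℂ) ω X]
    (H : IsVariational g₀ F g) (hf : SmoothInCharts n f) :
    IsInvariant fun e z => (1 + logRatio g₀ F g e z) * lapl (g e) (fun w => f (e.symm w)) z :=
  fun e he e' he' z hz => by
    simp only
    rw [isInvariant_logRatio H.ref H.adm F e he e' he' z hz,
      H.adm.lapl_transform he he' hz hf]

lemma IsVariational.smooth_greenIntegrand [IsManifold 𝓘(ℂ, Fin n → ℂ) ω X]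
    (H : IsVariational g₀ F g) (hf : SmoothInCharts n f) :
    SmoothInCharts n (greenIntegrand g₀ F g f) :=
  smoothInCharts_glue (H.isInvariant_green hf) fun e he =>
    (contDiffOn_const.add (contDiffOn_logRatio H.ref H.adm he H.smooth)).mul
      (contDiffOn_lapl H.adm he (hf e he))

/-- The Laplacian is local, so a function vanishing on the open complement of K has zero Laplacian
there. -/
lemma greenIntegrand_eq_zero {K : Set X} (hK : IsClosed K) (hfK : ∀ x, x ∉ K → f x = 0) {x : X}
    (hx : x ∉ K) : greenIntegrand g₀ F g f x = 0 := by
  set e := chartAt (Fin n → ℂ) x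
  have hU : IsOpen (e.target ∩ e.symm ⁻¹' Kᶜ) := e.symm.isOpen_inter_preimage hK.isOpen_compl
  have hxe : x ∈ e.source := mem_chart_source _ x
  have h := lapl_eq_zero (h := g e) (u := fun w => f (e.symm w)) hU (fun z hz => hfK _ hz.2)
    (z := e x) ⟨e.map_source hxe, by rw [Set.mem_preimage, e.left_inv hxe]; exact hx⟩
  change _ * lapl (g e) (fun w => f (e.symm w)) (e x) = 0
  rw [h, mul_zero]

lemma flowSpeed_eq_glue : flowSpeed g₀ F g = glue (localSpeed g₀ F g) := rfl

lemma greenIntegrand_sum {t : Finset X} {η : X → X → ℝ} (hη : ∀ p, SmoothInCharts n (η p))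
    (x : X) : greenIntegrand g₀ F g (fun y => ∑ p ∈ t, η p y) x =
      ∑ p ∈ t, greenIntegrand g₀ F g (η p) x := by
  set e := chartAt (Fin n → ℂ) x
  have he : e ∈ atlas (Fin n → ℂ) X := chart_mem_atlas _ x
  have hx : e x ∈ e.target := e.map_source (mem_chart_source _ x)
  have h : ddbar (fun w => ∑ p ∈ t, η p (e.symm w)) (e x) =
      ∑ p ∈ t, ddbar (fun w => η p (e.symm w)) (e x) := by
    classical
    induction t using Finset.induction_on with
    | empty => simp only [Finset.sum_empty, ddbar_zero]
    | insert a s ha ih =>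
      simp only [Finset.sum_insert ha]
      rw [ddbar_add e.open_target (hη a e he) (ContDiffOn.sum fun p _ => hη p e he) hx, ih]
  change (1 + logRatio g₀ F g e (e x)) * lapl (g e) (fun w => ∑ p ∈ t, η p (e.symm w)) (e x) =
    ∑ p ∈ t, (1 + logRatio g₀ F g e (e x)) * lapl (g e) (fun w => η p (e.symm w)) (e x)
  rw [← Finset.mul_sum]
  congr 1
  simp only [lapl, h, ← Complex.re_sum]
  congr 1
  rw [Finset.sum_comm' (t' := Finset.univ) (s' := fun _ => t) (by simp)]
  refine Finset.sum_congr rfl fun i _ => ?_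
  rw [Finset.sum_comm' (t' := Finset.univ) (s' := fun _ => t) (by simp)]
  refine Finset.sum_congr rfl fun j _ => ?_
  rw [Matrix.sum_apply, Finset.mul_sum]

variable [T2Space X] [IsManifold 𝓘(ℂ, Fin n → ℂ) ω X]

/-- The extension by zero to `X` of a function with compact support in a chart. -/
lemma smoothInCharts_extend (he : e ∈ atlas (Fin n → ℂ) X) {ζ : (Fin n → ℂ) → ℝ}
    (hζ : ContDiff ℝ ∞ ζ) (hζc : HasCompactSupport ζ) (hζe : tsupport ζ ⊆ e.target) :
    SmoothInCharts n (e.source.indicator fun x => ζ (e x)) := by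
  intro e' he' w hw
  set K := e.symm '' tsupport ζ
  have hK : IsCompact K := hζc.isCompact.image_of_continuousOn (e.symm.continuousOn.mono hζe)
  by_cases hwe : e'.symm w ∈ e.source
  · have hwo : w ∈ overlap e' e := ⟨hw, hwe⟩
    have h1 : ContDiffAt ℝ ∞ (fun y => ζ (transition e' e y)) w :=
      hζ.contDiffAt.comp w ((((contDiffOn_transition he' he).contDiffAt
        ((isOpen_overlap e' e).mem_nhds hwo)).restrict_scalars ℝ).of_le (by simp))
    refine (h1.congr_of_eventuallyEq ?_).contDiffWithinAt
    filter_upwards [(isOpen_overlap e' e).mem_nhds hwo] with y hy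
    rw [Set.indicator_of_mem (show e'.symm y ∈ e.source from hy.2)]
    rfl
  -- Outside the domain of `e` the point has a neighbourhood avoiding K, which is compact and hence
  -- closed in the Hausdorff space X; the extension is identically zero there.
  · have hO : IsOpen (e'.target ∩ e'.symm ⁻¹' Kᶜ) :=
      e'.symm.isOpen_inter_preimage hK.isClosed.isOpen_compl
    have hKe : K ⊆ e.source := by
      rintro _ ⟨z, hz, rfl⟩; exact e.map_target (hζe hz)
    refine ((contDiffAt_const (c := (0 : ℝ))).congr_of_eventuallyEq ?_).contDiffWithinAt
    filter_upwards [hO.mem_nhds ⟨hw, fun h => hwe (hKe h)⟩] with y hy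
    by_cases hye : e'.symm y ∈ e.source
    · rw [Set.indicator_of_mem hye]
      refine image_eq_zero_of_notMem_tsupport fun h => hy.2 ⟨_, h, e.left_inv hye⟩
    · rw [Set.indicator_of_notMem hye]

lemma exists_partition_of_unity (n : ℕ) (X : Type*) [TopologicalSpace X] [T2Space X]
    [CompactSpace X] [ChartedSpace (Fin n → ℂ) X] [IsManifold 𝓘(ℂ, Fin n → ℂ) ω X] :
    ∃ (t : Finset X) (χ : X → X → ℝ), (∀ p, SmoothInCharts n (χ p)) ∧
      (∀ p, tsupport (χ p) ⊆ (chartAt (Fin n → ℂ) p).source) ∧ ∀ x, ∑ p ∈ t, χ p x = 1 := by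
  have := isManifold_real (n := n) X
  obtain ⟨f, hf⟩ := SmoothPartitionOfUnity.exists_isSubordinate_chartAt_source
    𝓘(ℝ, Fin n → ℂ) X
  have hfin := f.locallyFinite.finite_nonempty_of_compact
  refine ⟨hfin.toFinset, fun p => f p, fun p => smoothInCharts_of_contMDiff (f p).contMDiff,
    hf, fun x => ?_⟩
  rw [← f.sum_eq_one (Set.mem_univ x)]
  refine (finsum_eq_sum_of_support_subset _ fun p hp => ?_).symm
  simp only [Set.Finite.coe_toFinset, Set.mem_ofPred_eq]
  exact ⟨x, hp⟩

variable [MeasurableSpace X] [BorelSpace X]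

/-- The left side is already a global integral, because the Laplacian is known to be invariant. The
right side stays in coordinates: invariance of the local speed is deduced from this statement. -/
lemma IsVariational.integral_greenIntegrand_chart (H : IsVariational g₀ F g)
    (he : e ∈ atlas (Fin n → ℂ) X) {K : Set X} (hK : IsCompact K) (hKe : K ⊆ e.source)
    (hf : SmoothInCharts n f) (hfK : ∀ x, x ∉ K → f x = 0) :
    Integrable (greenIntegrand g₀ F g f) (volForm g) ∧
      ∫ x, greenIntegrand g₀ F g f x ∂(volForm g) =
        -∫ z in e.target, density g e z * (f (e.symm z) * localSpeed g₀ F g e z) := by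
  obtain ⟨h1, h2⟩ := integrable_and_integral_volForm H.adm he hK hKe
    ((H.smooth_greenIntegrand hf).continuousOn he)
    fun x hx => greenIntegrand_eq_zero hK.isClosed hfK hx
  refine ⟨h1, ?_⟩
  rw [h2, ← H.green_chart he (isCompact_image_chart hK hKe).1 (isCompact_image_chart hK hKe).2
    (hf e he) (eq_zero_off_image hfK)]
  refine setIntegral_congr_fun e.open_target.measurableSet fun z hz => ?_
  simp only [greenIntegrand]
  rw [glue_symm (H.isInvariant_green hf) he hz]

/-- The right-hand side of the flow does not depend on the chart: it is the `L²`-gradient of an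
invariant functional. -/
lemma IsVariational.isInvariant_localSpeed (H : IsVariational g₀ F g) :
    IsInvariant (localSpeed g₀ F g) := by
  intro e he e' he'
  set O := overlap e e'
  have hO : IsOpen O := isOpen_overlap e e'
  have hOe : O ⊆ e.target := Set.inter_subset_left
  set r : (Fin n → ℂ) → ℝ := fun z => density g e z *
    (localSpeed g₀ F g e z - localSpeed g₀ F g e' (transition e e' z)) with hr
  have htr : ContinuousOn (transition e e') O := (contDiffOn_transition he he').continuousOn
  have hc1 : ContinuousOn (localSpeed g₀ F g e) O :=
    (H.contDiffOn_localSpeed he).continuousOn.mono hOe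
  have hc2 : ContinuousOn (fun z => localSpeed g₀ F g e' (transition e e' z)) O :=
    (H.contDiffOn_localSpeed he').continuousOn.comp htr
      fun z hz => (mapsTo_transition e e' hz).1
  have hd : ContinuousOn (density g e) O := (continuousOn_density H.adm he).mono hOe
  have hrc : ContinuousOn r O := hd.mul (hc1.sub hc2)
  -- For a test function ζ on the overlap, extended by zero to X, Green's formula in `e` and in `e'`
  -- computes the same global integral; equating the right-hand sides shows that the weighted
  -- difference of the speeds is orthogonal to ζ.
  have key : ∀ ζ : (Fin n → ℂ) → ℝ, ContDiff ℝ ∞ ζ → HasCompactSupport ζ → tsupport ζ ⊆ O →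
      ∫ z, ζ z • r z = 0 := by
    intro ζ hζ hζc hζO
    set η : X → ℝ := e.source.indicator fun x => ζ (e x) with hη
    have hηs : SmoothInCharts n η := smoothInCharts_extend he hζ hζc (hζO.trans hOe)
    set K := e.symm '' tsupport ζ
    have hK : IsCompact K :=
      hζc.isCompact.image_of_continuousOn (e.symm.continuousOn.mono (hζO.trans hOe))
    have hKe : K ⊆ e.source := by
      rintro _ ⟨z, hz, rfl⟩; exact e.map_target (hOe (hζO hz))
    have hKe' : K ⊆ e'.source := by
      rintro _ ⟨z, hz, rfl⟩; exact (hζO hz).2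
    have hηK : ∀ x, x ∉ K → η x = 0 := by
      intro x hx
      by_cases hxe : x ∈ e.source
      · rw [hη, Set.indicator_of_mem hxe]
        exact image_eq_zero_of_notMem_tsupport fun h => hx ⟨_, h, e.left_inv hxe⟩
      · rw [hη, Set.indicator_of_notMem hxe]
    have hηζ : ∀ z ∈ e.target, η (e.symm z) = ζ z := fun z hz => by
      rw [hη, Set.indicator_of_mem (e.map_target hz), e.right_inv hz]
    have h1 := (H.integral_greenIntegrand_chart he hK hKe hηs hηK).2
    have h2 := (H.integral_greenIntegrand_chart he' hK hKe' hηs hηK).2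
    -- The speed read in `e'` and cut off by η is a function on X, so its integral can be carried
    -- from the coordinates of `e'` to those of `e`.
    set Q : X → ℝ := fun x => η x * localSpeed g₀ F g e' (e' x) with hQ
    have hQK : ∀ x, x ∉ K → Q x = 0 := fun x hx => by simp only [hQ, hηK x hx, zero_mul]
    have hQc : Continuous Q := by
      refine continuous_of_eq_zero_off_compact e'.open_source hK hKe' ?_ hQK
      exact hηs.continuous.continuousOn.mul
        ((H.contDiffOn_localSpeed he').continuousOn.comp e'.continuousOn e'.mapsTo)
    have h3 := (integrable_and_integral_volForm H.adm he hK hKe hQc.continuousOn hQK).2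
    have h4 := (integrable_and_integral_volForm H.adm he' hK hKe' hQc.continuousOn hQK).2
    have h5 : ∫ z in e'.target, density g e' z * Q (e'.symm z) =
        ∫ z in e'.target, density g e' z * (η (e'.symm z) * localSpeed g₀ F g e' z) :=
      setIntegral_congr_fun e'.open_target.measurableSet fun z hz => by
        simp only [hQ, e'.right_inv hz]
    have h6 : ∫ z in e.target, density g e z * (η (e.symm z) * localSpeed g₀ F g e z) =
        ∫ z in e.target, density g e z * Q (e.symm z) := by
      rw [← h3, h4, h5]
      linarith
    have hKt := isCompact_image_chart hK hKe
    have i1 : IntegrableOn (fun z => density g e z * (η (e.symm z) * localSpeed g₀ F g e z))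
        e.target :=
      integrableOn_of_eq_zero_off_compact e.open_target hKt.1 hKt.2
        ((continuousOn_density H.adm he).mul ((hηs e he).continuousOn.mul
          (H.contDiffOn_localSpeed he).continuousOn))
        fun z hz hzK => by simp [eq_zero_off_image hηK z hz hzK]
    have i2 : IntegrableOn (fun z => density g e z * Q (e.symm z)) e.target :=
      integrableOn_of_eq_zero_off_compact e.open_target hKt.1 hKt.2
        ((continuousOn_density H.adm he).mul (hQc.comp_continuousOn e.symm.continuousOn))
        fun z hz hzK => by simp [eq_zero_off_image hQK z hz hzK]
    have h7 : ∫ z in e.target, ζ z • r z = 0 := by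
      rw [← sub_eq_zero, ← integral_sub i1 i2] at h6
      rw [← h6]
      refine setIntegral_congr_fun e.open_target.measurableSet fun z hz => ?_
      simp only [hr, hQ, smul_eq_mul, hηζ z hz, transition]
      ring
    rw [← h7]
    refine (setIntegral_eq_integral_of_forall_compl_eq_zero fun z hz => ?_).symm
    rw [image_eq_zero_of_notMem_tsupport fun h => hz (hOe (hζO h)), zero_smul]
  -- The fundamental lemma of the calculus of variations gives vanishing almost everywhere;
  -- continuity then makes it hold at every point of the overlap, and the positive density can be
  -- cancelled.
  have hae := hO.ae_eq_zero_of_integral_contDiff_smul_eq_zero (μ := volume)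
    (hrc.locallyIntegrableOn hO.measurableSet) key
  have hae' : r =ᵐ[volume.restrict O] fun _ => 0 := by
    rw [Filter.EventuallyEq, ae_restrict_iff' hO.measurableSet]
    exact hae
  intro z hz
  have hz0 := Measure.eqOn_open_of_ae_eq hae' hO hrc continuousOn_const hz
  have := (mul_eq_zero.1 hz0).resolve_left (density_pos H.adm he (hOe hz)).ne'
  linarith

lemma IsVariational.smooth_flowSpeed (H : IsVariational g₀ F g) :
    SmoothInCharts n (flowSpeed g₀ F g) :=
  smoothInCharts_glue H.isInvariant_localSpeed fun _ he => H.contDiffOn_localSpeed he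

/-- Green's formula on a compact manifold. -/
theorem IsVariational.integral_greenIntegrand [CompactSpace X] (H : IsVariational g₀ F g)
    (hf : SmoothInCharts n f) :
    ∫ x, greenIntegrand g₀ F g f x ∂(volForm g) =
      -∫ x, f x * flowSpeed g₀ F g x ∂(volForm g) := by
  obtain ⟨t, χ, hχ, hχs, hχ1⟩ := exists_partition_of_unity n X
  have hsum : ∀ (u : X → ℝ) x, u x = ∑ p ∈ t, χ p x * u x := fun u x => by
    rw [← Finset.sum_mul, hχ1, one_mul]
  have hη : ∀ p, SmoothInCharts n fun x => χ p x * f x := fun p => (hχ p).mul hf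
  have hK : ∀ p, IsCompact (tsupport (χ p)) := fun p => (isClosed_tsupport _).isCompact
  have hl := fun p => H.integral_greenIntegrand_chart (chart_mem_atlas _ p) (hK p) (hχs p) (hη p)
    (eq_zero_off_tsupport f)
  have hr := fun p => integrable_and_integral_volForm H.adm (chart_mem_atlas _ p) (hK p) (hχs p)
    ((hη p).mul H.smooth_flowSpeed).continuous.continuousOn
    (fun x hx => by rw [eq_zero_off_tsupport f x hx, zero_mul])
  have e1 : ∀ x, greenIntegrand g₀ F g f x =
      ∑ p ∈ t, greenIntegrand g₀ F g (fun y => χ p y * f y) x := fun x => by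
    rw [← greenIntegrand_sum hη, ← funext (hsum f)]
  have e2 : ∀ x, f x * flowSpeed g₀ F g x = ∑ p ∈ t, χ p x * f x * flowSpeed g₀ F g x :=
    fun x => by rw [← Finset.sum_mul, ← hsum f]
  simp_rw [e1, e2]
  rw [integral_finsetSum _ fun p _ => (hl p).1, integral_finsetSum _ fun p _ => (hr p).1,
    ← Finset.sum_neg_distrib]
  refine Finset.sum_congr rfl fun p _ => ?_
  rw [(hl p).2, (hr p).2]
  congr 1
  refine setIntegral_congr_fun (chartAt _ p).open_target.measurableSet fun z hz => ?_
  simp only [flowSpeed_eq_glue]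
  rw [glue_symm H.isInvariant_localSpeed (chart_mem_atlas _ p) hz]

end glue

/-! ### First variation of the Mabuchi energy -/

section variation

variable {X : Type*} [TopologicalSpace X] [ChartedSpace (Fin n → ℂ) X]

/-- Smoothness, in the charts of the atlas, of a function on `[a, b] × X`. -/
def SmoothFamily (n : ℕ) {X : Type*} [TopologicalSpace X] [ChartedSpace (Fin n → ℂ) X]
    (a b : ℝ) (Φ : ℝ → X → ℝ) : Prop :=
  ∀ e ∈ atlas (Fin n → ℂ) X, ContDiffOn ℝ ∞
    (fun p : ℝ × (Fin n → ℂ) => Φ p.1 (e.symm p.2)) (Set.Icc a b ×ˢ e.target)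

variable {a b : ℝ} {Φ : ℝ → X → ℝ} {g₀ : LocalCoeff n X} {F : X → ℝ}
  {e : OpenPartialHomeomorph X (Fin n → ℂ)}

lemma SmoothFamily.slice (hΦ : SmoothFamily n a b Φ) {t : ℝ} (ht : t ∈ Set.Icc a b) :
    SmoothInCharts n (Φ t) := fun e he =>
  contDiffOn_slice (Ψ := fun r z => Φ r (e.symm z)) (hΦ e he) ht

lemma SmoothFamily.velocity (hab : a < b) (hΦ : SmoothFamily n a b Φ) :
    SmoothFamily n a b fun t x => derivWithin (fun s => Φ s x) (Set.Icc a b) t := fun e he =>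
  contDiffOn_timeDeriv (Ψ := fun r z => Φ r (e.symm z)) hab e.open_target (hΦ e he)

lemma SmoothFamily.contDiffOn_perturb (hab : a < b) (hΦ : SmoothFamily n a b Φ)
    (hg₀ : IsAdmissible g₀) (he : e ∈ atlas (Fin n → ℂ) X) (i j : Fin n) :
    ContDiffOn ℝ ∞ (fun p : ℝ × (Fin n → ℂ) => perturb g₀ (Φ p.1) e p.2 i j)
      (Set.Icc a b ×ˢ e.target) :=
  ((hg₀.smooth e he i j).comp contDiffOn_snd fun _ hp => hp.2).add
    (contDiffOn_ddbar_slice (Φ := fun r z => Φ r (e.symm z)) hab e.open_target (hΦ e he) i j)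

lemma SmoothFamily.contDiffOn_det_perturb (hab : a < b) (hΦ : SmoothFamily n a b Φ)
    (hg₀ : IsAdmissible g₀) (he : e ∈ atlas (Fin n → ℂ) X) :
    ContDiffOn ℝ ∞ (fun p : ℝ × (Fin n → ℂ) => (perturb g₀ (Φ p.1) e p.2).det.re)
      (Set.Icc a b ×ˢ e.target) :=
  contDiffOn_re (contDiffOn_det (hΦ.contDiffOn_perturb hab hg₀ he))

/-- The time derivative of the determinant, `∂ₜ det g = det(g) Δ ∂ₜφ`. -/
lemma SmoothFamily.hasDerivWithinAt_det (hab : a < b) (hΦ : SmoothFamily n a b Φ)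
    (he : e ∈ atlas (Fin n → ℂ) X) {t : ℝ} (ht : t ∈ Set.Icc a b)
    (hg : IsAdmissible (perturb g₀ (Φ t))) {z : Fin n → ℂ} (hz : z ∈ e.target) :
    HasDerivWithinAt (fun s => (perturb g₀ (Φ s) e z).det.re)
      ((perturb g₀ (Φ t) e z).det.re * lapl (perturb g₀ (Φ t) e)
        (fun w => derivWithin (fun s => Φ s (e.symm w)) (Set.Icc a b) t) z) (Set.Icc a b) t := by
  have h1 : ∀ i j, HasDerivWithinAt (fun s => perturb g₀ (Φ s) e z i j)
      (ddbar (fun w => derivWithin (fun s => Φ s (e.symm w)) (Set.Icc a b) t) z i j)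
      (Set.Icc a b) t := fun i j =>
    (hasDerivWithinAt_ddbar (Φ := fun r z => Φ r (e.symm z)) hab e.open_target (hΦ e he)
      ht hz i j).const_add (g₀ e z i j)
  have h2 := Complex.reCLM.hasFDerivAt.comp_hasDerivWithinAt t
    (hasFDerivWithinAt_det (h := fun s => perturb g₀ (Φ s) e z)
      fun i j => (h1 i j).hasFDerivWithinAt).hasDerivWithinAt
  refine h2.congr_deriv ?_
  rw [lapl, ← Complex.re_ofReal_mul, ofReal_det_re (hg.herm e he z hz), Complex.reCLM_apply]
  congr 1
  simp only [Finset.mul_sum, _root_.sum_apply, _root_.smul_apply, smul_eq_mul,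
    ContinuousLinearMap.toSpanSingleton_apply, one_smul, invMetric,
    adjugate_eq_det_mul_inv _ (hg.det_ne_zero he hz), mul_assoc]

lemma SmoothFamily.hasDerivWithinAt_logRatio (hab : a < b) (hΦ : SmoothFamily n a b Φ)
    (hg₀ : IsAdmissible g₀) (he : e ∈ atlas (Fin n → ℂ) X) {t : ℝ} (ht : t ∈ Set.Icc a b)
    (hg : IsAdmissible (perturb g₀ (Φ t))) {z : Fin n → ℂ} (hz : z ∈ e.target) :
    HasDerivWithinAt (fun s => logRatio g₀ F (perturb g₀ (Φ s)) e z)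
      (lapl (perturb g₀ (Φ t) e)
        (fun w => derivWithin (fun s => Φ s (e.symm w)) (Set.Icc a b) t) z) (Set.Icc a b) t := by
  have hp := hg.det_pos e he z hz
  have hp₀ := hg₀.det_pos e he z hz
  have h1 := (((hΦ.hasDerivWithinAt_det hab he ht hg hz).div_const (g₀ e z).det.re).log
    (div_pos hp hp₀).ne').sub_const (F (e.symm z))
  refine h1.congr_deriv ?_
  field_simp

variable [CompactSpace X] [IsManifold 𝓘(ℂ, Fin n → ℂ) ω X] [MeasurableSpace X]
  [BorelSpace X]

/-- The domains on the right are compact and do not depend on g, which allows differentiation under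
the integral while the metric and its measure both move. -/
lemma integral_volForm_eq_sum {g : LocalCoeff n X} (hg : IsAdmissible g) {t : Finset X}
    {χ : X → X → ℝ} (hχ : ∀ p, SmoothInCharts n (χ p))
    (hχs : ∀ p, tsupport (χ p) ⊆ (chartAt (Fin n → ℂ) p).source)
    (hχ1 : ∀ x, ∑ p ∈ t, χ p x = 1) {f : X → ℝ} (hf : SmoothInCharts n f) :
    ∫ x, f x ∂(volForm g) = ∑ p ∈ t, ∫ z in chartAt (Fin n → ℂ) p '' tsupport (χ p),
      density g (chartAt (Fin n → ℂ) p) z * (χ p ((chartAt (Fin n → ℂ) p).symm z) *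
        f ((chartAt (Fin n → ℂ) p).symm z)) := by
  have hK : ∀ p, IsCompact (tsupport (χ p)) := fun p => (isClosed_tsupport _).isCompact
  have h1 := fun p => integrable_and_integral_volForm hg (chart_mem_atlas _ p) (hK p) (hχs p)
    (((hχ p).mul hf).continuous.continuousOn) (eq_zero_off_tsupport f)
  have e1 : ∀ x, f x = ∑ p ∈ t, χ p x * f x := fun x => by rw [← Finset.sum_mul, hχ1, one_mul]
  rw [integral_congr_ae (Filter.Eventually.of_forall e1)]
  rw [integral_finsetSum _ fun p _ => (h1 p).1]
  refine Finset.sum_congr rfl fun p _ => ?_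
  rw [(h1 p).2]
  refine setIntegral_eq_of_subset_of_forall_sdiff_eq_zero
    (chartAt _ p).open_target.measurableSet (isCompact_image_chart (hK p) (hχs p)).2
    fun z hz => ?_
  rw [eq_zero_off_image (eq_zero_off_tsupport f) z hz.1 hz.2, mul_zero]

/-- The first variation of the Mabuchi energy. -/
theorem hasDerivWithinAt_mabuchi [T2Space X] (hab : a < b) (hΦ : SmoothFamily n a b Φ)
    (H : ∀ s ∈ Set.Icc a b, IsVariational g₀ F (perturb g₀ (Φ s))) {t : ℝ}
    (ht : t ∈ Set.Icc a b) :
    HasDerivWithinAt (fun s => mabuchi g₀ F (perturb g₀ (Φ s)))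
      (-(1 / totalVol g₀ * ∫ x, derivWithin (fun s => Φ s x) (Set.Icc a b) t *
        flowSpeed g₀ F (perturb g₀ (Φ t)) x ∂(volForm (perturb g₀ (Φ t))))) (Set.Icc a b) t := by
  obtain ⟨T, χ, hχ, hχs, hχ1⟩ := exists_partition_of_unity n X
  set Φ' : ℝ → X → ℝ := fun t x => derivWithin (fun s => Φ s x) (Set.Icc a b) t with hΦ'
  have hΦs : SmoothFamily n a b Φ' := hΦ.velocity hab
  have hg₀ := (H t ht).ref
  have hF := (H t ht).smooth
  set G : X → ℝ → (Fin n → ℂ) → ℝ := fun p s z =>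
    density (perturb g₀ (Φ s)) (chartAt (Fin n → ℂ) p) z *
      (χ p ((chartAt (Fin n → ℂ) p).symm z) *
        logRatio g₀ F (perturb g₀ (Φ s)) (chartAt (Fin n → ℂ) p) z) with hG
  set G' : X → ℝ → (Fin n → ℂ) → ℝ := fun p s z =>
    density (perturb g₀ (Φ s)) (chartAt (Fin n → ℂ) p) z *
      (χ p ((chartAt (Fin n → ℂ) p).symm z) *
        ((1 + logRatio g₀ F (perturb g₀ (Φ s)) (chartAt (Fin n → ℂ) p) z) *
          lapl (perturb g₀ (Φ s) (chartAt (Fin n → ℂ) p))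
            (fun w => Φ' s ((chartAt (Fin n → ℂ) p).symm w)) z)) with hG'
  -- By the product rule the density contributes (log ratio) Δφ̇ and the logarithm contributes Δφ̇,
  -- each times the density; this is the factor 1 + log ratio in `G'`.
  have hder : ∀ p, HasDerivWithinAt
      (fun s => ∫ z in chartAt (Fin n → ℂ) p '' tsupport (χ p), G p s z)
      (∫ z in chartAt (Fin n → ℂ) p '' tsupport (χ p), G' p t z) (Set.Icc a b) t := by
    intro p
    set e := chartAt (Fin n → ℂ) p
    have he : e ∈ atlas (Fin n → ℂ) X := chart_mem_atlas _ p
    obtain ⟨hKc, hKe⟩ := isCompact_image_chart (isClosed_tsupport (χ p)).isCompact (hχs p)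
    have hsub : Set.Icc a b ×ˢ (e '' tsupport (χ p)) ⊆ Set.Icc a b ×ˢ e.target :=
      Set.prod_mono_right hKe
    have hdet := hΦ.contDiffOn_det_perturb hab hg₀ he
    have hdet0 : ∀ q ∈ Set.Icc a b ×ˢ e.target, (perturb g₀ (Φ q.1) e q.2).det.re ≠ 0 :=
      fun q hq => ((H _ hq.1).adm.det_pos e he _ hq.2).ne'
    have hsnd : ∀ {f : (Fin n → ℂ) → ℝ}, ContDiffOn ℝ ∞ f e.target →
        ContDiffOn ℝ ∞ (fun q : ℝ × (Fin n → ℂ) => f q.2) (Set.Icc a b ×ˢ e.target) :=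
      fun hf => hf.comp contDiffOn_snd fun _ hq => hq.2
    have hdens : ContDiffOn ℝ ∞ (fun q : ℝ × (Fin n → ℂ) => density (perturb g₀ (Φ q.1)) e q.2)
        (Set.Icc a b ×ˢ e.target) := contDiffOn_const.mul hdet
    have hlog : ContDiffOn ℝ ∞
        (fun q : ℝ × (Fin n → ℂ) => logRatio g₀ F (perturb g₀ (Φ q.1)) e q.2)
        (Set.Icc a b ×ˢ e.target) :=
      ((hdet.div (hsnd (contDiffOn_det_re hg₀ he)) fun q hq =>
        (hg₀.det_pos e he _ hq.2).ne').log fun q hq =>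
          div_ne_zero (hdet0 q hq) (hg₀.det_pos e he _ hq.2).ne').sub (hsnd (hF e he))
    have hlapl : ContDiffOn ℝ ∞ (fun q : ℝ × (Fin n → ℂ) =>
        lapl (perturb g₀ (Φ q.1) e) (fun w => Φ' q.1 (e.symm w)) q.2)
        (Set.Icc a b ×ˢ e.target) :=
      contDiffOn_re (ContDiffOn.sum fun i _ => ContDiffOn.sum fun j _ =>
        (contDiffOn_inv (h := fun q : ℝ × (Fin n → ℂ) => perturb g₀ (Φ q.1) e q.2)
          (hΦ.contDiffOn_perturb hab hg₀ he)
          (fun q hq => (H _ hq.1).adm.det_ne_zero he hq.2) j i).mul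
        (contDiffOn_ddbar_slice (Φ := fun r z => Φ' r (e.symm z)) hab e.open_target
          (hΦs e he) i j))
    refine hasDerivWithinAt_setIntegral hKc ?_ ?_ ?_ ht
    · exact ((hdens.mul ((hsnd (hχ p e he)).mul hlog)).continuousOn).mono hsub
    · exact ((hdens.mul ((hsnd (hχ p e he)).mul
        ((contDiffOn_const.add hlog).mul hlapl))).continuousOn).mono hsub
    · intro s hs z hz
      have d1 := (hΦ.hasDerivWithinAt_det hab he hs (H s hs).adm (hKe hz)).const_mul
        ((n.factorial : ℝ) * 2 ^ n)
      have d2 := (hΦ.hasDerivWithinAt_logRatio (F := F) hab hg₀ he hs (H s hs).adm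
        (hKe hz)).const_mul (χ p (e.symm z))
      refine (d1.mul d2).congr_deriv ?_
      simp only [hG', density]
      ring
  have hmab : ∀ s ∈ Set.Icc a b, mabuchi g₀ F (perturb g₀ (Φ s)) = 1 / totalVol g₀ *
      (∑ p ∈ T, ∫ z in chartAt (Fin n → ℂ) p '' tsupport (χ p), G p s z) +
      1 / totalVol g₀ * ∫ x, F x ∂(volForm g₀) := by
    intro s hs
    have hinv := isInvariant_logRatio hg₀ (H s hs).adm F
    have hsm := smoothInCharts_glue hinv
      fun e he => contDiffOn_logRatio hg₀ (H s hs).adm he hF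
    have h1 := integral_volForm_eq_sum (H s hs).adm hχ hχs hχ1 hsm
    rw [mabuchi]
    congr 2
    refine h1.trans (Finset.sum_congr rfl fun p _ => ?_)
    obtain ⟨hKc, hKe⟩ := isCompact_image_chart (isClosed_tsupport (χ p)).isCompact (hχs p)
    refine setIntegral_congr_fun hKc.measurableSet fun z hz => ?_
    simp only [hG]
    rw [glue_symm hinv (chart_mem_atlas _ p) (hKe hz)]
  -- Reassembling the pieces gives the global integral of the Green integrand for the velocity, to
  -- which Green's formula applies.
  have hval : ∑ p ∈ T, ∫ z in chartAt (Fin n → ℂ) p '' tsupport (χ p), G' p t z =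
      -∫ x, Φ' t x * flowSpeed g₀ F (perturb g₀ (Φ t)) x ∂(volForm (perturb g₀ (Φ t))) := by
    have hsl := hΦs.slice ht
    rw [← (H t ht).integral_greenIntegrand hsl, integral_volForm_eq_sum (H t ht).adm hχ hχs hχ1
      ((H t ht).smooth_greenIntegrand hsl)]
    refine Finset.sum_congr rfl fun p _ => ?_
    obtain ⟨hKc, hKe⟩ := isCompact_image_chart (isClosed_tsupport (χ p)).isCompact (hχs p)
    refine setIntegral_congr_fun hKc.measurableSet fun z hz => ?_
    simp only [hG', greenIntegrand]
    rw [glue_symm ((H t ht).isInvariant_green hsl) (chart_mem_atlas _ p) (hKe hz)]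
  have h := ((HasDerivWithinAt.fun_sum fun p (_ : p ∈ T) => hder p).const_mul
    (1 / totalVol g₀)).add_const (1 / totalVol g₀ * ∫ x, F x ∂(volForm g₀))
  rw [hval, mul_neg] at h
  exact h.congr hmab (hmab t ht)

end variation

/-! ### The flow -/

section flow

variable {X : Type*} [TopologicalSpace X] [ChartedSpace (Fin n → ℂ) X]
  [IsManifold 𝓘(ℂ, Fin n → ℂ) ω X] {g₀ : LocalCoeff n X} {F : X → ℝ}

lemma isVariational_perturb [MeasurableSpace X] (hg₀ : IsHermitianMetric g₀)
    (hdd : ∀ k ∈ ({1, 2} : Set ℕ), DDbarPowEqZero g₀ k) (hF : IsChernRicciPotential g₀ F)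
    {f : X → ℝ} (hf : SmoothInCharts n f)
    (hpos : ∀ e ∈ atlas (Fin n → ℂ) X, ∀ z ∈ e.target, 0 < (perturb g₀ f e z).det.re) :
    IsVariational g₀ F (perturb g₀ f) where
  ref := hg₀.isAdmissible
  adm := isAdmissible_perturb hg₀.isAdmissible hf hpos
  pluriclosed e he z hz :=
    (isPluriclosedAt_of_ddbarPow e.open_target hz (hg₀.smooth e he)
      (hdd 1 (by simp) e he z hz) (hdd 2 (by simp) e he z hz)).add_ddbar e.open_target hz
      (hg₀.smooth e he) (contDiffOn_ofReal (hf e he))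
  smooth := smoothInCharts_of_contMDiff hF.smooth
  ricci := hF.ricci

/-- Positivity of the determinant is an open condition along a smooth family of potentials. -/
lemma eventually_det_perturb_pos [CompactSpace X] {a b : ℝ} {Φ : ℝ → X → ℝ}
    (hΦ : SmoothFamily n a b Φ) (hg₀ : IsAdmissible g₀) {t : ℝ} (ht : t ∈ Set.Ioo a b)
    (hg : IsAdmissible (perturb g₀ (Φ t))) :
    ∀ᶠ s in nhds t, ∀ e ∈ atlas (Fin n → ℂ) X, ∀ z ∈ e.target,
      0 < (perturb g₀ (Φ s) e z).det.re := by
  -- Near each point, continuity in one chart is enough: determinants in the other charts differ by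
  -- the positive factor |det J|². Compactness of X then makes the time neighbourhood uniform.
  have key : ∀ᶠ s in nhds t, ∀ x ∈ (Set.univ : Set X), s ∈ Set.Icc a b →
      ∀ e ∈ atlas (Fin n → ℂ) X, x ∈ e.source → 0 < (perturb g₀ (Φ s) e (e x)).det.re := by
    refine isCompact_univ.eventually_forall_of_forall_eventually fun x _ => ?_
    set c := chartAt (Fin n → ℂ) x
    have hc : c ∈ atlas (Fin n → ℂ) X := chart_mem_atlas _ x
    have hx : x ∈ c.source := mem_chart_source _ x
    have hcx : c x ∈ c.target := c.map_source hx
    obtain ⟨D, hD⟩ : ∃ D : ℝ × (Fin n → ℂ) → ℝ,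
        ∀ p, D p = (perturb g₀ (Φ p.1) c p.2).det.re := ⟨_, fun _ => rfl⟩
    have h1 : ContinuousAt D (t, c x) := by
      have := (hΦ.contDiffOn_det_perturb (ht.1.trans ht.2) hg₀ hc).continuousOn.continuousAt
        (prod_mem_nhds (Icc_mem_nhds ht.1 ht.2) (c.open_target.mem_nhds hcx))
      rwa [← funext hD] at this
    have h2 : ContinuousAt (fun p : ℝ × X => (p.1, c p.2)) (t, x) :=
      continuousAt_fst.prodMk
        (ContinuousAt.comp (f := Prod.snd) (g := c) (c.continuousAt hx) continuousAt_snd)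
    have h3 : ContinuousAt (fun p : ℝ × X => D (p.1, c p.2)) (t, x) :=
      ContinuousAt.comp (f := fun p : ℝ × X => (p.1, c p.2)) (g := D) h1 h2
    have h0 : 0 < D (t, c x) := by
      rw [hD]
      exact hg.det_pos c hc _ hcx
    have h4 := h3.eventually (lt_mem_nhds h0)
    have h5 : ∀ᶠ p : ℝ × X in nhds (t, x), p.2 ∈ c.source :=
      continuousAt_snd.eventually (c.open_source.mem_nhds hx)
    filter_upwards [h4, h5] with p hp hpc hpI e he hpe
    rw [hD] at hp
    have ho : e p.2 ∈ overlap e c :=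
      ⟨e.map_source hpe, by rw [Set.mem_preimage, e.left_inv hpe]; exact hpc⟩
    rw [det_re_of_transform (perturb_transform hg₀ (hΦ.slice hpI) he hc ho), transition,
      e.left_inv hpe]
    exact mul_pos (Complex.normSq_pos.2 (hg.det_jac_ne_zero he hc ho)) hp
  filter_upwards [key, Icc_mem_nhds ht.1 ht.2] with s hs hsI e he z hz
  have := hs _ (Set.mem_univ (e.symm z)) hsI e he (e.map_target hz)
  rwa [e.right_inv hz] at this

omit [IsManifold 𝓘(ℂ, Fin n → ℂ) ω X] in
lemma smoothFamily_add_mul {a b : ℝ} {φ ψ : X → ℝ} (hφ : SmoothInCharts n φ)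
    (hψ : SmoothInCharts n ψ) : SmoothFamily n a b fun s x => φ x + s * ψ x := fun e he =>
  ((hφ e he).comp contDiffOn_snd fun _ hp => hp.2).add
    (contDiffOn_fst.mul ((hψ e he).comp contDiffOn_snd fun _ hp => hp.2))

lemma smoothFamily_of_contMDiffOn {a b : ℝ} {S : Set ℝ} (hS : Set.Icc a b ⊆ S) {φ : ℝ → X → ℝ}
    (hφ : ContMDiffOn (𝓘(ℝ, ℝ).prod 𝓘(ℝ, Fin n → ℂ)) 𝓘(ℝ, ℝ) ∞ (fun p : ℝ × X => φ p.1 p.2)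
      (S ×ˢ Set.univ)) : SmoothFamily n a b φ := by
  have := isManifold_real (n := n) X
  intro e he
  have h1 := contMDiffOn_symm_of_mem_maximalAtlas (I := 𝓘(ℝ, Fin n → ℂ)) (n := ∞)
    (IsManifold.subset_maximalAtlas he)
  have h2 : ContMDiffOn 𝓘(ℝ, ℝ × (Fin n → ℂ)) 𝓘(ℝ, Fin n → ℂ) ∞
      (fun p : ℝ × (Fin n → ℂ) => e.symm p.2) (Set.Icc a b ×ˢ e.target) :=
    h1.comp (contDiff_snd.contMDiff.contMDiffOn) fun p hp => hp.2
  have h3 : ContMDiffOn 𝓘(ℝ, ℝ × (Fin n → ℂ)) 𝓘(ℝ, ℝ) ∞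
      (fun p : ℝ × (Fin n → ℂ) => p.1) (Set.Icc a b ×ˢ e.target) :=
    contDiff_fst.contMDiff.contMDiffOn
  have h4 := hφ.comp (h3.prodMk h2) fun p hp => ⟨hS hp.1, trivial⟩
  exact contMDiffOn_iff_contDiffOn.1 h4

/-- [0, c] is a neighbourhood of t within [0, T), so derivatives within the two sets agree and the
compact-interval results apply, also at t = 0 and for T = ∞. -/
lemma exists_Icc_subset_timeInterval {T : EReal} {t : ℝ} (ht : t ∈ timeInterval T) :
    ∃ c, t < c ∧ Set.Icc 0 c ⊆ timeInterval T ∧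
      Set.Icc 0 c ∈ nhdsWithin t (timeInterval T) := by
  obtain ⟨c, htc, hcT⟩ := EReal.lt_iff_exists_real_btwn.1 ht.2
  have htc' : t < c := EReal.coe_lt_coe_iff.1 htc
  refine ⟨c, htc', fun s hs => ⟨hs.1, lt_of_le_of_lt (EReal.coe_le_coe_iff.2 hs.2) hcT⟩, ?_⟩
  filter_upwards [self_mem_nhdsWithin, mem_nhdsWithin_of_mem_nhds (Iio_mem_nhds htc')] with s h1 h2
  exact ⟨h1.1, le_of_lt h2⟩

lemma convex_timeInterval (T : EReal) : Convex ℝ (timeInterval T) :=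
  Set.OrdConnected.convex ⟨fun _ hx _ hy _ hz =>
    ⟨hx.1.trans hz.1, lt_of_le_of_lt (EReal.coe_le_coe_iff.2 hz.2) hy.2⟩⟩

variable [T2Space X] [CompactSpace X] [MeasurableSpace X] [BorelSpace X]

/-- The first variation pairs the velocity with the flow speed, and along the flow these are the
same function. -/
theorem hasDerivWithinAt_mabuchi_flow (hg₀ : IsHermitianMetric g₀)
    (hdd : ∀ k ∈ ({1, 2} : Set ℕ), DDbarPowEqZero g₀ k) (hF : IsChernRicciPotential g₀ F)
    {T : EReal} {φ : ℝ → X → ℝ} (hφ : IsFlowSolution g₀ F T φ) {t : ℝ}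
    (ht : t ∈ timeInterval T) :
    HasDerivWithinAt (fun s => mabuchi g₀ F (perturb g₀ (φ s)))
      (-(1 / totalVol g₀ * ∫ x, (derivWithin (fun s => φ s x) (timeInterval T) t) ^ 2
        ∂(volForm (perturb g₀ (φ t))))) (timeInterval T) t := by
  obtain ⟨c, htc, hcT, hnhds⟩ := exists_Icc_subset_timeInterval ht
  have h0c : 0 < c := ht.1.trans_lt htc
  have htI : t ∈ Set.Icc 0 c := ⟨ht.1, htc.le⟩
  have hΦ : SmoothFamily n 0 c φ := smoothFamily_of_contMDiffOn hcT hφ.smooth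
  have h := hasDerivWithinAt_mabuchi h0c hΦ (fun s hs => isVariational_perturb hg₀ hdd hF
    (hΦ.slice hs) fun e he z hz => det_re_pos_of_posDef (hφ.pos s (hcT hs) e he z hz)) htI
  have hu : UniqueDiffWithinAt ℝ (Set.Icc 0 c) t := uniqueDiffOn_Icc h0c t htI
  refine (h.mono_of_mem_nhdsWithin hnhds).congr_deriv ?_
  congr 2
  refine integral_congr_ae (Filter.Eventually.of_forall fun x => ?_)
  have hx := hφ.evolution t ht x
  simp only
  rw [(hx.mono hcT).derivWithin hu, hx.derivWithin (hu.mono hcT), sq]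

theorem antitoneOn_mabuchi_flow (hg₀ : IsHermitianMetric g₀)
    (hdd : ∀ k ∈ ({1, 2} : Set ℕ), DDbarPowEqZero g₀ k) (hF : IsChernRicciPotential g₀ F)
    {T : EReal} {φ : ℝ → X → ℝ} (hφ : IsFlowSolution g₀ F T φ) :
    AntitoneOn (fun t => mabuchi g₀ F (perturb g₀ (φ t))) (timeInterval T) := by
  have h := fun t (ht : t ∈ timeInterval T) => hasDerivWithinAt_mabuchi_flow hg₀ hdd hF hφ ht
  refine antitoneOn_of_hasDerivWithinAt_nonpos (convex_timeInterval T)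
    (fun t ht => (h t ht).continuousWithinAt)
    (fun t ht => (h t (interior_subset ht)).mono interior_subset) fun t _ => ?_
  -- Nonnegativity of V is enough for the sign of the derivative; strict positivity is not used.
  have hV : 0 ≤ totalVol g₀ := integral_nonneg fun _ => zero_le_one
  exact neg_nonpos.2 (mul_nonneg (div_nonneg zero_le_one hV)
    (integral_nonneg fun x => sq_nonneg _))

theorem hasDerivAt_mabuchi (hg₀ : IsHermitianMetric g₀)
    (hdd : ∀ k ∈ ({1, 2} : Set ℕ), DDbarPowEqZero g₀ k) (hF : IsChernRicciPotential g₀ F)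
    {φ ψ : X → ℝ} (hφ : SmoothInCharts n φ) (hpos : IsPositive (perturb g₀ φ))
    (hψ : SmoothInCharts n ψ) :
    HasDerivAt (fun s : ℝ => mabuchi g₀ F (perturb g₀ (fun x => φ x + s * ψ x)))
      (-(1 / totalVol g₀ * ∫ x, ψ x * flowSpeed g₀ F (perturb g₀ φ) x
        ∂(volForm (perturb g₀ φ)))) 0 := by
  set Φ : ℝ → X → ℝ := fun s x => φ x + s * ψ x with hΦdef
  have hΦ0 : Φ 0 = φ := by simp [hΦdef]
  have hΦ1 : SmoothFamily n (-1) 1 Φ := smoothFamily_add_mul hφ hψ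
  have hev := eventually_det_perturb_pos hΦ1 hg₀.isAdmissible (t := 0) (by norm_num)
    (by
      rw [hΦ0]
      exact isAdmissible_perturb hg₀.isAdmissible hφ
        fun e he z hz => det_re_pos_of_posDef (hpos e he z hz))
  -- Halving ε puts the closed interval [-ε/2, ε/2] inside the open ball where the determinant is
  -- positive. Positive definiteness for s ≠ 0 is not needed, since admissibility asks only for a
  -- positive determinant.
  obtain ⟨ε, hε, hball⟩ := Metric.eventually_nhds_iff.1 hev
  have hδ : -(ε / 2) < ε / 2 := by linarith
  have hδ0 : (0 : ℝ) ∈ Set.Icc (-(ε / 2)) (ε / 2) := ⟨by linarith, by linarith⟩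
  have hΦ : SmoothFamily n (-(ε / 2)) (ε / 2) Φ := smoothFamily_add_mul hφ hψ
  have h := hasDerivWithinAt_mabuchi hδ hΦ (fun s hs => isVariational_perturb hg₀ hdd hF
    (hΦ.slice hs) (hball (by
      rw [Real.dist_eq, sub_zero]
      exact (abs_le.2 hs).trans_lt (by linarith)))) hδ0
  have hd : ∀ x, derivWithin (fun s => Φ s x) (Set.Icc (-(ε / 2)) (ε / 2)) 0 = ψ x := by
    intro x
    have h1 : HasDerivAt (fun s => Φ s x) (1 * ψ x) 0 :=
      ((hasDerivAt_id (0 : ℝ)).mul_const (ψ x)).const_add (φ x)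
    rw [h1.hasDerivWithinAt.derivWithin (uniqueDiffOn_Icc hδ 0 hδ0), one_mul]
  simp_rw [hd, hΦ0] at h
  exact h.hasDerivAt (Icc_mem_nhds (by linarith) (by linarith))

end flow

end ChernCalabi

end

/-! ### The main theorem. -/

theorem mainTheorem4 {n : ℕ} {X : Type*} [TopologicalSpace X] [T2Space X] [CompactSpace X]
    [ChartedSpace (Fin n → ℂ) X] [IsManifold 𝓘(ℂ, Fin n → ℂ) ω X]
    [MeasurableSpace X] [BorelSpace X]
    (g₀ : ChernCalabi.LocalCoeff n X) (hg₀ : ChernCalabi.IsHermitianMetric g₀)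
    (hdd : ∀ k ∈ ({1, 2} : Set ℕ), ChernCalabi.DDbarPowEqZero g₀ k)
    (F : X → ℝ) (hF : ChernCalabi.IsChernRicciPotential g₀ F) :
    -- along the flow, the derivative of the Mabuchi energy is minus the squared `L²`-norm of the
    -- velocity, and the Mabuchi energy decreases
    (∀ (T : EReal) (φ : ℝ → X → ℝ), ChernCalabi.IsFlowSolution g₀ F T φ →
      (∀ t ∈ ChernCalabi.timeInterval T,
        HasDerivWithinAt (fun s => ChernCalabi.mabuchi g₀ F (ChernCalabi.perturb g₀ (φ s)))
          (-(1 / ChernCalabi.totalVol g₀ *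
            ∫ x, (derivWithin (fun s => φ s x) (ChernCalabi.timeInterval T) t) ^ 2
              ∂(ChernCalabi.volForm (ChernCalabi.perturb g₀ (φ t)))))
          (ChernCalabi.timeInterval T) t) ∧
      AntitoneOn (fun t => ChernCalabi.mabuchi g₀ F (ChernCalabi.perturb g₀ (φ t)))
        (ChernCalabi.timeInterval T)) ∧
    -- gradient flow: at every metric `ω_φ`, the right-hand side of the flow is minus the
    -- `L²`-gradient of the Mabuchi energy
    (∀ φ : X → ℝ, ContMDiff 𝓘(ℝ, Fin n → ℂ) 𝓘(ℝ, ℝ) ∞ φ →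
      ChernCalabi.IsPositive (ChernCalabi.perturb g₀ φ) →
      ∀ ψ : X → ℝ, ContMDiff 𝓘(ℝ, Fin n → ℂ) 𝓘(ℝ, ℝ) ∞ ψ →
        HasDerivAt
          (fun s : ℝ => ChernCalabi.mabuchi g₀ F (ChernCalabi.perturb g₀ (fun x => φ x + s * ψ x)))
          (-(1 / ChernCalabi.totalVol g₀ *
            ∫ x, ψ x * ChernCalabi.flowSpeed g₀ F (ChernCalabi.perturb g₀ φ) x
              ∂(ChernCalabi.volForm (ChernCalabi.perturb g₀ φ)))) 0) := by
  refine ⟨fun T φ hφ => ⟨fun t ht => ?_, ?_⟩, fun φ hφ hpos ψ hψ => ?_⟩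
  · exact ChernCalabi.hasDerivWithinAt_mabuchi_flow hg₀ hdd hF hφ ht
  · exact ChernCalabi.antitoneOn_mabuchi_flow hg₀ hdd hF hφ
  · exact ChernCalabi.hasDerivAt_mabuchi hg₀ hdd hF (ChernCalabi.smoothInCharts_of_contMDiff hφ)
      hpos (ChernCalabi.smoothInCharts_of_contMDiff hψ)
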